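/- Let $n,r\ge 0$ be integers and $\mathcal R=\mathbb C[q^{\pm1},Q_1^{\pm1},\dots,Q_r^{\pm1}]$. Let $\mathcal H_{n,r}$ be the cyclotomic Hecke (Ariki–Koike) algebra: the associative unital $\mathcal R$-algebra generated by $L_1,\dots,L_n,T_1,\dots,T_{n-1}$ with relations $T_iT_j=T_jT_i$ for $|i-j|>1$; $L_iL_j=L_jL_i$; $T_iL_j=L_jT_i$ for $j\ne i,i+1$; $T_iT_{i+1}T_i=T_{i+1}T_iT_{i+1}$; $(T_i+1)(T_i-q)=0$; $qL_{i+1}=T_iL_iT_i$; and (if $n\ge1$) $\prod_{c=1}^r(L_1-Q_c)=0$. Let $Z(\mathcal H_{n,r})^{\mathrm{JM}}\subset\mathcal H_{n,r}$ be the Jucys–Murphy center, i.e. the $\mathcal R$-subalgebra of all symmetric polynomials in $L_1,\dots,L_n$ with coefficients in $\mathcal R$. Let $\mathcal P^r_n$ be the set of $r$-multipartitions of $n$ with the dominance order $\trianglerighteq$. For $\lambda=(\lambda^1,\dots,\lambda^r)\in\mathcal P^r_n$ put $m_\lambda=u_\lambda x_\lambda$, where $u_\lambda=\prod_{c=1}^r\prod_{k=1}^{|\lambda^1|+\dots+|\lambda^{c-1}|}(L_k-Q_c)$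 and $x_\lambda=\sum_w T_w$, the sum over the row stabilizer in $\mathfrak S_n$ of the initial tableau of shape $\lambda$ (filled with $1,\dots,n$ along the rows of $\lambda^1$, then of $\lambda^2$, and so on), with $T_w=T_{i_1}\cdots T_{i_k}$ for a reduced expression $w=s_{i_1}\cdots s_{i_k}$. Let $\mathcal H^{\triangleright\lambda}$ be the two-sided ideal generated by the $m_\mu$ with $\mu\in\mathcal P^r_n$, $\mu\triangleright\lambda$. The Specht (cell) module $S^\lambda$ is the left $\mathcal H_{n,r}$-submodule of $\mathcal H_{n,r}/\mathcal H^{\triangleright\lambda}$ generated by the class of $m_\lambda$. Then for every $z\in Z(\mathcal H_{n,r})^{\mathrm{JM}}$ and $\lambda\in\mathcal P^r_n$ there is a unique scalar $\alpha_\lambda(z)\in\mathcal R$ such that $z$ acts on $S^\lambda$ as multiplication by $\alpha_\lambda(z)$; the map $$\sigma: Z(\mathcal H_{n,r})^{\mathrm{JM}}\to\bigoplus_{\lambda\in\mathcal P^r_n}\mathcal R,\qquad z\mapsto(\alpha_\lambda(z))_\lambda,$$ is a homomorphism of $\mathcal R$-algebras, and $\sigma$ is injective. -/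

import Mathlib

open MvPolynomial

noncomputable section

namespace ArikiKoike

/-! ### The base ring -/

/-- The Laurent polynomial ring `ℂ[q^±1, Q_1^±1, …, Q_r^±1]`: the variable `none` is `q`, the
variable `some c` is `Q_c`. -/
abbrev LaurentRing (r : ℕ) : Type :=
  Localization (Submonoid.closure
    (Set.range (X : Option (Fin r) → MvPolynomial (Option (Fin r)) ℂ)))

/-- A variable of the Laurent polynomial ring, as a unit. -/
def laurentVar (r : ℕ) (v : Option (Fin r)) : (LaurentRing r)ˣ :=
  (IsLocalization.map_units (M := Submonoid.closure
    (Set.range (X : Option (Fin r) → MvPolynomial (Option (Fin r)) ℂ))) (LaurentRing r)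
    ⟨X v, Submonoid.subset_closure ⟨v, rfl⟩⟩).unit

theorem coe_laurentVar (r : ℕ) (v : Option (Fin r)) :
    (laurentVar r v : LaurentRing r) =
      algebraMap (MvPolynomial (Option (Fin r)) ℂ) (LaurentRing r) (X v) := rfl

/-! ### The cyclotomic Hecke algebra -/

/-- Generators `L_1, …, L_n` and `T_1, …, T_{n-1}` (indexed from zero). -/
inductive Gen (n : ℕ) : Type
  | L (j : Fin n) : Gen n
  | T (i : Fin (n - 1)) : Gen n

/-- The index `i` of `T_i`, read in `Fin n`. -/
def lo {n : ℕ} (i : Fin (n - 1)) : Fin n := ⟨i.1, by omega⟩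

/-- The index `i + 1`, for `T_i`, read in `Fin n`. -/
def hi {n : ℕ} (i : Fin (n - 1)) : Fin n := ⟨i.1 + 1, by omega⟩

section Algebra

variable {A : Type} [CommRing A]

/-- The generator `L_j` in the free algebra. -/
def freeL (A : Type) [CommRing A] {n : ℕ} (j : Fin n) : FreeAlgebra A (Gen n) :=
  FreeAlgebra.ι A (Gen.L j)

/-- The generator `T_i` in the free algebra. -/
def freeT (A : Type) [CommRing A] {n : ℕ} (i : Fin (n - 1)) : FreeAlgebra A (Gen n) :=
  FreeAlgebra.ι A (Gen.T i)

/-- The defining relations of the cyclotomic Hecke algebra of `G(r,1,n)` over `A`. -/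
inductive Rel (n r : ℕ) (q : Aˣ) (Q : Fin r → A) :
    FreeAlgebra A (Gen n) → FreeAlgebra A (Gen n) → Prop
  | T_comm (i j : Fin (n - 1)) (h : i.1 + 1 < j.1 ∨ j.1 + 1 < i.1) :
      Rel n r q Q (freeT A i * freeT A j) (freeT A j * freeT A i)
  | L_comm (i j : Fin n) : Rel n r q Q (freeL A i * freeL A j) (freeL A j * freeL A i)
  | TL_comm (i : Fin (n - 1)) (j : Fin n) (h : j ≠ lo i) (h' : j ≠ hi i) :
      Rel n r q Q (freeT A i * freeL A j) (freeL A j * freeT A i)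
  | braid (i j : Fin (n - 1)) (h : j.1 = i.1 + 1) :
      Rel n r q Q (freeT A i * freeT A j * freeT A i) (freeT A j * freeT A i * freeT A j)
  | quadratic (i : Fin (n - 1)) :
      Rel n r q Q ((freeT A i + 1) * (freeT A i - algebraMap A _ (q : A))) 0
  | L_succ (i : Fin (n - 1)) :
      Rel n r q Q ((q : A) • freeL A (hi i)) (freeT A i * freeL A (lo i) * freeT A i)
  | cyclotomic (j : Fin n) (h : j.1 = 0) :
      Rel n r q Q
        (Polynomial.aeval (freeL A j) (∏ c : Fin r, (Polynomial.X - Polynomial.C (Q c)))) 0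

/-- The cyclotomic Hecke algebra (Ariki–Koike algebra) `H_{n,r}(A, (q, Q_1, …, Q_r))`. -/
abbrev HeckeOver (n r : ℕ) (q : Aˣ) (Q : Fin r → A) : Type :=
  RingQuot (Rel n r q Q)

end Algebra

/-- The algebra `H_{n,r}` over `ℂ[q^±1, Q_1^±1, …, Q_r^±1]` with the generic parameters. -/
abbrev Hecke (n r : ℕ) : Type :=
  HeckeOver n r (laurentVar r none) (fun c => (laurentVar r (some c) : LaurentRing r))

section Generic

variable {n r : ℕ}

/-- The Jucys–Murphy element `L_j` of `H_{n,r}`. -/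
def L (r : ℕ) {n : ℕ} (j : Fin n) : Hecke n r :=
  RingQuot.mkAlgHom (LaurentRing r) _ (freeL (LaurentRing r) j)

/-- The generator `T_i` of `H_{n,r}`. -/
def T (r : ℕ) {n : ℕ} (i : Fin (n - 1)) : Hecke n r :=
  RingQuot.mkAlgHom (LaurentRing r) _ (freeT (LaurentRing r) i)

theorem L_mul_comm (i j : Fin n) : L r i * L r j = L r j * L r i := by
  simpa only [map_mul, L] using RingQuot.mkAlgHom_rel (LaurentRing r)
    (Rel.L_comm (q := laurentVar r none)
      (Q := fun c => (laurentVar r (some c) : LaurentRing r)) i j)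

/-! ### The Jucys–Murphy center -/

theorem L_range_comm (n r : ℕ) :
    ∀ a ∈ Set.range (L r : Fin n → Hecke n r), ∀ b ∈ Set.range (L r : Fin n → Hecke n r),
      a * b = b * a := by
  rintro _ ⟨i, rfl⟩ _ ⟨j, rfl⟩
  exact L_mul_comm i j

/-- Evaluation `p ↦ p(L_1, …, L_n)` of polynomials at the (commuting) Jucys–Murphy elements. -/
def evalJM (n r : ℕ) : MvPolynomial (Fin n) (LaurentRing r) →ₐ[LaurentRing r] Hecke n r :=
  letI : CommRing (Algebra.adjoin (LaurentRing r) (Set.range (L r : Fin n → Hecke n r))) :=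
    { (Algebra.adjoin (LaurentRing r) (Set.range (L r : Fin n → Hecke n r))).toRing with
      mul_comm := (Algebra.isMulCommutative_adjoin (LaurentRing r)
        (L_range_comm n r)).is_comm.comm }
  (Algebra.adjoin (LaurentRing r) (Set.range (L r : Fin n → Hecke n r))).val.comp
    (MvPolynomial.aeval fun i => ⟨L r i, Algebra.subset_adjoin ⟨i, rfl⟩⟩)

theorem evalJM_X (i : Fin n) : evalJM n r (X i) = L r i := by
  simp [evalJM]

/-- The Jucys–Murphy center: all symmetric polynomials in `L_1, …, L_n`. -/
def JMCenter (n r : ℕ) : Subalgebra (LaurentRing r) (Hecke n r) :=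
  (symmetricSubalgebra (Fin n) (LaurentRing r)).map (evalJM n r)

/-! ### The elements `T_w` -/

/-- The product `s_{i_1} ⋯ s_{i_k}` of simple transpositions. -/
def wordPerm (l : List (Fin (n - 1))) : Equiv.Perm (Fin n) :=
  (l.map fun i => Equiv.swap (lo i) (hi i)).prod

theorem exists_word (w : Equiv.Perm (Fin n)) : ∃ l : List (Fin (n - 1)), wordPerm l = w := by
  cases n with
  | zero => exact ⟨[], Subsingleton.elim _ _⟩
  | succ m =>
    have hw : w ∈ Submonoid.closure
        (Set.range fun i : Fin m => Equiv.swap i.castSucc i.succ) := by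
      rw [Equiv.Perm.mclosure_swap_castSucc_succ]; trivial
    induction hw using Submonoid.closure_induction with
    | mem x hx =>
      obtain ⟨i, rfl⟩ := hx
      exact ⟨[i], by simp [wordPerm]; rfl⟩
    | one => exact ⟨[], rfl⟩
    | mul x y _ _ hx hy =>
      obtain ⟨l, rfl⟩ := hx
      obtain ⟨k, rfl⟩ := hy
      exact ⟨l ++ k, by simp [wordPerm]⟩

theorem exists_reduced (w : Equiv.Perm (Fin n)) : ∃ l : List (Fin (n - 1)),
    wordPerm l = w ∧ ∀ k : List (Fin (n - 1)), wordPerm k = w → l.length ≤ k.length := by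
  obtain ⟨l, hl, hmin⟩ := (measure List.length).wf.has_min
    {l : List (Fin (n - 1)) | wordPerm l = w} (exists_word w)
  exact ⟨l, hl, fun k hk => not_lt.mp (hmin k hk)⟩

/-- A reduced expression of `w` in the simple transpositions. -/
def reducedWord (w : Equiv.Perm (Fin n)) : List (Fin (n - 1)) :=
  (exists_reduced w).choose

/-- `T_w = T_{i_1} ⋯ T_{i_k}` for a reduced expression `w = s_{i_1} ⋯ s_{i_k}`. -/
def TPerm (r : ℕ) {n : ℕ} (w : Equiv.Perm (Fin n)) : Hecke n r :=
  ((reducedWord w).map (T r)).prod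

/-! ### Multipartitions -/

/-- The `r`-multipartitions of `n`. -/
abbrev Multipartition (r n : ℕ) : Type :=
  {lam : Fin r → YoungDiagram // ∑ c, (lam c).card = n}

/-- The number of boxes in the components before `c` and in the first `i` rows of
component `c`. -/
def partialSum (lam : Multipartition r n) (c : Fin r) (i : ℕ) : ℕ :=
  (∑ d ∈ Finset.univ.filter (· < c), (lam.1 d).card) + ∑ j ∈ Finset.range i, (lam.1 c).rowLen j

/-- Strict dominance: `mu ▷ lam`. -/
def StrictlyDominates (mu lam : Multipartition r n) : Prop :=
  (∀ c i, partialSum lam c i ≤ partialSum mu c i) ∧ mu ≠ lam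

/-- The entry `k` lies in row `i` of component `c` of the initial tableau of shape `lam`, into
which the numbers are entered along the rows of the first component, then of the second, and so
on. -/
def InRow (lam : Multipartition r n) (c : Fin r) (i : ℕ) (k : Fin n) : Prop :=
  partialSum lam c i ≤ k.1 ∧ k.1 < partialSum lam c (i + 1)

open Classical in
/-- The Young subgroup of `lam`: the row stabilizer of the initial tableau. -/
def youngSubgroup (lam : Multipartition r n) : Finset (Equiv.Perm (Fin n)) :=
  Finset.univ.filter fun w => ∀ c i k, InRow lam c i (w k) ↔ InRow lam c i k

/-! ### Specht modules -/

/-- `x_lam = ∑ T_w` over the Young subgroup of `lam`. -/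
def xElt (lam : Multipartition r n) : Hecke n r :=
  ∑ w ∈ youngSubgroup lam, TPerm r w

/-- `u_lam = ∏_c ∏_{k ≤ a_c} (L_k - Q_c)`, where `a_c = |lam^1| + ⋯ + |lam^{c-1}|` (the factors
commute; for the first component the product is empty). -/
def uElt (lam : Multipartition r n) : Hecke n r :=
  ((List.finRange r).map fun c =>
    (((List.finRange n).filter fun k => k.1 < partialSum lam c 0).map fun k =>
      L r k - algebraMap (LaurentRing r) (Hecke n r) (laurentVar r (some c) : LaurentRing r)).prod).prod

/-- The element `m_lam = u_lam x_lam`. -/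
def mElt (lam : Multipartition r n) : Hecke n r := uElt lam * xElt lam

/-- The two-sided ideal generated by the `m_mu` with `mu ▷ lam`, as a left ideal. It is the
span of the Murphy basis elements of shape strictly dominating `lam`. -/
def dominatingIdeal (lam : Multipartition r n) : Ideal (Hecke n r) :=
  (TwoSidedIdeal.span {a : Hecke n r | ∃ mu, StrictlyDominates mu lam ∧ a = mElt mu}).asIdeal

/-- The Specht (cell) module `S^lam`: the left `H_{n,r}`-submodule generated by the class of
`m_lam` in the quotient of `H_{n,r}` by the ideal of the shapes strictly dominating `lam`. -/
abbrev Specht (lam : Multipartition r n) : Submodule (Hecke n r) (Hecke n r ⧸ dominatingIdeal lam) :=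
  Submodule.span (Hecke n r) {Submodule.Quotient.mk (mElt lam)}

end Generic

end ArikiKoike

end

/-! Symmetric polynomials in the `L_k` are central: this is the Bernstein relation `T_mul_evalJM`,
whose correction term vanishes on polynomials invariant under the swap. A central element acts on
the cyclic module S^lam as it acts on the class of m_lam, and that class is a joint eigenvector:
`L_k` acts by the content Q_c q^(j-i) of the cell (c, i, j) of `k` in the initial tableau
(`L_smul_mElt`). At the head of a row this holds because q L_(k+1) = T_k L_k T_k carries the
operator up from the first entry of the component, while moving the head of a row to an earlier row
produces a multiple of m_g for a strictly dominating g, which is zero in the quotient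
(`exists_sum_cycT_mul_xSum`, `mCol_mem`). Along a row each step multiplies by q. Hence p(L) acts on
S^lam by the value of p at the contents of lam, which gives existence of the scalar.

Multipartitions are handled through monotone colorings of the entries by rows. For these, dominance
is the pointwise order, the dominating coloring being the smaller one (`le_iff_cnt_le`); it is well
founded, so induction and minimal choices are available.

Uniqueness of the scalar and injectivity both come from the seminormal representation over the
fraction field, on functions of all standard tableaux with n cells, where `L_k` is diagonal with the
contents as eigenvalues. The key is `exists_minimal_shape`: for a nonempty set C of tableaux closed
under the nonzero off-diagonal coefficients of the T_i, choose the most dominant lam for which m_lam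
acts nontrivially on functions supported on C. The ideal of lam then kills these functions, so m_lam
v is an eigenvector with the contents of the initial tableau of lam, and that tableau belongs to C.
Taking for C all tableaux of one shape shows that the class of m_lam is torsion free. Taking for C a
connected component shows that tableaux of the same shape are connected, so the image spans the full
matrix algebra of every shape.

The representation is faithful by counting: the r^n n! elements L^a T_w with a_i < r span the
algebra (`span_stdElt`), and the matrix units number the sum of f_D^2, which is r^n n!
(`sum_card_tab_sq`). Finally, if all scalars of z = p(L) vanish, then p vanishes at the contents of
every standard tableau, being symmetric, so z acts by zero in a faithful representation. -/

noncomputable section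
namespace ArikiKoike

variable {n r : ℕ}

/-! ### Inversions and reduced words -/

/-- The simple transposition exchanging `i` and `i + 1`. -/
def simpleSwap (i : Fin (n - 1)) : Equiv.Perm (Fin n) := Equiv.swap (lo i) (hi i)

theorem lo_lt_hi (i : Fin (n - 1)) : lo i < hi i := by simp [lo, hi, Fin.lt_def]

theorem lo_ne_hi (i : Fin (n - 1)) : lo i ≠ hi i := (lo_lt_hi i).ne

@[simp] theorem simpleSwap_lo (i : Fin (n - 1)) : simpleSwap i (lo i) = hi i :=
  Equiv.swap_apply_left _ _

@[simp] theorem simpleSwap_hi (i : Fin (n - 1)) : simpleSwap i (hi i) = lo i :=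
  Equiv.swap_apply_right _ _

@[simp] theorem simpleSwap_mul_self (i : Fin (n - 1)) : simpleSwap i * simpleSwap i = 1 :=
  Equiv.swap_mul_self _ _

@[simp] theorem simpleSwap_inv (i : Fin (n - 1)) : (simpleSwap i)⁻¹ = simpleSwap i :=
  Equiv.swap_inv _ _

@[simp] theorem simpleSwap_mul_cancel (i : Fin (n - 1)) (w : Equiv.Perm (Fin n)) :
    simpleSwap i * (simpleSwap i * w) = w := by
  rw [← mul_assoc, simpleSwap_mul_self, one_mul]

theorem simpleSwap_of_ne {i : Fin (n - 1)} {x : Fin n} (h : x ≠ lo i) (h' : x ≠ hi i) :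
    simpleSwap i x = x := Equiv.swap_apply_of_ne_of_ne h h'

theorem simpleSwap_val (i : Fin (n - 1)) (x : Fin n) :
    (simpleSwap i x).1 = if x.1 = i.1 then i.1 + 1 else if x.1 = i.1 + 1 then i.1 else x.1 := by
  by_cases h : x = lo i
  · rw [h, simpleSwap_lo]; simp [lo, hi]
  by_cases h' : x = hi i
  · rw [h', simpleSwap_hi]; simp [lo, hi]
  rw [simpleSwap_of_ne h h', if_neg, if_neg]
  · intro e; exact h' (Fin.ext e)
  · intro e; exact h (Fin.ext e)

theorem perm_apply_inv (w : Equiv.Perm (Fin n)) (x : Fin n) : w (w⁻¹ x) = x :=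
  w.apply_symm_apply x

theorem perm_inv_apply (w : Equiv.Perm (Fin n)) (x : Fin n) : w⁻¹ (w x) = x :=
  w.symm_apply_apply x

/-- The set of inversions of a permutation. -/
def inversions (w : Equiv.Perm (Fin n)) : Finset (Fin n × Fin n) :=
  Finset.univ.filter fun p => p.1 < p.2 ∧ w p.2 < w p.1

theorem mem_inversions {w : Equiv.Perm (Fin n)} {p : Fin n × Fin n} :
    p ∈ inversions w ↔ p.1 < p.2 ∧ w p.2 < w p.1 := by simp [inversions]

/-- The number of inversions of a permutation. -/
def inv (w : Equiv.Perm (Fin n)) : ℕ := (inversions w).card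

@[simp] theorem inv_one : inv (1 : Equiv.Perm (Fin n)) = 0 := by
  simp only [inv, Finset.card_eq_zero, Finset.eq_empty_iff_forall_notMem, mem_inversions]
  rintro p ⟨h, h'⟩
  exact lt_asymm h h'

theorem inv_inv (w : Equiv.Perm (Fin n)) : inv w⁻¹ = inv w := by
  refine Finset.card_bij' (fun p _ => (w⁻¹ p.2, w⁻¹ p.1)) (fun p _ => (w p.2, w p.1)) ?_ ?_ ?_ ?_
  · intro p hp; simpa [mem_inversions, and_comm] using hp
  · intro p hp; simpa [mem_inversions, and_comm] using hp
  · intro p _; simp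
  · intro p _; simp

/-- Left multiplication by a simple transposition exchanges two adjacent values, so the order of
values changes only for the pair of positions holding them. -/
theorem inv_simpleSwap_mul_of_lt {w : Equiv.Perm (Fin n)} {i : Fin (n - 1)}
    (h : w⁻¹ (lo i) < w⁻¹ (hi i)) : inv (simpleSwap i * w) = inv w + 1 := by
  have : inversions (simpleSwap i * w) =
      insert (w⁻¹ (lo i), w⁻¹ (hi i)) (inversions w) := by
    ext ⟨a, b⟩
    obtain ⟨x, rfl⟩ := (w⁻¹).surjective a
    obtain ⟨y, rfl⟩ := (w⁻¹).surjective b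
    simp only [mem_inversions, Finset.mem_insert, Prod.mk.injEq, Equiv.Perm.mul_apply,
      perm_apply_inv, EmbeddingLike.apply_eq_iff_eq]
    rw [Fin.lt_def (a := simpleSwap i y), simpleSwap_val, simpleSwap_val]
    constructor
    · rintro ⟨hxy, hs⟩
      by_cases hx : x = lo i ∧ y = hi i
      · exact Or.inl hx
      · refine Or.inr ⟨hxy, ?_⟩
        rw [Fin.lt_def]
        have h1 : ¬ (x.1 = i.1 ∧ y.1 = i.1 + 1) := fun e => hx ⟨Fin.ext e.1, Fin.ext e.2⟩
        have h2 : x.1 ≠ y.1 := by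
          intro e
          rw [Fin.ext e] at hxy
          exact lt_irrefl _ hxy
        split_ifs at hs <;> omega
    · rintro (⟨rfl, rfl⟩ | ⟨hxy, hs⟩)
      · exact ⟨h, by simp [lo, hi]⟩
      · refine ⟨hxy, ?_⟩
        have h1 : ¬ (y.1 = i.1 ∧ x.1 = i.1 + 1) := by
          rintro ⟨e, e'⟩
          have e1 : y = lo i := Fin.ext e
          have e2 : x = hi i := Fin.ext e'
          subst e1 e2
          exact lt_asymm h hxy
        rw [Fin.lt_def] at hs
        split_ifs <;> omega
  rw [inv, this, Finset.card_insert_of_notMem, inv]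
  simp only [mem_inversions, perm_apply_inv, not_and, not_lt]
  exact fun _ => (lo_lt_hi i).le

theorem inv_simpleSwap_mul_of_gt {w : Equiv.Perm (Fin n)} {i : Fin (n - 1)}
    (h : w⁻¹ (hi i) < w⁻¹ (lo i)) : inv (simpleSwap i * w) + 1 = inv w := by
  have := inv_simpleSwap_mul_of_lt (w := simpleSwap i * w) (i := i) (by simpa using h)
  rw [simpleSwap_mul_cancel] at this
  exact this.symm

theorem inv_simpleSwap_mul_le (w : Equiv.Perm (Fin n)) (i : Fin (n - 1)) :
    inv (simpleSwap i * w) ≤ inv w + 1 := by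
  rcases lt_trichotomy (w⁻¹ (lo i)) (w⁻¹ (hi i)) with h | h | h
  · exact (inv_simpleSwap_mul_of_lt h).le
  · exact absurd ((w⁻¹).injective h) (lo_ne_hi i)
  · have := inv_simpleSwap_mul_of_gt h; omega

theorem eq_one_of_forall_lt {w : Equiv.Perm (Fin n)}
    (h : ∀ i : Fin (n - 1), w⁻¹ (lo i) < w⁻¹ (hi i)) : w = 1 := by
  cases n with
  | zero => exact Subsingleton.elim _ _
  | succ m =>
    have hm : StrictMono (⇑(w⁻¹) : Fin (m + 1) → Fin (m + 1)) := Fin.strictMono_iff_lt_succ.2 fun i => h i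
    have : w⁻¹ = 1 := (Equiv.Perm.monotone_iff _).1 hm.monotone
    simpa using this

theorem exists_descent {w : Equiv.Perm (Fin n)} (h : w ≠ 1) :
    ∃ i : Fin (n - 1), w⁻¹ (hi i) < w⁻¹ (lo i) := by
  by_contra! hc
  exact h (eq_one_of_forall_lt fun i => lt_of_le_of_ne (hc i)
    fun e => lo_ne_hi i ((w⁻¹).injective e))

/-- Induction on the number of inversions, through left multiplication by simple
transpositions. -/
theorem perm_induction {P : Equiv.Perm (Fin n) → Prop} (one : P 1)
    (step : ∀ (i : Fin (n - 1)) (w : Equiv.Perm (Fin n)), w⁻¹ (lo i) < w⁻¹ (hi i) → P w →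
      P (simpleSwap i * w)) (w : Equiv.Perm (Fin n)) : P w := by
  induction hk : inv w using Nat.strong_induction_on generalizing w with
  | _ k ih =>
    by_cases hw : w = 1
    · rw [hw]; exact one
    obtain ⟨i, hi'⟩ := exists_descent hw
    have h1 := inv_simpleSwap_mul_of_gt hi'
    have := step i (simpleSwap i * w) (by simpa using hi') (ih _ (by omega) _ rfl)
    rwa [simpleSwap_mul_cancel] at this

@[simp] theorem wordPerm_nil : wordPerm ([] : List (Fin (n - 1))) = 1 := rfl

@[simp] theorem wordPerm_cons (i : Fin (n - 1)) (l : List (Fin (n - 1))) :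
    wordPerm (i :: l) = simpleSwap i * wordPerm l := by simp [wordPerm, simpleSwap]

theorem wordPerm_append (l k : List (Fin (n - 1))) :
    wordPerm (l ++ k) = wordPerm l * wordPerm k := by simp [wordPerm]

theorem inv_wordPerm_le (l : List (Fin (n - 1))) : inv (wordPerm l) ≤ l.length := by
  induction l with
  | nil => simp
  | cons i l ih =>
    rw [wordPerm_cons, List.length_cons]
    exact (inv_simpleSwap_mul_le _ _).trans (by omega)

theorem exists_word_length_eq_inv (w : Equiv.Perm (Fin n)) :
    ∃ l : List (Fin (n - 1)), wordPerm l = w ∧ l.length = inv w := by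
  induction w using perm_induction with
  | one => exact ⟨[], by simp⟩
  | step i w hw ih =>
    obtain ⟨l, h, h'⟩ := ih
    exact ⟨i :: l, by simp [h], by simp [h', inv_simpleSwap_mul_of_lt hw]⟩

theorem wordPerm_reducedWord (w : Equiv.Perm (Fin n)) : wordPerm (reducedWord w) = w :=
  (exists_reduced w).choose_spec.1

/-- A letter changes the inversion number by at most one, and successive left descents give a word
attaining it. -/
theorem length_reducedWord (w : Equiv.Perm (Fin n)) : (reducedWord w).length = inv w := by
  obtain ⟨l, h, h'⟩ := exists_word_length_eq_inv w
  refine le_antisymm (h' ▸ (exists_reduced w).choose_spec.2 l h) ?_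
  conv_lhs => rw [← wordPerm_reducedWord w]
  exact inv_wordPerm_le _

/-- Two simple transpositions which are far from each other. -/
theorem simpleSwap_comm {i j : Fin (n - 1)} (h : i.1 + 1 < j.1 ∨ j.1 + 1 < i.1) :
    simpleSwap i * simpleSwap j = simpleSwap j * simpleSwap i := by
  ext x
  simp only [Equiv.Perm.mul_apply, simpleSwap_val]
  split_ifs <;> omega

theorem simpleSwap_braid {i j : Fin (n - 1)} (h : j.1 = i.1 + 1) :
    simpleSwap i * simpleSwap j * simpleSwap i = simpleSwap j * simpleSwap i * simpleSwap j := by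
  have h1 : hi i = lo j := Fin.ext h.symm
  have h2 : lo i ≠ lo j := by rw [← h1]; exact lo_ne_hi i
  have h3 : hi j ≠ lo j := (lo_ne_hi j).symm
  have h4 : lo i ≠ hi j := ((lo_lt_hi i).trans (h1 ▸ lo_lt_hi j)).ne
  have e1 := Equiv.swap_mul_swap_mul_swap (x := lo i) (y := lo j) (z := hi j) h2 h4
  have e2 := Equiv.swap_mul_swap_mul_swap (x := hi j) (y := lo j) (z := lo i) h3 h4.symm
  simp only [simpleSwap, h1]
  rw [e1, Equiv.swap_comm (hi j) (lo i), ← e2, Equiv.swap_comm (hi j) (lo j),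
    Equiv.swap_comm (lo j) (lo i)]

/-! ### Matsumoto's theorem from the braid relations -/

section Matsumoto

variable {M : Type*} [Monoid M]

/-- Elements satisfying the braid relations of type `A`. -/
structure IsBraid (t : Fin (n - 1) → M) : Prop where
  comm : ∀ i j, i.1 + 1 < j.1 ∨ j.1 + 1 < i.1 → t i * t j = t j * t i
  braid : ∀ i j, j.1 = i.1 + 1 → t i * t j * t i = t j * t i * t j

/-- A word is reduced if its length is the number of inversions of its permutation. -/
def IsReduced (l : List (Fin (n - 1))) : Prop := l.length = inv (wordPerm l)

theorem IsReduced.of_cons {i : Fin (n - 1)} {l : List (Fin (n - 1))} (h : IsReduced (i :: l)) :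
    IsReduced l ∧ (wordPerm l)⁻¹ (lo i) < (wordPerm l)⁻¹ (hi i) := by
  have h1 := inv_wordPerm_le l
  have h2 : l.length + 1 = inv (simpleSwap i * wordPerm l) := by simpa [IsReduced] using h
  have h3 := inv_simpleSwap_mul_le (wordPerm l) i
  refine ⟨by unfold IsReduced; omega, ?_⟩
  by_contra hc
  have h4 := inv_simpleSwap_mul_of_gt
    (lt_of_le_of_ne (not_lt.1 hc) fun e => lo_ne_hi i (((wordPerm l)⁻¹).injective e).symm)
  omega

/-- Matsumoto's theorem for the symmetric group: the product along a reduced word depends only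
on the permutation. -/
theorem IsBraid.prod_eq {t : Fin (n - 1) → M} (ht : IsBraid t) (l k : List (Fin (n - 1)))
    (hl : IsReduced l) (hk : IsReduced k) (h : wordPerm l = wordPerm k) :
    (l.map t).prod = (k.map t).prod := by
  induction hm : l.length using Nat.strong_induction_on generalizing l k with
  | _ m ih =>
    have hlk : l.length = k.length := by rw [hl, hk, h]
    match l, k, hl, hk, h, hlk, hm with
    | [], [], _, _, _, _, _ => rfl
    | i :: l, j :: k, hl, hk, h, hlk, hm =>
      simp only [List.length_cons] at hlk hm
      obtain ⟨hl', hil⟩ := hl.of_cons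
      obtain ⟨hk', hjk⟩ := hk.of_cons
      rw [wordPerm_cons, wordPerm_cons] at h
      obtain ⟨w, hw⟩ : ∃ w, w = simpleSwap i * wordPerm l := ⟨_, rfl⟩
      rw [← hw] at h
      have hwl : wordPerm l = simpleSwap i * w := by simp [hw]
      have hwk : wordPerm k = simpleSwap j * w := by simp [h]
      have hwi : w⁻¹ (hi i) < w⁻¹ (lo i) := by simpa [hw] using hil
      have hwj : w⁻¹ (hi j) < w⁻¹ (lo j) := by simpa [h] using hjk
      simp only [List.map_cons, List.prod_cons]
      -- Two left descents of `w` with commuting transpositions: both reduced words can be replaced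
      -- by words that continue with a common reduced word `p` of s_j s_i w. The induction applies
      -- because the tails are one letter shorter.
      have far : ∀ i j : Fin (n - 1), ∀ l k : List (Fin (n - 1)), IsReduced l → IsReduced k →
          l.length + 1 = m → k.length + 1 = m →
          wordPerm l = simpleSwap i * w → wordPerm k = simpleSwap j * w →
          w⁻¹ (hi i) < w⁻¹ (lo i) → w⁻¹ (hi j) < w⁻¹ (lo j) →
          i.1 + 1 < j.1 → t i * (l.map t).prod = t j * (k.map t).prod := by
        intro i j l k hl' hk' hm hm' hwl hwk hwi hwj hij
        obtain ⟨p, hp, hp'⟩ := exists_word_length_eq_inv (simpleSwap j * (simpleSwap i * w))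
        have e1 : (simpleSwap i * w)⁻¹ (hi j) < (simpleSwap i * w)⁻¹ (lo j) := by
          rw [mul_inv_rev, Equiv.Perm.mul_apply, Equiv.Perm.mul_apply, simpleSwap_inv,
            simpleSwap_of_ne, simpleSwap_of_ne]
          · exact hwj
          all_goals simp only [ne_eq, Fin.ext_iff, lo, hi]; omega
        have e2 := inv_simpleSwap_mul_of_gt e1
        have e3 : inv (simpleSwap i * w) = l.length := by rw [← hwl]; exact hl'.symm
        have e4 : simpleSwap j * (simpleSwap i * w) = simpleSwap i * (simpleSwap j * w) := by
          rw [← mul_assoc, ← mul_assoc, simpleSwap_comm (Or.inl hij)]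
        have r1 : wordPerm (j :: p) = wordPerm l := by
          rw [wordPerm_cons, hp, simpleSwap_mul_cancel, hwl]
        have r2 : wordPerm (i :: p) = wordPerm k := by
          rw [wordPerm_cons, hp, e4, simpleSwap_mul_cancel, hwk]
        have r3 : p.length + 1 = l.length := by omega
        have r4 : l.length = k.length := by omega
        rw [ih l.length (by omega) l (j :: p) hl'
            (by rw [IsReduced, r1, List.length_cons, r3]; exact hl') r1.symm rfl,
          ih k.length (by omega) k (i :: p) hk'
            (by rw [IsReduced, r2, List.length_cons, r3, r4]; exact hk') r2.symm rfl]
        simp only [List.map_cons, List.prod_cons]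
        rw [← mul_assoc, ← mul_assoc, ht.comm i j (Or.inl hij)]
      -- Adjacent descents: `w` then begins with the whole braid s_i s_j s_i, and `p` is a reduced
      -- word of what remains after removing it.
      have near : ∀ i j : Fin (n - 1), ∀ l k : List (Fin (n - 1)), IsReduced l → IsReduced k →
          l.length + 1 = m → k.length + 1 = m →
          wordPerm l = simpleSwap i * w → wordPerm k = simpleSwap j * w →
          w⁻¹ (hi i) < w⁻¹ (lo i) → w⁻¹ (hi j) < w⁻¹ (lo j) →
          j.1 = i.1 + 1 → t i * (l.map t).prod = t j * (k.map t).prod := by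
        intro i j l k hl' hk' hm hm' hwl hwk hwi hwj hij
        have hji : lo j = hi i := Fin.ext hij
        have hne : hi j ≠ lo i := by simp only [ne_eq, Fin.ext_iff, lo, hi]; omega
        have hne' : hi j ≠ hi i := by simp only [ne_eq, Fin.ext_iff, hi]; omega
        have hne'' : lo i ≠ hi j := hne.symm
        have hne3 : lo i ≠ lo j := by simp only [ne_eq, Fin.ext_iff, lo]; omega
        obtain ⟨p, hp, hp'⟩ :=
          exists_word_length_eq_inv (simpleSwap i * (simpleSwap j * (simpleSwap i * w)))
        have e1 : (simpleSwap i * w)⁻¹ (hi j) < (simpleSwap i * w)⁻¹ (lo j) := by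
          rw [mul_inv_rev, Equiv.Perm.mul_apply, Equiv.Perm.mul_apply, simpleSwap_inv,
            simpleSwap_of_ne hne hne', hji, simpleSwap_hi]
          rw [hji] at hwj
          exact hwj.trans hwi
        have e2 := inv_simpleSwap_mul_of_gt e1
        have e1' : (simpleSwap j * (simpleSwap i * w))⁻¹ (hi i) <
            (simpleSwap j * (simpleSwap i * w))⁻¹ (lo i) := by
          simp only [mul_inv_rev, Equiv.Perm.mul_apply, simpleSwap_inv]
          rw [simpleSwap_of_ne hne3 hne'', simpleSwap_lo, ← hji, simpleSwap_lo,
            simpleSwap_of_ne hne hne']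
          exact hwj.trans_eq (by rw [hji])
        have e2' := inv_simpleSwap_mul_of_gt e1'
        have e3 : inv (simpleSwap i * w) = l.length := by rw [← hwl]; exact hl'.symm
        have e4 : simpleSwap i * (simpleSwap j * (simpleSwap i * w)) =
            simpleSwap j * (simpleSwap i * (simpleSwap j * w)) := by
          have := simpleSwap_braid hij
          simp only [← mul_assoc, this]
        have r1 : wordPerm (j :: i :: p) = wordPerm l := by
          rw [wordPerm_cons, wordPerm_cons, hp, simpleSwap_mul_cancel, simpleSwap_mul_cancel, hwl]
        have r2 : wordPerm (i :: j :: p) = wordPerm k := by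
          rw [wordPerm_cons, wordPerm_cons, hp, e4, simpleSwap_mul_cancel, simpleSwap_mul_cancel,
            hwk]
        have r3 : p.length + 2 = l.length := by omega
        have r4 : l.length = k.length := by omega
        rw [ih l.length (by omega) l (j :: i :: p) hl'
            (by rw [IsReduced, r1, List.length_cons, List.length_cons, r3]; exact hl') r1.symm rfl,
          ih k.length (by omega) k (i :: j :: p) hk'
            (by rw [IsReduced, r2, List.length_cons, List.length_cons, r3, r4]; exact hk')
            r2.symm rfl]
        simp only [List.map_cons, List.prod_cons]
        have := ht.braid i j hij
        simp only [← mul_assoc, this]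
      rcases lt_trichotomy i.1 j.1 with hij | hij | hij
      · by_cases hij' : i.1 + 1 < j.1
        · exact far i j l k hl' hk' hm (by omega) hwl hwk hwi hwj hij'
        · exact near i j l k hl' hk' hm (by omega) hwl hwk hwi hwj (by omega)
      · obtain rfl : i = j := Fin.ext hij
        rw [ih l.length (by omega) l k hl' hk' (by rw [hwl, hwk]) rfl]
      · by_cases hij' : j.1 + 1 < i.1
        · exact (far j i k l hk' hl' (by omega) hm hwk hwl hwj hwi hij').symm
        · exact (near j i k l hk' hl' (by omega) hm hwk hwl hwj hwi (by omega)).symm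

end Matsumoto

/-! ### Relations in the Hecke algebra -/

/-- The parameter `q`. -/
abbrev qpar (r : ℕ) : LaurentRing r := (laurentVar r none : LaurentRing r)

/-- The scalar `q - 1`. -/
def qm (r : ℕ) : LaurentRing r := qpar r - 1

theorem qm_add_one (r : ℕ) : qm r + 1 = qpar r := by simp [qm]

/-- The parameters `Q_c`. -/
abbrev Qpar {r : ℕ} (c : Fin r) : LaurentRing r := (laurentVar r (some c) : LaurentRing r)

theorem T_comm {i j : Fin (n - 1)} (h : i.1 + 1 < j.1 ∨ j.1 + 1 < i.1) :
    T r i * T r j = T r j * T r i := by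
  simpa only [map_mul, T] using RingQuot.mkAlgHom_rel (LaurentRing r)
    (Rel.T_comm (q := laurentVar r none)
      (Q := fun c => (laurentVar r (some c) : LaurentRing r)) i j h)

theorem T_braid {i j : Fin (n - 1)} (h : j.1 = i.1 + 1) :
    T r i * T r j * T r i = T r j * T r i * T r j := by
  simpa only [map_mul, T] using RingQuot.mkAlgHom_rel (LaurentRing r)
    (Rel.braid (q := laurentVar r none)
      (Q := fun c => (laurentVar r (some c) : LaurentRing r)) i j h)

theorem T_mul_L_comm {i : Fin (n - 1)} {j : Fin n} (h : j ≠ lo i) (h' : j ≠ hi i) :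
    T r i * L r j = L r j * T r i := by
  simpa only [map_mul, T, L] using RingQuot.mkAlgHom_rel (LaurentRing r)
    (Rel.TL_comm (q := laurentVar r none)
      (Q := fun c => (laurentVar r (some c) : LaurentRing r)) i j h h')

theorem q_smul_L_hi (i : Fin (n - 1)) :
    qpar r • L r (hi i) = T r i * L r (lo i) * T r i := by
  simpa only [map_mul, map_smul, T, L] using RingQuot.mkAlgHom_rel (LaurentRing r)
    (Rel.L_succ (q := laurentVar r none)
      (Q := fun c => (laurentVar r (some c) : LaurentRing r)) i)

theorem mul_self_of_quadratic {A B : Type*} [CommRing A] [Ring B] [Algebra A B] {q q' : A}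
    (hq : q' + 1 = q) {t : B} (h : (t + 1) * (t - algebraMap A B q) = 0) :
    t * t = q' • t + q • 1 := by
  rw [Algebra.algebraMap_eq_smul_one] at h
  rw [← sub_eq_zero, ← h, ← hq]
  simp only [add_mul, mul_sub, mul_add, smul_add, mul_smul_comm, mul_one, one_mul, add_smul, one_smul]
  abel

theorem T_mul_self (i : Fin (n - 1)) : T r i * T r i = qm r • T r i + qpar r • 1 := by
  refine mul_self_of_quadratic (qm_add_one r) ?_
  have h := RingQuot.mkAlgHom_rel (LaurentRing r)
    (Rel.quadratic (q := laurentVar r none)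
      (Q := fun c => (laurentVar r (some c) : LaurentRing r)) i)
  simp only [map_mul, map_add, map_sub, map_one, map_zero, AlgHom.commutes] at h
  exact h

theorem cyclotomic_relation (j : Fin n) (h : j.1 = 0) :
    Polynomial.aeval (L r j) (∏ c : Fin r, (Polynomial.X - Polynomial.C (Qpar c))) = 0 := by
  have := RingQuot.mkAlgHom_rel (LaurentRing r)
    (Rel.cyclotomic (q := laurentVar r none)
      (Q := fun c => (laurentVar r (some c) : LaurentRing r)) j h)
  rwa [map_zero, ← Polynomial.aeval_algHom_apply] at this

/-- Left multiplication by `q` is invertible. -/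
theorem q_smul_inj {M : Type*} [AddCommGroup M] [Module (LaurentRing r) M] {x y : M}
    (h : qpar r • x = qpar r • y) : x = y := by
  have := congrArg (fun z => ((laurentVar r none)⁻¹ : (LaurentRing r)ˣ) • z) h
  simpa only [← Units.smul_def, inv_smul_smul] using this

theorem isUnit_T (i : Fin (n - 1)) : IsUnit (T r i) := by
  have h := T_mul_self (r := r) i
  set u : LaurentRing r := (((laurentVar r none)⁻¹ : (LaurentRing r)ˣ) : LaurentRing r) with hu
  have huq : u * qpar r = 1 := by simp [hu]
  have key : u • (T r i * T r i - qm r • T r i) = 1 := by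
    rw [h, add_sub_cancel_left, smul_smul, huq, one_smul]
  refine ⟨⟨T r i, u • (T r i - qm r • 1), ?_, ?_⟩, rfl⟩
  · rw [mul_smul_comm, mul_sub, mul_smul_comm, mul_one, key]
  · rw [smul_mul_assoc, sub_mul, smul_mul_assoc, one_mul, key]

/-! ### The elements `T_w` -/

theorem isBraid_T : IsBraid (n := n) (T r) := ⟨fun _ _ h => T_comm h, fun _ _ h => T_braid h⟩

theorem isReduced_reducedWord (w : Equiv.Perm (Fin n)) : IsReduced (reducedWord w) := by
  rw [IsReduced, wordPerm_reducedWord, length_reducedWord]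

/-- When lengths add, the concatenation of two reduced words is reduced, so Matsumoto's theorem
applies. -/
theorem TPerm_mul_of_inv_eq {x y : Equiv.Perm (Fin n)} (h : inv (x * y) = inv x + inv y) :
    TPerm r x * TPerm r y = TPerm r (x * y) := by
  rw [TPerm, TPerm, TPerm, ← List.prod_append, ← List.map_append]
  have e : wordPerm (reducedWord x ++ reducedWord y) = x * y := by
    rw [wordPerm_append, wordPerm_reducedWord, wordPerm_reducedWord]
  refine isBraid_T.prod_eq _ _ ?_ (isReduced_reducedWord _) (by rw [e, wordPerm_reducedWord])
  rw [IsReduced, e, h, List.length_append, length_reducedWord, length_reducedWord]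

@[simp] theorem TPerm_one : TPerm r (1 : Equiv.Perm (Fin n)) = 1 := by
  have := length_reducedWord (1 : Equiv.Perm (Fin n))
  rw [inv_one, List.length_eq_zero_iff] at this
  rw [TPerm, this]; rfl

theorem inv_simpleSwap (i : Fin (n - 1)) : inv (simpleSwap i) = 1 := by
  simpa using inv_simpleSwap_mul_of_lt (w := 1) (i := i) (by simpa using lo_lt_hi i)

theorem TPerm_simpleSwap (i : Fin (n - 1)) : TPerm r (simpleSwap i) = T r i := by
  have : IsReduced [i] := by simp [IsReduced, inv_simpleSwap]
  rw [TPerm]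
  simpa using isBraid_T.prod_eq (t := T r) _ [i] (isReduced_reducedWord (simpleSwap i)) this
    (by simp [wordPerm_reducedWord])

theorem T_mul_TPerm_of_lt {w : Equiv.Perm (Fin n)} {i : Fin (n - 1)}
    (h : w⁻¹ (lo i) < w⁻¹ (hi i)) : T r i * TPerm r w = TPerm r (simpleSwap i * w) := by
  rw [← TPerm_simpleSwap, TPerm_mul_of_inv_eq]
  rw [inv_simpleSwap_mul_of_lt h, inv_simpleSwap, add_comm]

theorem T_mul_TPerm_of_gt {w : Equiv.Perm (Fin n)} {i : Fin (n - 1)}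
    (h : w⁻¹ (hi i) < w⁻¹ (lo i)) :
    T r i * TPerm r w = qm r • TPerm r w + qpar r • TPerm r (simpleSwap i * w) := by
  have h1 : T r i * TPerm r (simpleSwap i * w) = TPerm r w := by
    rw [T_mul_TPerm_of_lt (by simpa using h), simpleSwap_mul_cancel]
  conv_lhs => rw [← h1]
  rw [← mul_assoc, T_mul_self, add_mul, smul_mul_assoc, smul_mul_assoc, one_mul, h1]

theorem isUnit_TPerm (w : Equiv.Perm (Fin n)) : IsUnit (TPerm r w) := by
  induction w using perm_induction with
  | one => simp
  | step i w hw ih => rw [← T_mul_TPerm_of_lt hw]; exact (isUnit_T i).mul ih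


/-! ### Colorings and Young subgroups -/

section Coloring

variable {α : Type*} [LinearOrder α]

/-- The permutations preserving a coloring. -/
def stab (f : Fin n → α) : Finset (Equiv.Perm (Fin n)) :=
  Finset.univ.filter fun w => ∀ k, f (w k) = f k

theorem mem_stab {f : Fin n → α} {w : Equiv.Perm (Fin n)} : w ∈ stab f ↔ ∀ k, f (w k) = f k := by
  simp [stab]

theorem inv_mem_stab {f : Fin n → α} {w : Equiv.Perm (Fin n)} (h : w ∈ stab f) :
    w⁻¹ ∈ stab f := by
  rw [mem_stab] at h ⊢
  intro k
  rw [← h (w⁻¹ k), perm_apply_inv]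

theorem mul_mem_stab {f : Fin n → α} {w v : Equiv.Perm (Fin n)} (h : w ∈ stab f)
    (h' : v ∈ stab f) : w * v ∈ stab f := by
  rw [mem_stab] at *
  intro k
  rw [Equiv.Perm.mul_apply, h, h']

/-- The sum of the `T_w` over the stabilizer of a coloring. -/
def xSum (r : ℕ) (f : Fin n → α) : Hecke n r := ∑ w ∈ stab f, TPerm r w

/-- Here `d` is the shortest element of its left coset of the Young subgroup. Inversions of `d * w`
between different colors correspond under `w` to the inversions of `d`; those within a color are
exactly the inversions of `w`, because `d` preserves order there. -/
theorem inv_mul_of_mem_stab {f : Fin n → α} (hf : Monotone f) {d w : Equiv.Perm (Fin n)}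
    (hw : w ∈ stab f) (hd : ∀ a b, a < b → f a = f b → d a < d b) :
    inv (d * w) = inv d + inv w := by
  rw [mem_stab] at hw
  have hlt : ∀ a b, f a < f b → a < b := fun a b h => hf.reflect_lt h
  set S : Finset (Fin n × Fin n) := Finset.univ.filter fun p =>
    f p.1 < f p.2 ∧ d (w p.2) < d (w p.1) with hS
  have hmem : ∀ p, p ∈ S ↔ f p.1 < f p.2 ∧ d (w p.2) < d (w p.1) := fun p => by simp [hS]
  have h1 : inversions (d * w) = S ∪ inversions w := by
    ext ⟨a, b⟩
    simp only [mem_inversions, Finset.mem_union, hmem, Equiv.Perm.mul_apply]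
    constructor
    · rintro ⟨hab, hdw⟩
      rcases (hf hab.le).lt_or_eq with h | h
      · exact Or.inl ⟨h, hdw⟩
      · refine Or.inr ⟨hab, ?_⟩
        by_contra hc
        have hne : w a ≠ w b := fun e => hab.ne (w.injective e)
        exact lt_asymm hdw (hd _ _ (lt_of_le_of_ne (not_lt.1 hc) hne) (by rw [hw, hw, h]))
    · rintro (⟨h, hdw⟩ | ⟨hab, hwab⟩)
      · exact ⟨hlt _ _ h, hdw⟩
      · refine ⟨hab, hd _ _ hwab ?_⟩
        refine le_antisymm (hf hwab.le) ?_
        rw [hw, hw]; exact hf hab.le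
  have h2 : Disjoint S (inversions w) := by
    rw [Finset.disjoint_left]
    rintro ⟨a, b⟩ hp hp'
    rw [hmem] at hp
    rw [mem_inversions] at hp'
    have := hlt (w a) (w b) (by rw [hw, hw]; exact hp.1)
    exact lt_asymm this hp'.2
  have h3 : S.card = (inversions d).card := by
    refine Finset.card_bij' (fun p _ => (w p.1, w p.2)) (fun p _ => (w⁻¹ p.1, w⁻¹ p.2)) ?_ ?_ ?_ ?_
    · rintro ⟨a, b⟩ hp
      rw [hmem] at hp
      rw [mem_inversions]
      exact ⟨hlt _ _ (by rw [hw, hw]; exact hp.1), hp.2⟩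
    · rintro ⟨a, b⟩ hp
      rw [mem_inversions] at hp
      rw [hmem]
      have h4 := mem_stab.1 (inv_mem_stab (mem_stab.2 hw))
      simp only [perm_apply_inv, h4]
      refine ⟨lt_of_le_of_ne (hf hp.1.le) fun e => ?_, hp.2⟩
      exact lt_asymm hp.2 (hd _ _ hp.1 e)
    · intro p _; simp
    · intro p _; simp
  rw [inv, h1, Finset.card_union_of_disjoint h2, h3, inv, inv]

theorem TPerm_mul_of_mem_stab {f : Fin n → α} (hf : Monotone f) {d w : Equiv.Perm (Fin n)}
    (hw : w ∈ stab f) (hd : ∀ a b, a < b → f a = f b → d a < d b) :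
    TPerm r d * TPerm r w = TPerm r (d * w) :=
  TPerm_mul_of_inv_eq (inv_mul_of_mem_stab hf hw hd)

theorem sort_monotone (h : Fin n → α) : Monotone (h ∘ Tuple.sort h) := Tuple.monotone_sort h

theorem sort_stable (h : Fin n → α) {a b : Fin n} (hab : a < b)
    (e : h (Tuple.sort h a) = h (Tuple.sort h b)) : Tuple.sort h a < Tuple.sort h b :=
  (Tuple.eq_sort_iff.1 (rfl : Tuple.sort h = Tuple.sort h)).2 a b hab e

theorem sort_inv_lt (h : Fin n → α) {a b : Fin n} (hab : a < b) (e : h a = h b) :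
    (Tuple.sort h)⁻¹ a < (Tuple.sort h)⁻¹ b := by
  by_contra hc
  have hne : (Tuple.sort h)⁻¹ a ≠ (Tuple.sort h)⁻¹ b :=
    fun e' => hab.ne ((Tuple.sort h)⁻¹.injective e')
  have := sort_stable h (lt_of_le_of_ne (not_lt.1 hc) hne.symm)
    (by rw [perm_apply_inv, perm_apply_inv, e])
  rw [perm_apply_inv, perm_apply_inv] at this
  exact lt_asymm hab this

/-- Elements of a right coset of a Young subgroup. -/
theorem sum_TPerm_coset {g : Fin n → α} (hg : Monotone g) {y₀ : Equiv.Perm (Fin n)}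
    {h : Fin n → α} (hy : g ∘ y₀ = h) :
    ∑ y ∈ Finset.univ.filter (fun y : Equiv.Perm (Fin n) => g ∘ y = h), TPerm r y =
      xSum r g * TPerm r (Tuple.sort h)⁻¹ := by
  set s := Tuple.sort h with hs
  have hmono : Monotone (h ∘ s) := sort_monotone h
  -- Both are monotone rearrangements of the same coloring.
  have e1 : h ∘ s = g := by
    have := Tuple.unique_monotone (f := g) (σ := y₀ * s) (τ := 1)
      (by rw [Equiv.Perm.coe_mul, ← Function.comp_assoc, hy]; exact hmono) (by simpa using hg)
    rw [Equiv.Perm.coe_mul, ← Function.comp_assoc, hy] at this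
    simpa using this
  have e2 : ∀ x, g (s⁻¹ x) = h x := fun x => by rw [← e1, Function.comp_apply, perm_apply_inv]
  rw [xSum, Finset.sum_mul]
  refine Finset.sum_bij' (fun y _ => y * s) (fun w _ => w * s⁻¹) ?_ ?_ ?_ ?_ ?_
  · intro y hy'
    simp only [Finset.mem_filter, Finset.mem_univ, true_and] at hy'
    rw [mem_stab]
    intro k
    rw [Equiv.Perm.mul_apply]
    have := congrFun hy' (s k)
    simp only [Function.comp_apply] at this
    rw [this]; exact congrFun e1 k
  · intro w hw
    rw [mem_stab] at hw
    simp only [Finset.mem_filter, Finset.mem_univ, true_and]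
    funext x
    simp only [Function.comp_apply, Equiv.Perm.mul_apply, hw, e2]
  · intro y _; simp
  · intro w _; simp
  · intro y hy'
    have hys : y * s ∈ stab g := by
      simp only [Finset.mem_filter, Finset.mem_univ, true_and] at hy'
      rw [mem_stab]
      intro k
      rw [Equiv.Perm.mul_apply]
      have := congrFun hy' (s k)
      simp only [Function.comp_apply] at this
      rw [this]; exact congrFun e1 k
    -- Lengths add in y = (y s) s⁻¹: this is `inv_mul_of_mem_stab` after inversion, since the stable
    -- sort `s` is increasing on each color block.
    rw [TPerm_mul_of_inv_eq]
    · simp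
    · rw [← inv_inv, mul_inv_rev, _root_.inv_inv, inv_mul_of_mem_stab hg (inv_mem_stab hys), inv_inv,
        inv_inv, add_comm]
      intro a b hab e
      refine sort_stable h hab ?_
      have h1 := congrFun e1 a
      have h2 := congrFun e1 b
      simp only [Function.comp_apply] at h1 h2
      rw [h1, h2, e]

/-- Permuting the colors of a monotone coloring conjugates the sum over the Young subgroup. -/
theorem TPerm_sort_mul_xSum {g : Fin n → α} (hg : Monotone g) {τ : α → α}
    (hτ : Function.Injective τ) :
    TPerm r (Tuple.sort (τ ∘ g))⁻¹ * xSum r g =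
      xSum r ((τ ∘ g) ∘ Tuple.sort (τ ∘ g)) * TPerm r (Tuple.sort (τ ∘ g))⁻¹ := by
  set h := τ ∘ g with hh
  set s := Tuple.sort h with hs
  have hd : (h ∘ s) ∘ ⇑s⁻¹ = h := by
    funext x
    simp only [Function.comp_apply, perm_apply_inv]
  -- Both sides are the sum of T_y over the single coset of those `y` taking the sorted coloring to
  -- `h`. Injectivity of `τ` makes the stabilizers of `g` and `τ ∘ g` coincide.
  rw [hs, ← sum_TPerm_coset (sort_monotone h) hd, ← hs, xSum, Finset.mul_sum]
  refine Finset.sum_bij' (fun w _ => s⁻¹ * w) (fun y _ => s * y) ?_ ?_ ?_ ?_ ?_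
  · intro w hw
    rw [mem_stab] at hw
    simp only [Finset.mem_filter, Finset.mem_univ, true_and]
    funext x
    simp only [Function.comp_apply, Equiv.Perm.mul_apply, perm_apply_inv, hh, hw]
  · intro y hy
    simp only [Finset.mem_filter, Finset.mem_univ, true_and] at hy
    rw [mem_stab]
    intro k
    have := congrFun hy k
    simp only [Function.comp_apply, hh] at this
    exact hτ this
  · intro w _; simp
  · intro w _; simp
  · intro w hw
    rw [TPerm_mul_of_mem_stab hg hw]
    intro a b hab e
    exact sort_inv_lt h hab (by rw [hh, Function.comp_apply, Function.comp_apply, e])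

theorem simpleSwap_mem_stab {f : Fin n → α} {i : Fin (n - 1)} (h : f (lo i) = f (hi i)) :
    simpleSwap i ∈ stab f := by
  rw [mem_stab]
  intro k
  by_cases h1 : k = lo i
  · rw [h1, simpleSwap_lo, h]
  by_cases h2 : k = hi i
  · rw [h2, simpleSwap_hi, h]
  rw [simpleSwap_of_ne h1 h2]

/-- Pair `w` with s_i w inside the stabilizer: T_i sends the sum over the shorter halves `U` to the
sum over the longer halves `D`, and the latter to (q-1) times itself plus q times the former. -/
theorem T_mul_xSum {f : Fin n → α} {i : Fin (n - 1)} (h : f (lo i) = f (hi i)) :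
    T r i * xSum r f = qpar r • xSum r f := by
  classical
  set U := (stab f).filter fun w => w⁻¹ (lo i) < w⁻¹ (hi i) with hU
  set D := (stab f).filter fun w => ¬ w⁻¹ (lo i) < w⁻¹ (hi i) with hD
  have hs := simpleSwap_mem_stab h
  have hlt : ∀ w ∈ D, w⁻¹ (hi i) < w⁻¹ (lo i) := fun w hw => by
    refine lt_of_le_of_ne (not_lt.1 (Finset.mem_filter.1 hw).2) fun e => ?_
    exact lo_ne_hi i ((w⁻¹).injective e).symm
  have hmemD : ∀ w, w ∈ D ↔ w ∈ stab f ∧ w⁻¹ (hi i) < w⁻¹ (lo i) := fun w =>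
    ⟨fun hw => ⟨(Finset.mem_filter.1 hw).1, hlt w hw⟩,
      fun hw => Finset.mem_filter.2 ⟨hw.1, not_lt.2 hw.2.le⟩⟩
  have hUD : ∀ w ∈ U, simpleSwap i * w ∈ D := fun w hw => by
    rw [hU, Finset.mem_filter] at hw
    rw [hmemD]
    exact ⟨mul_mem_stab hs hw.1, by simpa using hw.2⟩
  have hDU : ∀ w ∈ D, simpleSwap i * w ∈ U := fun w hw => by
    rw [hmemD] at hw
    rw [hU, Finset.mem_filter]
    exact ⟨mul_mem_stab hs hw.1, by simpa using hw.2⟩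
  have hsum : xSum r f = ∑ w ∈ U, TPerm r w + ∑ w ∈ D, TPerm r w :=
    (Finset.sum_filter_add_sum_filter_not _ _ _).symm
  have h1 : ∑ w ∈ U, TPerm r (simpleSwap i * w) = ∑ w ∈ D, TPerm r w :=
    Finset.sum_bij' (fun w _ => simpleSwap i * w) (fun w _ => simpleSwap i * w) hUD hDU
      (by simp) (by simp) (by simp)
  have h2 : ∑ w ∈ D, TPerm r (simpleSwap i * w) = ∑ w ∈ U, TPerm r w :=
    Finset.sum_bij' (fun w _ => simpleSwap i * w) (fun w _ => simpleSwap i * w) hDU hUD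
      (by simp) (by simp) (by simp)
  have h3 : T r i * ∑ w ∈ U, TPerm r w = ∑ w ∈ D, TPerm r w := by
    rw [Finset.mul_sum, ← h1]
    exact Finset.sum_congr rfl fun w hw => T_mul_TPerm_of_lt (Finset.mem_filter.1 hw).2
  have h4 : T r i * ∑ w ∈ D, TPerm r w =
      qm r • ∑ w ∈ D, TPerm r w + qpar r • ∑ w ∈ U, TPerm r w := by
    rw [Finset.mul_sum, ← h2, Finset.smul_sum, Finset.smul_sum, ← Finset.sum_add_distrib]
    exact Finset.sum_congr rfl fun w hw => T_mul_TPerm_of_gt (hlt w hw)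
  have h5 : ∑ w ∈ D, TPerm r w + qm r • ∑ w ∈ D, TPerm r w = qpar r • ∑ w ∈ D, TPerm r w := by
    rw [← qm_add_one, add_smul, one_smul, add_comm]
  rw [hsum, mul_add, h3, h4, smul_add, ← add_assoc, h5, add_comm]

/-- An element commuting with the generators of a parabolic subalgebra commutes with its `T_w`. -/
theorem commute_TPerm {f : Fin n → α} (hf : Monotone f) {z : Hecke n r}
    (hz : ∀ i, f (lo i) = f (hi i) → Commute (T r i) z) {d : Equiv.Perm (Fin n)}
    (hd : d ∈ stab f) : Commute (TPerm r d) z := by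
  induction d using perm_induction with
  | one => simp
  | step i w hw ih =>
    have e : f (lo i) = f (hi i) := by
      refine le_antisymm (hf (lo_lt_hi i).le) ?_
      have h1 := mem_stab.1 hd (w⁻¹ (lo i))
      have h2 := mem_stab.1 hd (w⁻¹ (hi i))
      rw [Equiv.Perm.mul_apply, perm_apply_inv, simpleSwap_lo] at h1
      rw [Equiv.Perm.mul_apply, perm_apply_inv, simpleSwap_hi] at h2
      rw [h1, h2]
      exact hf hw.le
    rw [← T_mul_TPerm_of_lt hw]
    refine (hz i e).mul_left (ih ?_)
    have := mul_mem_stab (simpleSwap_mem_stab e) hd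
    rwa [simpleSwap_mul_cancel] at this

/-- The number of entries with color less than `p`. -/
def cnt (f : Fin n → α) (p : α) : ℕ := (Finset.univ.filter fun k => f k < p).card

/-- The number of entries with color at most `p`. -/
def cntLE (f : Fin n → α) (p : α) : ℕ := (Finset.univ.filter fun k => f k ≤ p).card

theorem lt_cnt_iff {f : Fin n → α} (hf : Monotone f) {p : α} {k : Fin n} :
    k.1 < cnt f p ↔ f k < p := Tuple.lt_card_lt_iff_apply_lt_of_monotone hf

theorem lt_cntLE_iff {f : Fin n → α} (hf : Monotone f) {p : α} {k : Fin n} :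
    k.1 < cntLE f p ↔ f k ≤ p := Tuple.lt_card_le_iff_apply_le_of_monotone hf

theorem cnt_comp (f : Fin n → α) (p : α) (s : Equiv.Perm (Fin n)) : cnt (f ∘ s) p = cnt f p := by
  refine Finset.card_bij' (fun k _ => s k) (fun k _ => s⁻¹ k) ?_ ?_ ?_ ?_ <;> simp

theorem cntLE_comp (f : Fin n → α) (p : α) (s : Equiv.Perm (Fin n)) :
    cntLE (f ∘ s) p = cntLE f p := by
  refine Finset.card_bij' (fun k _ => s k) (fun k _ => s⁻¹ k) ?_ ?_ ?_ ?_ <;> simp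

theorem cnt_le (f : Fin n → α) (p : α) : cnt f p ≤ n :=
  (Finset.card_le_univ _).trans (by simp)

theorem cnt_le_cntLE (f : Fin n → α) (p : α) : cnt f p ≤ cntLE f p :=
  Finset.card_le_card fun k => by simpa using fun h => h.le

/-- The inequalities between partial sums that define dominance become a pointwise comparison. The
more dominant coloring is the smaller one, since more of its entries lie in early rows. -/
theorem le_iff_cnt_le {f g : Fin n → α} (hf : Monotone f) (hg : Monotone g) :
    g ≤ f ↔ ∀ p, cnt f p ≤ cnt g p := by
  constructor
  · intro h p
    refine Finset.card_le_card fun k => ?_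
    simpa using fun h' => (h k).trans_lt h'
  · intro h k
    by_contra hc
    have := (lt_cnt_iff hf).2 (not_le.1 hc)
    exact lt_irrefl _ ((lt_cnt_iff hg).1 (this.trans_le (h _)))

end Coloring

/-! ### Cycles -/

/-- `T_i` for a natural number `i` (equal to `1` out of range). -/
def TN (n r i : ℕ) : Hecke n r := if h : i < n - 1 then T r ⟨i, h⟩ else 1

/-- The simple transposition for a natural number `i` (equal to `1` out of range). -/
def swapN (n i : ℕ) : Equiv.Perm (Fin n) := if h : i < n - 1 then simpleSwap ⟨i, h⟩ else 1

/-- The cycle moving `j + m` to `j` and shifting the entries between. -/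
def cyc (n : ℕ) : ℕ → ℕ → Equiv.Perm (Fin n)
  | _, 0 => 1
  | j, m + 1 => swapN n j * cyc n (j + 1) m

/-- The product `T_j T_{j+1} ⋯ T_{j+m-1}`. -/
def cycT (n r : ℕ) : ℕ → ℕ → Hecke n r
  | _, 0 => 1
  | j, m + 1 => TN n r j * cycT n r (j + 1) m

theorem swapN_val {i : ℕ} (h : i + 1 < n) (x : Fin n) :
    (swapN n i x).1 = if x.1 = i then i + 1 else if x.1 = i + 1 then i else x.1 := by
  rw [swapN, dif_pos (by omega), simpleSwap_val]

theorem cyc_val {j m : ℕ} (h : j + m < n) (x : Fin n) :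
    (cyc n j m x).1 = if x.1 = j + m then j else if j ≤ x.1 ∧ x.1 < j + m then x.1 + 1 else x.1 := by
  induction m generalizing j with
  | zero => simp only [cyc, Equiv.Perm.one_apply]; split_ifs <;> omega
  | succ m ih =>
    rw [cyc, Equiv.Perm.mul_apply, swapN_val (by omega), ih (by omega)]
    split_ifs <;> omega

theorem TPerm_cyc {j m : ℕ} (h : j + m < n) : TPerm r (cyc n j m) = cycT n r j m := by
  induction m generalizing j with
  | zero => simp [cyc, cycT]
  | succ m ih =>
    have hj : j < n - 1 := by omega
    rw [cyc, cycT, ← ih (by omega), swapN, TN, dif_pos hj, dif_pos hj, T_mul_TPerm_of_lt]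
    have e1 : (cyc n (j + 1) m)⁻¹ (lo ⟨j, hj⟩) = lo ⟨j, hj⟩ := by
      rw [Equiv.Perm.inv_eq_iff_eq, Fin.ext_iff, cyc_val (by omega),
        if_neg (by simp only [lo]; omega), if_neg (by simp only [lo]; omega)]
    have e2 : (cyc n (j + 1) m)⁻¹ (hi ⟨j, hj⟩) = ⟨j + 1 + m, by omega⟩ := by
      rw [Equiv.Perm.inv_eq_iff_eq, Fin.ext_iff, cyc_val (by omega)]
      simp [hi]
    rw [e1, e2, Fin.lt_def]
    simp only [lo]; omega

/-! ### Moving the head of a row to an earlier row -/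

section Move

variable {α : Type*} [LinearOrder α]

/-- Moving the first entry of a row to the end of an earlier row. -/
theorem exists_sum_cycT_mul_xSum {f : Fin n → α} (hf : Monotone f) {k : Fin n}
    (hk : ∀ x, x < k → f x < f k) {p : α} (hp : p < f k) :
    ∃ h : Hecke n r, ∑ j ∈ Finset.Icc (cnt f p) (cntLE f p), cycT n r j (k.1 - j) * xSum r f =
      xSum r (Function.update f k p ∘ Tuple.sort (Function.update f k p)) * h := by
  classical
  set h₀ := Function.update f k p with hh₀
  set g := h₀ ∘ Tuple.sort h₀ with hg
  set a := cnt f p with ha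
  set b := cntLE f p with hb
  have hgm : Monotone g := sort_monotone h₀
  have h₀k : h₀ k = p := Function.update_self ..
  have h₀ne : ∀ x, x ≠ k → h₀ x = f x := fun x hx => Function.update_of_ne hx ..
  have hlt : ∀ x : Fin n, x.1 < a ↔ f x < p := fun x => lt_cnt_iff hf
  have hle : ∀ x : Fin n, x.1 < b ↔ f x ≤ p := fun x => lt_cntLE_iff hf
  have hab : a ≤ b := cnt_le_cntLE f p
  have hbk : b ≤ k.1 := by
    by_contra hc
    exact absurd ((hle k).1 (not_le.1 hc)) (not_le.2 hp)
  have hcntg : cnt g p = a := by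
    rw [hg, cnt_comp, ha, cnt, cnt]
    congr 1
    ext x
    by_cases hx : x = k
    · subst hx; simp [h₀k, hp.le]
    · simp [h₀ne x hx]
  have hcntg' : cntLE g p = b + 1 := by
    rw [hg, cntLE_comp, hb, cntLE, cntLE, ← Finset.card_insert_of_notMem (a := k)]
    · congr 1
      ext x
      by_cases hx : x = k
      · subst hx; simp [h₀k]
      · simp [h₀ne x hx, hx]
    · simpa using hp
  have hgp : ∀ x : Fin n, g x = p ↔ a ≤ x.1 ∧ x.1 ≤ b := fun x => by
    have h1 := lt_cnt_iff hgm (p := p) (k := x)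
    have h2 := lt_cntLE_iff hgm (p := p) (k := x)
    rw [hcntg] at h1
    rw [hcntg'] at h2
    rw [← Nat.lt_succ_iff (m := x.1), Nat.succ_eq_add_one, h2, ← not_lt, h1, not_lt]
    exact ⟨fun e => ⟨e.ge, e.le⟩, fun e => le_antisymm e.2 e.1⟩
  set c : ℕ → Equiv.Perm (Fin n) := fun j => cyc n j (k.1 - j) with hc
  have hcv : ∀ j, j ≤ b → ∀ x : Fin n, (c j x).1 =
      if x = k then j else if j ≤ x.1 ∧ x.1 < k.1 then x.1 + 1 else x.1 := by
    intro j hj x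
    have e : j + (k.1 - j) = k.1 := by omega
    rw [hc, cyc_val (by omega), e]
    simp only [Fin.ext_iff]
  have hck : ∀ j, j ≤ b → (c j k).1 = j := fun j hj => by rw [hcv j hj, if_pos rfl]
  -- The permutation `c j` carries `k` to position `j` and shifts the entries between. Every `j`
  -- from the start `a` of row `p` to the place `b` just after its end gives the same sorted
  -- coloring `g`, which accounts for the closed interval in the sum.
  have hgc : ∀ j, a ≤ j → j ≤ b → g ∘ c j = h₀ := by
    intro j haj hjb
    have hm : Monotone (h₀ ∘ ⇑(c j)⁻¹) := by
      have key : ∀ u v : Fin n, c j u ≤ c j v → h₀ u ≤ h₀ v := by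
        intro u v huv
        rw [Fin.le_def, hcv j hjb, hcv j hjb] at huv
        by_cases hu : u = k <;> by_cases hv : v = k
        · rw [hu, hv]
        · rw [hu, h₀k, h₀ne v hv, ← not_lt, ← hlt]
          rw [if_pos hu, if_neg hv] at huv
          split_ifs at huv <;> omega
        · rw [hv, h₀k, h₀ne u hu, ← hle]
          rw [if_pos hv, if_neg hu] at huv
          have : u.1 ≠ k.1 := fun e => hu (Fin.ext e)
          split_ifs at huv <;> omega
        · rw [h₀ne u hu, h₀ne v hv]
          rw [if_neg hv, if_neg hu] at huv
          refine hf ?_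
          rw [Fin.le_def]
          have : u.1 ≠ k.1 := fun e => hu (Fin.ext e)
          have : v.1 ≠ k.1 := fun e => hv (Fin.ext e)
          split_ifs at huv <;> omega
      intro x y hxy
      exact key _ _ (by rwa [perm_apply_inv, perm_apply_inv])
    have := Tuple.unique_monotone hm (sort_monotone h₀)
    rw [hg, ← this]
    funext x
    simp only [Function.comp_apply, perm_inv_apply]
  have hinc : ∀ j, j ≤ b → ∀ u v : Fin n, u < v → f u = f v → c j u < c j v := by
    intro j hj u v huv e
    have hv : v ≠ k := fun hv => (hk u (hv ▸ huv)).ne (hv ▸ e)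
    rw [Fin.lt_def, hcv j hj, hcv j hj, if_neg hv]
    rw [Fin.lt_def] at huv
    have : v.1 ≠ k.1 := fun e => hv (Fin.ext e)
    by_cases hu : u = k
    · subst hu
      rw [if_pos rfl]; split_ifs <;> omega
    · have : u.1 ≠ k.1 := fun e => hu (Fin.ext e)
      rw [if_neg hu]; split_ifs <;> omega
  set F := Finset.univ.filter fun k' => f k' = f k with hF
  set G : Fin n → Finset (Equiv.Perm (Fin n)) := fun k' =>
    Finset.univ.filter fun y : Equiv.Perm (Fin n) => g ∘ y = Function.update f k' p with hG
  have hsumG : ∑ k' ∈ F, ∑ y ∈ G k', TPerm r y =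
      xSum r g * ∑ k' ∈ F, TPerm r (Tuple.sort (Function.update f k' p))⁻¹ := by
    rw [Finset.mul_sum]
    refine Finset.sum_congr rfl fun k' hk' => ?_
    have hfk : f k' = f k := by simpa [hF] using hk'
    -- Only a member of the coset is required: `k'` and `k` have the same color, so they may be
    -- exchanged before applying `c b`.
    refine sum_TPerm_coset (y₀ := c b * Equiv.swap k k') hgm ?_
    rw [Equiv.Perm.coe_mul, ← Function.comp_assoc, hgc b hab le_rfl]
    funext x
    simp only [Function.comp_apply]
    by_cases hx : x = k'
    · subst hx; simp [h₀k]
    · rw [Function.update_of_ne hx]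
      by_cases hx' : x = k
      · subst hx'
        rw [Equiv.swap_apply_left, h₀ne _ (Ne.symm hx), hfk]
      · rw [Equiv.swap_apply_of_ne_of_ne hx' hx, h₀ne _ hx']
  -- The pairs (j, w) are reindexed by (w⁻¹ k, c_j w). For a fixed entry `k'` of the row of `k`, the
  -- second components run over a full right coset of the Young subgroup of `g`, so x_g factors out
  -- on the left.
  refine ⟨_, Eq.trans ?_ hsumG⟩
  have hL : ∑ j ∈ Finset.Icc a b, cycT n r j (k.1 - j) * xSum r f =
      ∑ j ∈ Finset.Icc a b, ∑ w ∈ stab f, TPerm r (c j * w) := by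
    refine Finset.sum_congr rfl fun j hj => ?_
    rw [Finset.mem_Icc] at hj
    rw [xSum, Finset.mul_sum, ← TPerm_cyc (by omega)]
    exact Finset.sum_congr rfl fun w hw => TPerm_mul_of_mem_stab hf hw (hinc j hj.2)
  rw [hL, ← Finset.sum_product', Finset.sum_sigma']
  have mem1 : ∀ j, a ≤ j → j ≤ b → ∀ w ∈ stab f,
      f (w⁻¹ k) = f k ∧ g ∘ ⇑(c j * w) = Function.update f (w⁻¹ k) p := by
    intro j haj hjb w hw
    refine ⟨mem_stab.1 (inv_mem_stab hw) k, ?_⟩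
    rw [mem_stab] at hw
    rw [Equiv.Perm.coe_mul, ← Function.comp_assoc, hgc j haj hjb]
    funext x
    by_cases hx : x = w⁻¹ k
    · subst hx
      rw [Function.comp_apply, perm_apply_inv, h₀k, Function.update_self]
    · rw [Function.update_of_ne hx, Function.comp_apply, h₀ne, hw]
      rintro rfl
      exact hx (perm_inv_apply w x).symm
  have mem2 : ∀ k', f k' = f k → ∀ y : Equiv.Perm (Fin n), g ∘ y = Function.update f k' p →
      (a ≤ (y k').1 ∧ (y k').1 ≤ b) ∧ (c (y k').1)⁻¹ * y ∈ stab f := by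
    intro k' hk' y hy
    have h1 : g (y k') = p := by
      have := congrFun hy k'
      rwa [Function.update_self] at this
    have h2 := (hgp _).1 h1
    refine ⟨h2, mem_stab.2 fun x => ?_⟩
    have h3 : (c (y k').1)⁻¹ (y k') = k := by
      rw [Equiv.Perm.inv_eq_iff_eq, Fin.ext_iff, hck _ h2.2]
    rw [Equiv.Perm.mul_apply]
    by_cases hx : x = k'
    · rw [hx, h3, hk']
    · have h4 : (c (y k').1)⁻¹ (y x) ≠ k := by
        rw [← h3]
        intro e
        exact hx (y.injective ((c (y k').1)⁻¹.injective e))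
      rw [← h₀ne _ h4, ← hgc _ h2.1 h2.2, Function.comp_apply, perm_apply_inv]
      have := congrFun hy x
      rwa [Function.update_of_ne hx] at this
  refine Finset.sum_bij' (fun (z : ℕ × Equiv.Perm (Fin n)) _ =>
      (⟨z.2⁻¹ k, c z.1 * z.2⟩ : Σ _ : Fin n, Equiv.Perm (Fin n)))
    (fun z _ => ((z.2 z.1).1, (c (z.2 z.1).1)⁻¹ * z.2)) ?_ ?_ ?_ ?_ ?_
  · rintro ⟨j, w⟩ hz
    simp only [Finset.mem_product, Finset.mem_Icc] at hz
    have := mem1 j hz.1.1 hz.1.2 w hz.2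
    simp only [Finset.mem_sigma, hF, hG, Finset.mem_filter, Finset.mem_univ, true_and]
    exact this
  · rintro ⟨k', y⟩ hz
    simp only [Finset.mem_sigma, hF, hG, Finset.mem_filter, Finset.mem_univ, true_and] at hz
    have := mem2 k' hz.1 y hz.2
    simp only [Finset.mem_product, Finset.mem_Icc]
    exact this
  · rintro ⟨j, w⟩ hz
    simp only [Finset.mem_product, Finset.mem_Icc] at hz
    have e : ((c j * w) (w⁻¹ k)).1 = j := by
      rw [Equiv.Perm.mul_apply, perm_apply_inv, hck j hz.1.2]
    simp only [e, inv_mul_cancel_left]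
  · rintro ⟨k', y⟩ hz
    simp only [Finset.mem_sigma, hF, hG, Finset.mem_filter, Finset.mem_univ, true_and] at hz
    have := (mem2 k' hz.1 y hz.2).1
    have e : ((c (y k').1)⁻¹ * y)⁻¹ k = k' := by
      rw [mul_inv_rev, _root_.inv_inv, Equiv.Perm.mul_apply, Equiv.Perm.inv_eq_iff_eq, Fin.ext_iff,
        hck _ this.2]
    simp only [e, mul_inv_cancel_left]
  · rintro ⟨j, w⟩ _
    rfl

end Move


/-! ### Polynomials in the Jucys–Murphy elements -/

/-- This provides the field of fractions for the seminormal form and lets `X (hi i) - X (lo i)` be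
cancelled in polynomial identities. -/
instance (r : ℕ) : IsDomain (LaurentRing r) := by
  refine IsLocalization.isDomain_localization ?_
  rw [Submonoid.closure_le]
  rintro _ ⟨v, rfl⟩
  exact mem_nonZeroDivisors_of_ne_zero (X_ne_zero v)

/-- After multiplication by the unit q, substitute q L_(i+1) = T_i L_i T_i and expand the square of
T_i. -/
theorem T_mul_L_lo (i : Fin (n - 1)) :
    T r i * L r (lo i) + qm r • L r (hi i) = L r (hi i) * T r i := by
  refine q_smul_inj (r := r) ?_
  rw [← smul_mul_assoc, q_smul_L_hi, mul_assoc _ (T r i), T_mul_self, mul_add, mul_smul_comm,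
    mul_smul_comm, mul_one, ← q_smul_L_hi, smul_add, add_comm, smul_comm]

theorem T_mul_L_hi (i : Fin (n - 1)) :
    T r i * L r (hi i) = L r (lo i) * T r i + qm r • L r (hi i) := by
  refine q_smul_inj (r := r) ?_
  rw [← mul_smul_comm, q_smul_L_hi, mul_assoc, ← mul_assoc, T_mul_self, add_mul, smul_mul_assoc,
    smul_mul_assoc, one_mul, ← mul_assoc, ← q_smul_L_hi, smul_add, add_comm, smul_comm]

theorem evalJM_mul_comm (p p' : MvPolynomial (Fin n) (LaurentRing r)) :
    evalJM n r p * evalJM n r p' = evalJM n r p' * evalJM n r p := by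
  rw [← map_mul, mul_comm, map_mul]

/-- The Bernstein relation: moving `T_i` past a polynomial in the Jucys–Murphy elements. -/
theorem T_mul_evalJM (i : Fin (n - 1)) (p : MvPolynomial (Fin n) (LaurentRing r)) :
    ∃ d : MvPolynomial (Fin n) (LaurentRing r),
      (X (hi i) - X (lo i)) * d = p - rename (simpleSwap i) p ∧
      T r i * evalJM n r p = evalJM n r (rename (simpleSwap i) p) * T r i +
        qm r • evalJM n r (X (hi i) * d) := by
  induction p using MvPolynomial.induction_on with
  | C a =>
    refine ⟨0, by simp, ?_⟩
    rw [rename_C, mul_zero, map_zero, smul_zero, add_zero, ← MvPolynomial.algebraMap_eq,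
      AlgHom.commutes, Algebra.commutes]
  | add p p' h h' =>
    obtain ⟨d, h1, h2⟩ := h
    obtain ⟨d', h1', h2'⟩ := h'
    refine ⟨d + d', by rw [mul_add, h1, h1', map_add]; ring, ?_⟩
    rw [map_add, mul_add, h2, h2', mul_add, map_add, map_add, map_add, add_mul, smul_add]
    abel
  | mul_X p j h =>
    obtain ⟨d, h1, h2⟩ := h
    obtain ⟨d', h1', h2'⟩ : ∃ d' : MvPolynomial (Fin n) (LaurentRing r),
        (X (hi i) - X (lo i)) * d' = X j - rename (simpleSwap i) (X j) ∧
        T r i * evalJM n r (X j) = evalJM n r (rename (simpleSwap i) (X j)) * T r i +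
          qm r • evalJM n r (X (hi i) * d') := by
      by_cases hj : j = lo i
      · subst hj
        refine ⟨-1, by rw [rename_X, simpleSwap_lo]; ring, ?_⟩
        have e : (X (hi i) * -1 : MvPolynomial (Fin n) (LaurentRing r)) = -X (hi i) := by ring
        rw [rename_X, simpleSwap_lo, e, map_neg, evalJM_X, evalJM_X, ← T_mul_L_lo,
          smul_neg, add_neg_cancel_right]
      by_cases hj' : j = hi i
      · subst hj'
        refine ⟨1, by rw [rename_X, simpleSwap_hi]; ring, ?_⟩
        rw [rename_X, simpleSwap_hi, mul_one, evalJM_X, evalJM_X, T_mul_L_hi]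
      · refine ⟨0, by rw [rename_X, simpleSwap_of_ne hj hj']; ring, ?_⟩
        rw [rename_X, simpleSwap_of_ne hj hj', mul_zero, map_zero, smul_zero, add_zero, evalJM_X,
          T_mul_L_comm hj hj']
    -- The divided difference satisfies the twisted Leibniz rule ∂(p p') = s(p) ∂(p') + ∂(p) p'.
    refine ⟨rename (simpleSwap i) p * d' + d * X j, ?_, ?_⟩
    · rw [map_mul]
      linear_combination (rename (simpleSwap i) p) * h1' + X j * h1
    · have e : X (hi i) * (rename (simpleSwap i) p * d' + d * X j) =
          rename (simpleSwap i) p * (X (hi i) * d') + X (hi i) * d * X j := by ring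
      rw [e, map_add, map_mul (evalJM n r), ← mul_assoc, h2, add_mul, mul_assoc, h2']
      simp only [map_mul, mul_add, smul_add, smul_mul_assoc, mul_smul_comm, mul_assoc]
      abel

/-- For an invariant polynomial the divided difference is zero, since polynomials over a domain have
no zero divisors; the correction term of the Bernstein relation disappears. -/
theorem commute_T_evalJM {i : Fin (n - 1)} {p : MvPolynomial (Fin n) (LaurentRing r)}
    (h : rename (simpleSwap i) p = p) : Commute (T r i) (evalJM n r p) := by
  obtain ⟨d, h1, h2⟩ := T_mul_evalJM i p
  rw [h, sub_self, mul_eq_zero, or_iff_right] at h1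
  · rw [h1, mul_zero, map_zero, smul_zero, add_zero, h] at h2
    exact h2
  · rw [sub_eq_zero]
    exact fun e => lo_ne_hi i (X_injective e).symm

theorem adjoin_generators (n r : ℕ) :
    Algebra.adjoin (LaurentRing r) (Set.range (L r : Fin n → Hecke n r) ∪ Set.range (T r)) = ⊤ := by
  have h : Function.Surjective (RingQuot.mkAlgHom (LaurentRing r) (Rel n r (laurentVar r none)
    (fun c => (laurentVar r (some c) : LaurentRing r)))) := RingQuot.mkAlgHom_surjective _ _
  have h1 := congrArg (Subalgebra.map (RingQuot.mkAlgHom (LaurentRing r)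
    (Rel n r (laurentVar r none) (fun c => (laurentVar r (some c) : LaurentRing r)))))
    (FreeAlgebra.adjoin_range_ι (LaurentRing r) (Gen n))
  rw [AlgHom.map_adjoin, Algebra.map_top, (AlgHom.range_eq_top _).2 h] at h1
  rw [← h1]
  congr 1
  ext x
  constructor
  · rintro (⟨j, rfl⟩ | ⟨i, rfl⟩)
    · exact ⟨_, ⟨Gen.L j, rfl⟩, rfl⟩
    · exact ⟨_, ⟨Gen.T i, rfl⟩, rfl⟩
  · rintro ⟨_, ⟨g, rfl⟩, rfl⟩
    cases g with
    | L j => exact Or.inl ⟨j, rfl⟩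
    | T i => exact Or.inr ⟨i, rfl⟩

/-- Symmetric polynomials in the Jucys–Murphy elements are central. -/
theorem commute_of_isSymmetric {p : MvPolynomial (Fin n) (LaurentRing r)} (hp : p.IsSymmetric)
    (x : Hecke n r) : Commute x (evalJM n r p) := by
  have hx : x ∈ Algebra.adjoin (LaurentRing r)
      (Set.range (L r : Fin n → Hecke n r) ∪ Set.range (T r)) := by
    rw [adjoin_generators]; trivial
  induction hx using Algebra.adjoin_induction with
  | mem x hx =>
    obtain ⟨j, rfl⟩ | ⟨i, rfl⟩ := hx
    · rw [← evalJM_X]; exact evalJM_mul_comm _ _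
    · exact commute_T_evalJM (hp _)
  | algebraMap a => exact Algebra.commutes _ _
  | add x y _ _ hx hy => exact hx.add_left hy
  | mul x y _ _ hx hy => exact hx.mul_left hy

/-! ### The action of the Jucys–Murphy elements along a column of rows -/

/-- `L_j` for a natural number `j` (equal to `0` out of range). -/
def LN (n r j : ℕ) : Hecke n r := if h : j < n then L r ⟨j, h⟩ else 0

theorem TN_mul_self {i : ℕ} (h : i + 1 < n) :
    TN n r i * TN n r i = qm r • TN n r i + qpar r • 1 := by
  rw [TN, dif_pos (by omega), T_mul_self]

theorem TN_comm {i j : ℕ} (h : i + 1 < j) : TN n r i * TN n r j = TN n r j * TN n r i := by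
  unfold TN
  split_ifs
  · exact T_comm (Or.inl h)
  all_goals simp

theorem TN_braid {i : ℕ} (h : i + 2 < n) :
    TN n r i * TN n r (i + 1) * TN n r i = TN n r (i + 1) * TN n r i * TN n r (i + 1) := by
  rw [TN, TN, dif_pos (by omega), dif_pos (by omega), T_braid rfl]

theorem q_smul_LN_succ {i : ℕ} (h : i + 1 < n) :
    qpar r • LN n r (i + 1) = TN n r i * LN n r i * TN n r i := by
  rw [LN, LN, TN, dif_pos h, dif_pos (by omega), dif_pos (by omega)]
  exact q_smul_L_hi ⟨i, by omega⟩

theorem cycT_comm_of_lt {l j m : ℕ} (h : l + 1 < j) :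
    TN n r l * cycT n r j m = cycT n r j m * TN n r l := by
  induction m generalizing j with
  | zero => simp [cycT]
  | succ m ih =>
    rw [cycT, ← mul_assoc, TN_comm h, mul_assoc, ih (by omega), mul_assoc]

/-- The braid relation carries a generator through the cycle, lowering its index by one. -/
theorem TN_mul_cycT {l j m : ℕ} (h : j ≤ l) (h' : l + 1 < j + m) (hn : j + m < n) :
    TN n r (l + 1) * cycT n r j m = cycT n r j m * TN n r l := by
  induction m generalizing j with
  | zero => omega
  | succ m ih =>
    rcases h.lt_or_eq with h1 | rfl
    · rw [cycT, ← mul_assoc, ← TN_comm (by omega), mul_assoc, ih (by omega) (by omega) (by omega),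
        mul_assoc]
    · obtain ⟨m, rfl⟩ : ∃ m', m = m' + 1 := ⟨m - 1, by omega⟩
      rw [cycT, cycT, ← mul_assoc, ← mul_assoc, ← TN_braid (by omega), mul_assoc _ (TN n r j),
        cycT_comm_of_lt (by omega)]
      simp only [mul_assoc]

/-- The product `T_{j+m-1} ⋯ T_{j+1} T_j`. -/
def descT (n r : ℕ) : ℕ → ℕ → Hecke n r
  | _, 0 => 1
  | j, m + 1 => descT n r (j + 1) m * TN n r j

theorem descT_add (j m m' : ℕ) :
    descT n r j (m + m') = descT n r (j + m) m' * descT n r j m := by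
  induction m generalizing j with
  | zero => simp [descT]
  | succ m ih =>
    rw [show m + 1 + m' = (m + m') + 1 by omega, descT, descT, ih, mul_assoc,
      show j + 1 + m = j + (m + 1) by omega]

theorem cycT_add (j m m' : ℕ) :
    cycT n r j (m + m') = cycT n r j m * cycT n r (j + m) m' := by
  induction m generalizing j with
  | zero => simp [cycT]
  | succ m ih =>
    rw [show m + 1 + m' = (m + m') + 1 by omega, cycT, cycT, ih, mul_assoc,
      show j + 1 + m = j + (m + 1) by omega]

/-- Iterating q L_(i+1) = T_i L_i T_i expresses a later Jucys–Murphy element through an earlier one.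
-/
theorem q_pow_smul_LN {j m : ℕ} (h : j + m < n) :
    qpar r ^ m • LN n r (j + m) = descT n r j m * LN n r j * cycT n r j m := by
  induction m with
  | zero => simp [descT, cycT]
  | succ m ih =>
    have e1 : descT n r j (m + 1) = TN n r (j + m) * descT n r j m := by
      rw [descT_add]; simp [descT]
    have e2 : cycT n r j (m + 1) = cycT n r j m * TN n r (j + m) := by
      rw [cycT_add]; simp [cycT]
    rw [e1, e2, pow_succ, mul_smul, ← add_assoc, q_smul_LN_succ (by omega), mul_assoc, mul_assoc,
      mul_assoc, ← mul_assoc (descT n r j m), ← mul_assoc (descT n r j m * _), ← ih (by omega),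
      smul_mul_assoc, mul_smul_comm]

/-! ### Transporting an eigenvector of an earlier Jucys–Murphy element across rows -/

section Rows

variable {M : Type*} [AddCommGroup M] [Module (LaurentRing r) M] [Module (Hecke n r) M]
  [IsScalarTower (LaurentRing r) (Hecke n r) M]

theorem hecke_smul_comm (a : LaurentRing r) (x : Hecke n r) (v : M) : x • a • v = a • x • v := by
  rw [← smul_assoc a x v, Algebra.smul_def, Algebra.commutes, mul_smul, algebraMap_smul]

theorem descT_smul_of_eigen {j m : ℕ} {v : M}
    (h : ∀ l, j ≤ l → l < j + m → TN n r l • v = qpar r • v) :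
    descT n r j m • v = qpar r ^ m • v := by
  induction m generalizing j with
  | zero => simp [descT]
  | succ m ih =>
    rw [descT, mul_smul, h j le_rfl (by omega), hecke_smul_comm,
      ih fun l hl hl' => h l (by omega) (by omega), smul_smul, pow_succ']

/-- Write C_j = T_j ⋯ T_(k-1). The quadratic relation gives T_j C_j v = (q-1) C_j v + q C_(j+1) v.
On C_j v the remaining descending generators act by q: they pass through the cycle with their index
lowered and then meet `v`. On C_(j+1) v the induction continues. -/
theorem q_smul_descT_smul {k b m : ℕ} (hk : k < n) (hb : b ≤ k) (hm : m ≤ b) {v : M}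
    (hT : ∀ l, b - m ≤ l → l + 1 < b → TN n r l • v = qpar r • v) :
    qpar r • descT n r (b - m) m • cycT n r (b - m) (k - (b - m)) • v =
      qpar r ^ m • (qpar r • cycT n r b (k - b) • v +
        qm r • ∑ j ∈ Finset.Ico (b - m) b, cycT n r j (k - j) • v) := by
  induction m with
  | zero => simp [descT]
  | succ m ih =>
    have ih := ih (by omega) fun l hl hl' => hT l (by omega) hl'
    have hj : b - m = b - (m + 1) + 1 := by omega
    rw [hj] at ih
    set j := b - (m + 1) with hj'
    have e1 : cycT n r j (k - j) = TN n r j * cycT n r (j + 1) (k - (j + 1)) := by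
      rw [show k - j = k - (j + 1) + 1 by omega, cycT]
    have e2 : descT n r (j + 1) m • cycT n r j (k - j) • v =
        qpar r ^ m • cycT n r j (k - j) • v := by
      refine descT_smul_of_eigen fun l hl hl' => ?_
      obtain ⟨l, rfl⟩ : ∃ l', l = l' + 1 := ⟨l - 1, by omega⟩
      rw [← mul_smul, TN_mul_cycT (by omega) (by omega) (by omega), mul_smul,
        hT l (by omega) (by omega), hecke_smul_comm]
    have e3 : TN n r j • cycT n r j (k - j) • v =
        qm r • cycT n r j (k - j) • v + qpar r • cycT n r (j + 1) (k - (j + 1)) • v := by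
      conv_lhs => rw [e1]
      rw [← mul_smul, ← mul_assoc, TN_mul_self (by omega), add_mul, smul_mul_assoc, smul_mul_assoc,
        one_mul, ← e1, add_smul, smul_assoc, smul_assoc]
    rw [descT, mul_smul, e3, smul_add, hecke_smul_comm, hecke_smul_comm, e2, smul_add, ih,
      Finset.sum_eq_sum_Ico_succ_bot (by omega : j < b), pow_succ]
    simp only [smul_add, smul_smul]
    rw [mul_comm (qpar r) (qm r * _), mul_right_comm, mul_comm (qm r)]
    simp only [← mul_assoc, mul_comm]
    abel

/-- The vanishing sum replaces (q-1) ∑_(j<b) C_j v by -(q-1) C_b v, so the coefficient q of C_b v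
drops to 1. Crossing a full row therefore costs one factor q, the source of the q^(-i) in the
content. -/
theorem descT_smul_row {k a b : ℕ} (hk : k < n) (hb : b ≤ k) (hab : a < b) {v : M}
    (hT : ∀ l, a ≤ l → l + 1 < b → TN n r l • v = qpar r • v)
    (hsum : ∑ j ∈ Finset.Icc a b, cycT n r j (k - j) • v = 0) :
    qpar r • descT n r a (b - a) • cycT n r a (k - a) • v =
      qpar r ^ (b - a) • cycT n r b (k - b) • v := by
  have h := q_smul_descT_smul (m := b - a) hk hb (by omega) (v := v) fun l hl hl' =>
    hT l (by omega) hl'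
  rw [show b - (b - a) = a by omega] at h
  have e : Finset.Icc a b = insert b (Finset.Ico a b) := by
    ext x; simp only [Finset.mem_Icc, Finset.mem_insert, Finset.mem_Ico]; omega
  rw [e, Finset.sum_insert (by simp)] at hsum
  have h2 : qpar r • cycT n r b (k - b) • v +
      qm r • ∑ j ∈ Finset.Ico a b, cycT n r j (k - j) • v = cycT n r b (k - b) • v := by
    conv_lhs => rw [← qm_add_one, add_smul, one_smul]
    rw [add_right_comm, ← smul_add, hsum, smul_zero, zero_add]
  rw [h, h2]

/-- If the entry `P i` starts the row `i` of a component, the earlier rows being bounded by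
`P 0 < P 1 < ⋯ < P i`, the Jucys–Murphy element acts by the content. -/
theorem LN_smul_of_rows {P : ℕ → ℕ} {i : ℕ} (hP : ∀ t, t < i → P t < P (t + 1)) (hn : P i < n)
    {v : M} {Q : LaurentRing r}
    (hT : ∀ t l, t < i → P t ≤ l → l + 1 < P (t + 1) → TN n r l • v = qpar r • v)
    (hsum : ∀ t, t < i → ∑ j ∈ Finset.Icc (P t) (P (t + 1)), cycT n r j (P i - j) • v = 0)
    (hL : LN n r (P 0) • cycT n r (P 0) (P i - P 0) • v = Q • cycT n r (P 0) (P i - P 0) • v) :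
    qpar r ^ i • LN n r (P i) • v = Q • v := by
  have hle : ∀ m, m ≤ i → P (i - m) ≤ P i := by
    intro m hm
    induction m with
    | zero => simp
    | succ m ih =>
      have := hP (i - (m + 1)) (by omega)
      rw [show i - (m + 1) + 1 = i - m by omega] at this
      exact this.le.trans (ih (by omega))
  -- The rows above row `i` are crossed one at a time from the bottom; each of the `m` rows crossed
  -- contributes one factor q on the left.
  have key : ∀ m, m ≤ i → qpar r ^ m • descT n r (P (i - m)) (P i - P (i - m)) •
      cycT n r (P (i - m)) (P i - P (i - m)) • v = qpar r ^ (P i - P (i - m)) • v := by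
    intro m hm
    induction m with
    | zero => simp [descT, cycT]
    | succ m ih =>
      have ih := ih (by omega)
      have h1 := hP (i - (m + 1)) (by omega)
      have h2 := hT (i - (m + 1))
      have h3 := hsum (i - (m + 1)) (by omega)
      have h4 := hle m (by omega)
      rw [show i - (m + 1) + 1 = i - m by omega] at h1 h2 h3
      set a := P (i - (m + 1))
      set b := P (i - m)
      have h5 := descT_smul_row hn h4 h1 (fun l => h2 l (by omega)) h3
      rw [show P i - a = (b - a) + (P i - b) by omega, descT_add, show a + (b - a) = b by omega,
        show (b - a) + (P i - b) = P i - a by omega, mul_smul, pow_succ, mul_smul,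
        ← hecke_smul_comm (qpar r) (descT n r b _), h5, hecke_smul_comm, smul_comm, ih, smul_smul,
        ← pow_add, show b - a + (P i - b) = P i - a by omega]
  have h := key i le_rfl
  rw [Nat.sub_self] at h
  have h0 := hle i le_rfl
  rw [Nat.sub_self] at h0
  -- This writes L at `P i` as a descending product, L at `P 0`, and a cycle. The assumption at `P
  -- 0` evaluates the middle, and `key` with m = i evaluates the rest.
  have h6 := q_pow_smul_LN (r := r) (j := P 0) (m := P i - P 0) (n := n) (by omega)
  rw [show P 0 + (P i - P 0) = P i by omega] at h6
  have h7 := congrArg (fun x : Hecke n r => qpar r ^ i • x • v) h6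
  simp only [smul_assoc, mul_smul, hL] at h7
  rw [hecke_smul_comm, smul_comm _ Q, h, smul_comm _ (qpar r ^ (P i - P 0)),
    smul_comm Q (qpar r ^ (P i - P 0))] at h7
  have inj : ∀ (m : ℕ) (x y : M), qpar r ^ m • x = qpar r ^ m • y → x = y := by
    intro m
    induction m with
    | zero => simp
    | succ m ih =>
      intro x y hxy
      rw [pow_succ, mul_smul, mul_smul] at hxy
      exact q_smul_inj (ih _ _ hxy)
  exact inj _ _ _ h7

end Rows


/-! ### Colorings by rows of multipartitions -/

/-- The rows of a multipartition: pairs of a component and a row index, in lexicographic order. -/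
abbrev Row (r : ℕ) : Type := Fin r ×ₗ ℕ

/-- The row `i` of the component `c`. -/
abbrev row {r : ℕ} (c : Fin r) (i : ℕ) : Row r := toLex (c, i)

/-- The component of a row. -/
abbrev comp {r : ℕ} (p : Row r) : Fin r := (ofLex p).1

/-- The index of a row in its component. -/
abbrev idx {r : ℕ} (p : Row r) : ℕ := (ofLex p).2

theorem row_lt_row {c d : Fin r} {i j : ℕ} : row c i < row d j ↔ c < d ∨ c = d ∧ i < j :=
  Prod.Lex.toLex_lt_toLex

theorem row_le_row {c d : Fin r} {i j : ℕ} : row c i ≤ row d j ↔ c < d ∨ c = d ∧ i ≤ j :=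
  Prod.Lex.toLex_le_toLex

theorem lt_row {p : Row r} {c : Fin r} {i : ℕ} :
    p < row c i ↔ comp p < c ∨ comp p = c ∧ idx p < i := row_lt_row (c := comp p) (i := idx p)

theorem le_row {p : Row r} {c : Fin r} {i : ℕ} :
    p ≤ row c i ↔ comp p < c ∨ comp p = c ∧ idx p ≤ i := row_le_row (c := comp p) (i := idx p)

theorem lt_row_zero {p : Row r} {c : Fin r} : p < row c 0 ↔ comp p < c := by
  rw [lt_row]; simp

theorem lt_row_succ {p : Row r} {c : Fin r} {i : ℕ} : p < row c (i + 1) ↔ p ≤ row c i := by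
  rw [lt_row, le_row, Nat.lt_succ_iff]

theorem comp_mono {p p' : Row r} (h : p ≤ p') : comp p ≤ comp p' := by
  by_contra hc
  have : p' < row (comp p) 0 := lt_row_zero.2 (not_le.1 hc)
  exact absurd (lt_row_zero.1 (h.trans_lt this)) (lt_irrefl _)

/-- The number of entries in a row. -/
def len (f : Fin n → Row r) (p : Row r) : ℕ := (Finset.univ.filter fun k => f k = p).card

theorem cntLE_eq (f : Fin n → Row r) (p : Row r) : cntLE f p = cnt f p + len f p := by
  rw [cntLE, cnt, len, ← Finset.card_union_of_disjoint]
  · congr 1; ext k; simp [le_iff_lt_or_eq]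
  · rw [Finset.disjoint_filter]; exact fun k _ h => h.ne

theorem cnt_row_succ (f : Fin n → Row r) (c : Fin r) (i : ℕ) :
    cnt f (row c (i + 1)) = cntLE f (row c i) := by
  simp only [cnt, cntLE, lt_row_succ]

theorem cnt_row_succ' (f : Fin n → Row r) (c : Fin r) (i : ℕ) :
    cnt f (row c (i + 1)) = cnt f (row c i) + len f (row c i) := by
  rw [cnt_row_succ, cntLE_eq]

theorem cnt_row (f : Fin n → Row r) (c : Fin r) (i : ℕ) :
    cnt f (row c i) = cnt f (row c 0) + ∑ j ∈ Finset.range i, len f (row c j) := by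
  induction i with
  | zero => simp
  | succ i ih => rw [cnt_row_succ', ih, Finset.sum_range_succ, add_assoc]

theorem cnt_row_zero (f : Fin n → Row r) (c : Fin r) :
    cnt f (row c 0) = ∑ d ∈ Finset.univ.filter (· < c),
      (Finset.univ.filter fun k => comp (f k) = d).card := by
  rw [cnt, Finset.card_eq_sum_card_fiberwise (f := fun k => comp (f k))
    (t := Finset.univ.filter (· < c))]
  · refine Finset.sum_congr rfl fun d hd => ?_
    congr 1
    ext k
    simp only [Finset.mem_filter, Finset.mem_univ, true_and, lt_row_zero] at hd ⊢
    exact ⟨fun h => h.2, fun h => ⟨h ▸ hd, h⟩⟩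
  · intro k hk
    simpa [lt_row_zero] using hk

/-- `f` is the coloring of the entries by the rows of the initial tableau of shape `lam`. -/
structure IsColoring (lam : Multipartition r n) (f : Fin n → Row r) : Prop where
  mono : Monotone f
  cnt_eq : ∀ c i, cnt f (row c i) = partialSum lam c i

theorem partialSum_succ (lam : Multipartition r n) (c : Fin r) (i : ℕ) :
    partialSum lam c (i + 1) = partialSum lam c i + (lam.1 c).rowLen i := by
  rw [partialSum, partialSum, Finset.sum_range_succ, add_assoc]

theorem IsColoring.len_eq {lam : Multipartition r n} {f : Fin n → Row r} (h : IsColoring lam f)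
    (c : Fin r) (i : ℕ) : len f (row c i) = (lam.1 c).rowLen i := by
  have h1 := cnt_row_succ' f c i
  rw [h.cnt_eq, h.cnt_eq, partialSum_succ] at h1
  omega

theorem IsColoring.inRow_iff {lam : Multipartition r n} {f : Fin n → Row r}
    (h : IsColoring lam f) {c : Fin r} {i : ℕ} {k : Fin n} :
    InRow lam c i k ↔ f k = row c i := by
  rw [InRow, ← h.cnt_eq, ← h.cnt_eq, lt_cnt_iff h.mono, ← not_lt, lt_cnt_iff h.mono, lt_row_succ,
    not_lt]
  exact ⟨fun e => le_antisymm e.2 e.1, fun e => ⟨e.ge, e.le⟩⟩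

theorem IsColoring.youngSubgroup_eq {lam : Multipartition r n} {f : Fin n → Row r}
    (h : IsColoring lam f) : youngSubgroup lam = stab f := by
  ext w
  simp only [youngSubgroup, Finset.mem_filter, Finset.mem_univ, true_and, mem_stab, h.inRow_iff]
  refine ⟨fun hw k => (hw (comp (f k)) (idx (f k)) k).2 rfl, fun hw c i k => by rw [hw]⟩

/-- The polynomial `∏_c ∏_{k < N c} (X_k - Q_c)`. -/
def uPoly (N : Fin r → ℕ) : MvPolynomial (Fin n) (LaurentRing r) :=
  ∏ c : Fin r, ∏ k ∈ Finset.univ.filter (fun k : Fin n => k.1 < N c), (X k - C (Qpar c))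

/-- The element `m_f = u_f x_f` of a coloring. -/
def mCol (f : Fin n → Row r) : Hecke n r :=
  evalJM n r (uPoly fun c => cnt f (row c 0)) * xSum r f

theorem evalJM_C (a : LaurentRing r) : evalJM n r (C a) = algebraMap _ _ a := by
  rw [← MvPolynomial.algebraMap_eq, AlgHom.commutes]

theorem uElt_eq (lam : Multipartition r n) :
    uElt lam = evalJM n r (uPoly fun c => partialSum lam c 0) := by
  rw [uPoly, Fin.prod_univ_def, map_list_prod, List.map_map, uElt]
  congr 2
  funext c
  have : (Finset.univ.filter fun k : Fin n => k.1 < partialSum lam c 0) =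
      ((List.finRange n).filter fun k => k.1 < partialSum lam c 0).toFinset := by
    ext k; simp
  rw [Function.comp_apply, this, List.prod_toFinset _ ((List.nodup_finRange n).filter _),
    map_list_prod, List.map_map]
  congr 2
  funext k
  rw [Function.comp_apply, map_sub, evalJM_X, evalJM_C]

theorem IsColoring.mElt_eq {lam : Multipartition r n} {f : Fin n → Row r}
    (h : IsColoring lam f) : mElt lam = mCol f := by
  rw [mElt, uElt_eq, mCol, xElt, h.youngSubgroup_eq, xSum]
  simp only [h.cnt_eq]

/-! ### Cells, and the passage between multipartitions and colorings -/

theorem card_filter_fst_lt (Y : YoungDiagram) (i : ℕ) :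
    (Y.cells.filter fun x => x.1 < i).card = ∑ j ∈ Finset.range i, Y.rowLen j := by
  rw [Finset.card_eq_sum_card_fiberwise (f := Prod.fst) (t := Finset.range i)]
  · refine Finset.sum_congr rfl fun j hj => ?_
    rw [YoungDiagram.rowLen_eq_card]
    congr 1
    ext x
    simp only [Finset.mem_filter, Finset.mem_range, YoungDiagram.mem_row_iff,
      YoungDiagram.mem_cells] at hj ⊢
    exact ⟨fun h => ⟨h.1.1, h.2⟩, fun h => ⟨⟨h.1, h.2 ▸ hj⟩, h.2⟩⟩
  · intro x hx
    simpa using (Finset.mem_filter.1 hx).2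

/-- The cells of all components. -/
abbrev Cell (r : ℕ) : Type := Fin r × ℕ × ℕ

/-- The set of cells of a multipartition. -/
def cellSet (lam : Multipartition r n) : Finset (Cell r) :=
  Finset.univ.biUnion fun c => (lam.1 c).cells.image (Prod.mk c)

theorem mem_cellSet {lam : Multipartition r n} {x : Cell r} :
    x ∈ cellSet lam ↔ x.2 ∈ (lam.1 x.1).cells := by
  obtain ⟨c, x⟩ := x
  simp [cellSet]

theorem card_filter_cellSet (lam : Multipartition r n) (P : Cell r → Prop) [DecidablePred P] :
    ((cellSet lam).filter P).card = ∑ c, ((lam.1 c).cells.filter fun x => P (c, x)).card := by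
  rw [Finset.card_eq_sum_card_fiberwise (f := Prod.fst) (t := Finset.univ)
    (fun _ _ => Finset.mem_coe.2 (Finset.mem_univ _))]
  refine Finset.sum_congr rfl fun c _ => ?_
  refine Finset.card_bij' (fun x _ => x.2) (fun x _ => (c, x)) ?_ ?_ ?_ ?_
  · rintro ⟨d, x⟩ hx
    simp only [Finset.mem_filter, mem_cellSet] at hx ⊢
    obtain ⟨hx, rfl⟩ := hx
    exact hx
  · intro x hx
    simpa only [Finset.mem_filter, mem_cellSet, and_true] using hx
  · rintro ⟨d, x⟩ hx
    simp only [Finset.mem_filter] at hx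
    rw [← hx.2]
  · intro x _; rfl

theorem card_cellSet (lam : Multipartition r n) : (cellSet lam).card = n := by
  have := card_filter_cellSet lam fun _ => True
  simp only [Finset.filter_true] at this
  rw [this]
  exact lam.2

/-- Enumerate the cells arbitrarily, color each by its row, and sort; sorting does not change how
many entries each row receives. -/
theorem exists_isColoring (lam : Multipartition r n) : ∃ f, IsColoring lam f := by
  let e : Fin n ≃ cellSet lam := ((cellSet lam).equivFinOfCardEq (card_cellSet lam)).symm
  let h : Fin n → Row r := fun k => row (e k).1.1 (e k).1.2.1
  refine ⟨h ∘ Tuple.sort h, sort_monotone h, fun c i => ?_⟩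
  rw [cnt_comp]
  have h1 : cnt h (row c i) = ((cellSet lam).filter fun x => row x.1 x.2.1 < row c i).card := by
    refine Finset.card_bij (fun k _ => (e k).1) ?_ ?_ ?_
    · intro k hk
      simpa [h] using hk
    · intro k _ k' _ hkk
      exact e.injective (Subtype.ext hkk)
    · intro x hx
      rw [Finset.mem_filter] at hx
      refine ⟨e.symm ⟨x, hx.1⟩, ?_, by simp⟩
      simpa [h] using hx.2
  have h2 : ∀ d : Fin r, ((lam.1 d).cells.filter fun x => row d x.1 < row c i).card =
      (if d < c then (lam.1 d).card else 0) +
        if c = d then ∑ j ∈ Finset.range i, (lam.1 d).rowLen j else 0 := by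
    intro d
    rcases lt_trichotomy d c with hd | hd | hd
    · rw [if_pos hd, if_neg hd.ne', add_zero]
      congr 1
      refine Finset.filter_true_of_mem fun x _ => ?_
      exact row_lt_row.2 (Or.inl hd)
    · subst hd
      rw [if_neg (lt_irrefl _), if_pos rfl, zero_add, ← card_filter_fst_lt]
      congr 1
      ext x
      simp [row_lt_row]
    · rw [if_neg hd.not_gt, if_neg hd.ne]
      rw [add_zero, Finset.card_eq_zero]
      refine Finset.filter_false_of_mem fun x _ hx => ?_
      rcases row_lt_row.1 hx with h | h
      · exact lt_asymm h hd
      · exact hd.ne h.1.symm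
  rw [h1, card_filter_cellSet, Finset.sum_congr rfl fun d _ => h2 d, Finset.sum_add_distrib,
    ← Finset.sum_filter, Finset.sum_ite_eq, if_pos (Finset.mem_univ _)]
  rfl

/-- A monotone coloring whose row lengths decrease weakly in every component. -/
structure IsPart (f : Fin n → Row r) : Prop where
  mono : Monotone f
  len_succ_le : ∀ c i, len f (row c (i + 1)) ≤ len f (row c i)

theorem IsPart.len_anti {f : Fin n → Row r} (h : IsPart f) {c : Fin r} {i j : ℕ} (hij : i ≤ j) :
    len f (row c j) ≤ len f (row c i) :=
  antitone_nat_of_succ_le (f := fun i => len f (row c i)) (fun i => h.len_succ_le c i) hij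

theorem IsColoring.isPart {lam : Multipartition r n} {f : Fin n → Row r} (h : IsColoring lam f) :
    IsPart f := by
  refine ⟨h.mono, fun c i => ?_⟩
  rw [h.len_eq, h.len_eq]
  exact YoungDiagram.rowLen_anti _ _ _ (Nat.le_succ i)

theorem exists_idx_lt (f : Fin n → Row r) : ∃ N, ∀ k, idx (f k) < N :=
  ⟨Finset.univ.sup (fun k => idx (f k)) + 1, fun k => Nat.lt_succ_of_le
    (Finset.le_sup (f := fun k => idx (f k)) (Finset.mem_univ k))⟩

theorem len_pos_iff {f : Fin n → Row r} {p : Row r} : 0 < len f p ↔ ∃ k, f k = p := by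
  rw [len, Finset.card_pos]
  simp [Finset.Nonempty]

theorem IsPart.exists_isColoring {f : Fin n → Row r} (h : IsPart f) :
    ∃ lam : Multipartition r n, IsColoring lam f := by
  obtain ⟨N, hN⟩ := exists_idx_lt f
  have hmem : ∀ c i j, j < len f (row c i) → i < N ∧ j < n := by
    intro c i j hj
    obtain ⟨k, hk⟩ := len_pos_iff.1 ((Nat.zero_le j).trans_lt hj)
    refine ⟨?_, hj.trans_le ((Finset.card_le_univ _).trans (by simp))⟩
    have := hN k
    rwa [hk] at this
  let Y : Fin r → YoungDiagram := fun c =>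
    { cells := (Finset.range N ×ˢ Finset.range n).filter fun x => x.2 < len f (row c x.1)
      isLowerSet := by
        rintro ⟨i, j⟩ ⟨i', j'⟩ ⟨hi, hj⟩ hx
        simp only [Finset.coe_filter, Finset.mem_product, Finset.mem_range, Set.mem_ofPred_eq] at hx ⊢
        simp only at hi hj
        have h1 : j' < len f (row c i') := (hj.trans_lt hx.2).trans_le (h.len_anti hi)
        exact ⟨hmem _ _ _ h1, h1⟩ }
  have hY : ∀ c i, (Y c).rowLen i = len f (row c i) := by
    intro c i
    have : ∀ j, j < (Y c).rowLen i ↔ j < len f (row c i) := by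
      intro j
      rw [← YoungDiagram.mem_iff_lt_rowLen, ← YoungDiagram.mem_cells]
      simp only [Y, Finset.mem_filter, Finset.mem_product, Finset.mem_range]
      exact ⟨fun h => h.2, fun h => ⟨hmem _ _ _ h, h⟩⟩
    exact le_antisymm (not_lt.1 fun hl => lt_irrefl _ ((this _).1 hl))
      (not_lt.1 fun hl => lt_irrefl _ ((this _).2 hl))
  have hcard : ∀ c, (Y c).card = (Finset.univ.filter fun k => comp (f k) = c).card := by
    intro c
    have e1 : (Y c).card = ((Y c).cells.filter fun x => x.1 < N).card := by
      rw [Finset.filter_true_of_mem]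
      intro x hx
      simp only [Y, Finset.mem_filter, Finset.mem_product, Finset.mem_range] at hx
      exact hx.1.1
    rw [e1, card_filter_fst_lt, Finset.card_eq_sum_card_fiberwise (f := fun k => idx (f k))
      (t := Finset.range N) (fun k _ => by simpa using hN k)]
    refine Finset.sum_congr rfl fun i _ => ?_
    rw [hY, len]
    congr 1
    ext k
    simp only [Finset.mem_filter, Finset.mem_univ, true_and]
    constructor
    · intro hk; rw [hk]; exact ⟨rfl, rfl⟩
    · rintro ⟨rfl, rfl⟩; rfl
  refine ⟨⟨Y, ?_⟩, h.mono, fun c i => ?_⟩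
  · rw [Finset.sum_congr rfl fun c _ => hcard c, ← Finset.card_eq_sum_card_fiberwise
      (fun _ _ => Finset.mem_coe.2 (Finset.mem_univ _))]
    simp
  · rw [cnt_row, cnt_row_zero, partialSum]
    simp only [hcard, hY]

theorem IsColoring.strictlyDominates {lam mu : Multipartition r n} {f g : Fin n → Row r}
    (hf : IsColoring lam f) (hg : IsColoring mu g) (h : g < f) : StrictlyDominates mu lam := by
  refine ⟨fun c i => ?_, ?_⟩
  · rw [← hf.cnt_eq, ← hg.cnt_eq]
    exact (le_iff_cnt_le hf.mono hg.mono).1 h.le _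
  · rintro rfl
    refine h.not_ge ((le_iff_cnt_le hg.mono hf.mono).2 fun p => ?_)
    have h1 := hg.cnt_eq (comp p) (idx p)
    rw [← hf.cnt_eq] at h1
    exact h1.le

theorem eq_of_partialSum_eq {lam mu : Multipartition r n}
    (h : ∀ c i, partialSum lam c i = partialSum mu c i) : lam = mu := by
  refine Subtype.ext (funext fun c => ?_)
  ext ⟨i, j⟩
  have h1 := h c (i + 1)
  rw [partialSum_succ, partialSum_succ, h c i] at h1
  rw [YoungDiagram.mem_cells, YoungDiagram.mem_cells, YoungDiagram.mem_iff_lt_rowLen,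
    YoungDiagram.mem_iff_lt_rowLen, Nat.add_left_cancel h1]

theorem IsColoring.lt_of_strictlyDominates {lam mu : Multipartition r n} {f g : Fin n → Row r}
    (hf : IsColoring lam f) (hg : IsColoring mu g) (h : StrictlyDominates mu lam) : g < f := by
  refine lt_of_le_of_ne ((le_iff_cnt_le hf.mono hg.mono).2 fun p => ?_) ?_
  · have := h.1 (comp p) (idx p)
    rwa [← hf.cnt_eq, ← hg.cnt_eq] at this
  · rintro rfl
    exact h.2 (eq_of_partialSum_eq fun c i => by rw [← hf.cnt_eq, ← hg.cnt_eq])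


/-! ### Ideals generated by the `m_mu` -/

/-- Each factor of u_f runs over all entries of the components before some `c`. It thus contains
both or neither of two adjacent entries of the same component and is invariant under their exchange.
-/
theorem T_commute_uPoly {f : Fin n → Row r} (hf : Monotone f) {i : Fin (n - 1)}
    (h : comp (f (lo i)) = comp (f (hi i))) :
    Commute (T r i) (evalJM n r (uPoly fun c => cnt f (row c 0))) := by
  refine commute_T_evalJM ?_
  rw [uPoly, map_prod]
  refine Finset.prod_congr rfl fun c _ => ?_
  rw [map_prod]
  refine Finset.prod_equiv (simpleSwap i) ?_ ?_
  · intro k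
    simp only [Finset.mem_filter, Finset.mem_univ, true_and, lt_cnt_iff hf, lt_row_zero]
    have := mem_stab.1 (simpleSwap_mem_stab (f := fun k => comp (f k)) h) k
    rw [this]
  · intro k _
    rw [map_sub, rename_X, rename_C]

theorem T_mul_mCol {f : Fin n → Row r} (hf : Monotone f) {i : Fin (n - 1)}
    (h : f (lo i) = f (hi i)) : T r i * mCol f = qpar r • mCol f := by
  rw [mCol, ← mul_assoc, (T_commute_uPoly hf (by rw [h])).eq, mul_assoc, T_mul_xSum h,
    mul_smul_comm]

theorem cnt_swap_rows (g : Fin n → Row r) (c : Fin r) (i : ℕ) (p : Row r)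
    (hp : p ≠ row c (i + 1)) :
    cnt (Equiv.swap (row c i) (row c (i + 1)) ∘ g) p = cnt g p := by
  rw [cnt, cnt]
  congr 1
  ext k
  simp only [Finset.mem_filter, Finset.mem_univ, true_and, Function.comp_apply]
  have hlt : row c i < row c (i + 1) := row_lt_row.2 (Or.inr ⟨rfl, Nat.lt_succ_self i⟩)
  have key : row c i < p ↔ row c (i + 1) < p := by
    constructor
    · intro h
      refine lt_of_le_of_ne ?_ hp.symm
      by_contra hc
      exact absurd (lt_row_succ.1 (not_le.1 hc)) (not_le.2 h)
    · exact fun h => hlt.trans h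
  by_cases h1 : g k = row c i
  · rw [h1, Equiv.swap_apply_left, key]
  by_cases h2 : g k = row c (i + 1)
  · rw [h2, Equiv.swap_apply_right, key]
  rw [Equiv.swap_apply_of_ne_of_ne h1 h2]

theorem cnt_swap_rows_self (g : Fin n → Row r) (c : Fin r) (i : ℕ) :
    cnt (Equiv.swap (row c i) (row c (i + 1)) ∘ g) (row c (i + 1)) =
      cnt g (row c i) + len g (row c (i + 1)) := by
  rw [cnt, cnt, len, ← Finset.card_union_of_disjoint]
  · congr 1
    ext k
    simp only [Finset.mem_filter, Finset.mem_univ, true_and, Function.comp_apply, Finset.mem_union]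
    have hlt : row c i < row c (i + 1) := row_lt_row.2 (Or.inr ⟨rfl, Nat.lt_succ_self i⟩)
    by_cases h1 : g k = row c i
    · rw [h1, Equiv.swap_apply_left]
      simp [hlt.ne]
    by_cases h2 : g k = row c (i + 1)
    · rw [h2, Equiv.swap_apply_right]
      simp [hlt]
    rw [Equiv.swap_apply_of_ne_of_ne h1 h2, lt_row_succ, le_iff_lt_or_eq]
    simp [h1, h2]
  · rw [Finset.disjoint_filter]
    rintro k _ h1 h2
    rw [h2] at h1
    exact absurd h1 (not_lt.2 (row_le_row.2 (Or.inr ⟨rfl, Nat.le_succ i⟩)))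

/-- The element of a coloring lies in every two-sided ideal containing the elements of the
multipartitions dominating it. -/
theorem mCol_mem {J : TwoSidedIdeal (Hecke n r)} {g : Fin n → Row r} (hg : Monotone g)
    (hJ : ∀ (mu : Multipartition r n) (f : Fin n → Row r), IsColoring mu f → f ≤ g → mElt mu ∈ J) :
    mCol g ∈ J := by
  induction g using WellFoundedLT.induction with
  | _ g ih =>
    by_cases hpart : ∀ c i, len g (row c (i + 1)) ≤ len g (row c i)
    · obtain ⟨mu, hmu⟩ := IsPart.exists_isColoring ⟨hg, hpart⟩
      rw [← hmu.mElt_eq]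
      exact hJ mu g hmu le_rfl
    push Not at hpart
    obtain ⟨c, i, hci⟩ := hpart
    -- A shorter row precedes a longer one in the same component. Exchanging them and sorting yields
    -- a strictly smaller coloring with the same components, to which the induction applies.
    set τ := Equiv.swap (row c i) (row c (i + 1)) with hτ
    set h := τ ∘ g with hh
    set g' := h ∘ Tuple.sort h with hg'
    have hgm : Monotone g' := sort_monotone h
    have hc1 : ∀ p, p ≠ row c (i + 1) → cnt g' p = cnt g p := fun p hp => by
      rw [hg', cnt_comp, hh, hτ, cnt_swap_rows g c i p hp]
    have hc2 : cnt g (row c (i + 1)) < cnt g' (row c (i + 1)) := by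
      rw [hg', cnt_comp, hh, hτ, cnt_swap_rows_self, cnt_row_succ']
      omega
    have hc0 : ∀ d, cnt g' (row d 0) = cnt g (row d 0) := fun d => hc1 _ (by
      intro e
      have : 0 = i + 1 := congrArg idx e
      omega)
    have hlt : g' < g := by
      refine lt_of_le_of_ne ((le_iff_cnt_le hg hgm).2 fun p => ?_) ?_
      · by_cases hp : p = row c (i + 1)
        · rw [hp]; exact hc2.le
        · exact (hc1 p hp).ge
      · intro e
        rw [e] at hc2
        exact lt_irrefl _ hc2
    have hmem := ih g' hlt hgm fun mu f hf hle => hJ mu f hf (hle.trans hlt.le)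
    have hcomp : ∀ k, comp (g' k) = comp (g k) := by
      intro k
      have key : ∀ d, comp (g' k) < d ↔ comp (g k) < d := fun d => by
        rw [← lt_row_zero, ← lt_row_zero, ← lt_cnt_iff hgm, ← lt_cnt_iff hg, hc0]
      exact le_antisymm (not_lt.1 fun e => lt_irrefl _ ((key _).2 e))
        (not_lt.1 fun e => lt_irrefl _ ((key _).1 e))
    have hcomp' : ∀ p, comp (τ p) = comp p := by
      intro p
      by_cases h1 : p = row c i
      · rw [h1, hτ, Equiv.swap_apply_left]; rfl
      by_cases h2 : p = row c (i + 1)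
      · rw [h2, hτ, Equiv.swap_apply_right]; rfl
      rw [hτ, Equiv.swap_apply_of_ne_of_ne h1 h2]
    have hd : (Tuple.sort h)⁻¹ ∈ stab (fun k => comp (g k)) := by
      rw [mem_stab]
      intro k
      rw [← hcomp, hg', Function.comp_apply, perm_apply_inv, hh, Function.comp_apply, hcomp']
    have hcomm : Commute (TPerm r (Tuple.sort h)⁻¹)
        (evalJM n r (uPoly fun c => cnt g (row c 0))) :=
      commute_TPerm (f := fun k => comp (g k)) (fun a b hab => comp_mono (hg hab))
        (fun i hi' => T_commute_uPoly hg hi') hd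
    -- The sorting permutation preserves components, so its T commutes with u, and it conjugates x_g
    -- into x_g'. As this T is invertible, m_g and m_g' generate the same two-sided ideal.
    have hconj : TPerm r (Tuple.sort h)⁻¹ * mCol g = mCol g' * TPerm r (Tuple.sort h)⁻¹ := by
      have hm' : mCol g' = evalJM n r (uPoly fun c => cnt g (row c 0)) * xSum r g' := by
        rw [mCol]; simp only [hc0]
      rw [hm', mCol, ← mul_assoc, hcomm.eq, mul_assoc, hh, TPerm_sort_mul_xSum hg τ.injective, ← hh,
        ← mul_assoc]
    obtain ⟨u, hu⟩ := isUnit_TPerm (r := r) (Tuple.sort h)⁻¹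
    have : mCol g = ↑u⁻¹ * (mCol g' * TPerm r (Tuple.sort h)⁻¹) := by
      rw [← hconj, ← hu, Units.inv_mul_cancel_left]
    rw [this]
    exact J.mul_mem_left _ _ (J.mul_mem_right _ _ hmem)

theorem mCol_mem_dominatingIdeal {lam : Multipartition r n} {f g : Fin n → Row r}
    (hf : IsColoring lam f) (hg : Monotone g) (h : g < f) (x : Hecke n r) :
    mCol g * x ∈ dominatingIdeal lam := by
  rw [dominatingIdeal, TwoSidedIdeal.mem_asIdeal]
  refine TwoSidedIdeal.mul_mem_right _ _ _ (mCol_mem hg fun mu f' hf' hle => ?_)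
  exact TwoSidedIdeal.subset_span ⟨mu, hf.strictlyDominates hf' (hle.trans_lt h), rfl⟩

/-! ### The action of the Jucys–Murphy elements on `m_lam` -/

theorem cycT_commute_uPoly {f : Fin n → Row r} (hf : Monotone f) {c : Fin r} {j m : ℕ}
    (h : j + m < n) (hcomp : ∀ k : Fin n, j ≤ k.1 → k.1 ≤ j + m → comp (f k) = c) :
    Commute (cycT n r j m) (evalJM n r (uPoly fun c => cnt f (row c 0))) := by
  induction m generalizing j with
  | zero => simp [cycT]
  | succ m ih =>
    rw [cycT]
    refine Commute.mul_left ?_ (ih (by omega) fun k hk hk' => hcomp k (by omega) (by omega))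
    rw [TN, dif_pos (by omega)]
    refine T_commute_uPoly hf ?_
    rw [hcomp, hcomp] <;> simp only [lo, hi] <;> omega

/-- Recoloring `k` by an earlier row decreases no count and raises the count of entries before its
old row. -/
theorem update_lt {f : Fin n → Row r} (hf : Monotone f) {k : Fin n} {p : Row r} (hp : p < f k) :
    Function.update f k p ∘ Tuple.sort (Function.update f k p) < f := by
  have hle : ∀ p', cnt f p' ≤ cnt (Function.update f k p) p' := by
    intro p'
    refine Finset.card_le_card fun x => ?_
    simp only [Finset.mem_filter, Finset.mem_univ, true_and]
    intro hx
    by_cases h : x = k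
    · subst h; rw [Function.update_self]; exact hp.trans hx
    · rwa [Function.update_of_ne h]
  refine lt_of_le_of_ne ((le_iff_cnt_le hf (sort_monotone _)).2 fun p' => ?_) ?_
  · rw [cnt_comp]; exact hle p'
  · intro e
    have h1 := cnt_comp (Function.update f k p) (f k) (Tuple.sort (Function.update f k p))
    rw [e] at h1
    have h2 : cnt f (f k) < cnt (Function.update f k p) (f k) := by
      refine Finset.card_lt_card (Finset.ssubset_iff_of_subset ?_ |>.2 ⟨k, ?_, ?_⟩)
      · intro x
        simp only [Finset.mem_filter, Finset.mem_univ, true_and]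
        intro hx
        rw [Function.update_of_ne]
        · exact hx
        · rintro rfl; exact lt_irrefl _ hx
      · simpa using hp
      · simp
    omega

theorem cnt_update (f : Fin n → Row r) {k : Fin n} {p p' : Row r} (h : p < p' ↔ f k < p') :
    cnt (Function.update f k p) p' = cnt f p' := by
  rw [cnt, cnt]
  congr 1
  ext x
  by_cases hx : x = k
  · subst hx; simp [h]
  · simp [Function.update_of_ne hx]

theorem cnt_update' (f : Fin n → Row r) {k : Fin n} {p p' : Row r} (h : p < p')
    (h' : ¬ f k < p') : cnt (Function.update f k p) p' = cnt f p' + 1 := by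
  rw [cnt, cnt, ← Finset.card_insert_of_notMem (a := k)]
  · congr 1
    ext x
    by_cases hx : x = k
    · subst hx; simp [h]
    · simp [hx]
  · simpa using h'

/-- Moving an entry from component `c` to the preceding one enlarges only the product attached to
`c`, by one linear factor. -/
theorem uPoly_update {N N' : Fin r → ℕ} {c : Fin r} (hc : N' c = N c + 1)
    (h : ∀ d, d ≠ c → N' d = N d) (hn : N c < n) :
    (uPoly N' : MvPolynomial (Fin n) (LaurentRing r)) =
      (X ⟨N c, hn⟩ - C (Qpar c)) * uPoly N := by
  rw [uPoly, uPoly, ← Finset.mul_prod_erase _ _ (Finset.mem_univ c),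
    ← Finset.mul_prod_erase Finset.univ _ (Finset.mem_univ c), ← mul_assoc]
  congr 1
  · have : (Finset.univ.filter fun k : Fin n => k.1 < N' c) =
        insert ⟨N c, hn⟩ (Finset.univ.filter fun k : Fin n => k.1 < N c) := by
      ext k
      simp only [Finset.mem_filter, Finset.mem_univ, true_and, Finset.mem_insert, Fin.ext_iff, hc]
      omega
    rw [this, Finset.prod_insert (by simp)]
  · refine Finset.prod_congr rfl fun d hd => ?_
    rw [h d (Finset.ne_of_mem_erase hd)]

/-- For d ≠ c, u already contains the factor of the first variable with parameter Q_d. The extra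
factor completes the product of the cyclotomic relation. -/
theorem evalJM_uPoly_first {N : Fin r → ℕ} {c : Fin r} (hn : 0 < n)
    (h : ∀ d, d ≠ c → 0 < N d) :
    evalJM n r ((X ⟨0, hn⟩ - C (Qpar c)) * uPoly N) = 0 := by
  have hdvd : (∏ d : Fin r, (X ⟨0, hn⟩ - C (Qpar d)) : MvPolynomial (Fin n) (LaurentRing r)) ∣
      (X ⟨0, hn⟩ - C (Qpar c)) * uPoly N := by
    rw [uPoly, ← Finset.mul_prod_erase Finset.univ _ (Finset.mem_univ c),
      ← Finset.mul_prod_erase Finset.univ (fun d => ∏ _ ∈ _, _) (Finset.mem_univ c)]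
    refine mul_dvd_mul dvd_rfl (Dvd.dvd.mul_left (Finset.prod_dvd_prod_of_dvd _ _ fun d hd => ?_) _)
    exact Finset.dvd_prod_of_mem (fun k : Fin n => (X k - C (Qpar d) :
      MvPolynomial (Fin n) (LaurentRing r)))
      (by simpa using h d (Finset.ne_of_mem_erase hd))
  obtain ⟨s, hs⟩ := hdvd
  have h1 : evalJM n r (∏ d : Fin r, (X ⟨0, hn⟩ - C (Qpar d))) = 0 := by
    have h2 : (∏ d : Fin r, (X ⟨0, hn⟩ - C (Qpar d)) : MvPolynomial (Fin n) (LaurentRing r)) =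
        Polynomial.aeval (X ⟨0, hn⟩ : MvPolynomial (Fin n) (LaurentRing r))
          (∏ d : Fin r, (Polynomial.X - Polynomial.C (Qpar d))) := by
      rw [map_prod]
      refine Finset.prod_congr rfl fun d _ => ?_
      rw [map_sub, Polynomial.aeval_X, Polynomial.aeval_C, MvPolynomial.algebraMap_eq]
    rw [h2, ← Polynomial.aeval_algHom_apply, evalJM_X]
    exact cyclotomic_relation _ rfl
  rw [hs, map_mul, h1, zero_mul]

/-- The content of a cell. -/
def content (x : Cell r) : (LaurentRing r)ˣ :=
  laurentVar r (some x.1) * laurentVar r none ^ x.2.2 * (laurentVar r none ^ x.2.1)⁻¹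

/-- The cell of the entry `k` in the initial tableau of a coloring. -/
def tabCell (f : Fin n → Row r) (k : Fin n) : Cell r :=
  (comp (f k), idx (f k), k.1 - cnt f (f k))

theorem eq_row_iff {f : Fin n → Row r} (hf : Monotone f) {c : Fin r} {i : ℕ} {k : Fin n} :
    f k = row c i ↔ cnt f (row c i) ≤ k.1 ∧ k.1 < cnt f (row c (i + 1)) := by
  rw [lt_cnt_iff hf, ← not_lt, lt_cnt_iff hf, lt_row_succ, not_lt]
  exact ⟨fun e => ⟨e.ge, e.le⟩, fun e => le_antisymm e.2 e.1⟩

/-- The head of row `i` of component `c` is reached through `LN_smul_of_rows`, with `P t` the start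
of row `t`. The sums over earlier rows vanish since they are multiples of dominating m_g. The base
case asks that L at the first entry of the component act by Q_c on the cycled generator. -/
theorem L_smul_first {lam : Multipartition r n} {f : Fin n → Row r} (hf : IsColoring lam f)
    {c : Fin r} {i : ℕ} {k : Fin n} (hk : f k = row c i) (hk' : k.1 = cnt f (row c i)) :
    qpar r ^ i • LN n r k.1 • (Submodule.Quotient.mk (mElt lam) : Hecke n r ⧸ dominatingIdeal lam) =
      Qpar c • (Submodule.Quotient.mk (mElt lam) : Hecke n r ⧸ dominatingIdeal lam) := by
  have hm := hf.mono
  have hfirst : ∀ x, x < k → f x < f k := by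
    intro x hx
    rw [hk, ← lt_cnt_iff hm, ← hk']
    exact hx
  have hlen : 0 < len f (row c i) := len_pos_iff.2 ⟨k, hk⟩
  set P : ℕ → ℕ := fun t => cnt f (row c t) with hP
  have hPmono : Monotone P := monotone_nat_of_le_succ fun t => by
    simp only [hP, cnt_row_succ']; omega
  have hcompP : ∀ x : Fin n, P 0 ≤ x.1 → x.1 ≤ k.1 → comp (f x) = c := by
    intro x hx hx'
    have h1 : ¬ comp (f x) < c := by
      rw [← lt_row_zero, ← lt_cnt_iff hm]; exact not_lt.2 hx
    have h2 := comp_mono (hm (Fin.le_def.2 hx'))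
    rw [hk] at h2
    exact le_antisymm h2 (not_lt.1 h1)
  have hP0 : P 0 ≤ k.1 := hk' ▸ hPmono (Nat.zero_le i)
  have hPi : P i = k.1 := hk'.symm
  have hkn := k.2
  have hmk : ∀ y : Hecke n r, y • (Submodule.Quotient.mk (mElt lam) : Hecke n r ⧸ dominatingIdeal lam)
      = Submodule.Quotient.mk (y * mElt lam) := fun y => rfl
  have hcyc : ∀ j, P 0 ≤ j → j ≤ k.1 → ∀ p : MvPolynomial (Fin n) (LaurentRing r),
      evalJM n r p * (cycT n r j (k.1 - j) * mElt lam) =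
      evalJM n r (p * uPoly fun d => cnt f (row d 0)) * (cycT n r j (k.1 - j) * xSum r f) := by
    intro j hj hj' p
    have := cycT_commute_uPoly (c := c) hm (j := j) (m := k.1 - j) (by omega)
      fun x hx hx' => hcompP x (by omega) (by omega)
    rw [hf.mElt_eq, mCol, ← mul_assoc (cycT _ _ _ _), this.eq, map_mul]
    simp only [mul_assoc]
  rw [← hPi]
  refine LN_smul_of_rows (n := n) (r := r) (M := Hecke n r ⧸ dominatingIdeal lam) (P := P) (i := i) ?_ (by rw [hPi]; exact k.2) ?_ ?_ ?_
  -- Row `i` contains `k`, so the earlier rows of the component are nonempty too.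
  · intro t ht
    have := hf.isPart.len_anti (c := c) ht.le
    simp only [hP, cnt_row_succ']
    omega
  · intro t l _ hl hl'
    have hln : l + 1 < n := hl'.trans_le (cnt_le _ _)
    rw [hmk, TN, dif_pos (by omega), hf.mElt_eq, T_mul_mCol hm]
    · rfl
    · have h1 : f (lo ⟨l, by omega⟩) = row c t := (eq_row_iff hm).2 ⟨hl, (Nat.lt_succ_self l).trans hl'⟩
      have h2 : f (hi ⟨l, by omega⟩) = row c t := (eq_row_iff hm).2
        ⟨by simp only [hi]; exact hl.trans (Nat.le_succ l), by simp only [hi]; exact hl'⟩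
      rw [h1, h2]
  · intro t ht
    have hp : row c t < f k := by rw [hk]; exact row_lt_row.2 (Or.inr ⟨rfl, ht⟩)
    obtain ⟨x, hx⟩ := exists_sum_cycT_mul_xSum (r := r) hm hfirst hp
    set g := Function.update f k (row c t) ∘ Tuple.sort (Function.update f k (row c t)) with hg
    have hu : ∀ d, cnt g (row d 0) = cnt f (row d 0) := fun d => by
      rw [hg, cnt_comp, cnt_update]
      rw [lt_row_zero, lt_row_zero, hk]
      rfl
    simp only [hmk]
    change ∑ j ∈ _, (dominatingIdeal lam).mkQ (cycT n r j (P i - j) * mElt lam) = 0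
    rw [← map_sum, Submodule.mkQ_apply, Submodule.Quotient.mk_eq_zero]
    have e : ∑ j ∈ Finset.Icc (P t) (P (t + 1)), cycT n r j (P i - j) * mElt lam = mCol g * x := by
      rw [mCol, mul_assoc, ← hx, Finset.mul_sum]
      simp only [hu]
      rw [← cnt_row_succ, hPi]
      refine Finset.sum_congr rfl fun j hj => ?_
      rw [Finset.mem_Icc] at hj
      have := hcyc j ((hPmono (Nat.zero_le t)).trans hj.1)
        (hj.2.trans (hPi ▸ hPmono (Nat.succ_le_of_lt ht))) 1
      rwa [map_one, one_mul, one_mul] at this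
    rw [e]
    exact mCol_mem_dominatingIdeal hf (sort_monotone _) (update_lt hm hp) x
  · have hP0n : P 0 < n := hP0.trans_lt k.2
    have hgoal : evalJM n r (X ⟨P 0, hP0n⟩ - C (Qpar c)) * (cycT n r (P 0) (k.1 - P 0) * mElt lam)
        ∈ dominatingIdeal lam := by
      rw [hcyc _ le_rfl hP0]
      -- In the first component the factor L - Q_c completes the cyclotomic relation. In a later one
      -- it turns u_f into u_g for the coloring that moves `k` to the preceding component, and the
      -- result lies in the ideal.
      by_cases hc : c.1 = 0
      · have h0 : P 0 = 0 := by
          simp only [hP, cnt, lt_row_zero, Fin.lt_def, hc]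
          simp
        have h1 := evalJM_uPoly_first (n := n) (r := r) (N := fun d => cnt f (row d 0)) (c := c)
          (by omega) (by
            intro d hd
            refine (Nat.zero_le k.1).trans_lt ((lt_cnt_iff hm).2 ?_)
            rw [lt_row_zero, hk]
            have : d.1 ≠ c.1 := fun e => hd (Fin.ext e)
            rw [Fin.lt_def]
            change c.1 < d.1
            omega)
        have h2 : (⟨P 0, hP0n⟩ : Fin n) = ⟨0, by omega⟩ := Fin.ext h0
        rw [h2, h1, zero_mul]
        exact Submodule.zero_mem _
      -- As `N` exceeds all row indices in use, row `N` of the preceding component is empty. The sum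
      -- of `exists_sum_cycT_mul_xSum` then has the single term j = P 0.
      · obtain ⟨N, hN⟩ := exists_idx_lt f
        set c' : Fin r := ⟨c.1 - 1, by omega⟩ with hc'
        have hcc : c' < c := by rw [Fin.lt_def]; simp only [hc']; omega
        have hcc' : ∀ d, c' < d ↔ c ≤ d := fun d => by
          rw [Fin.lt_def, Fin.le_def]; simp only [hc']; omega
        have hiff : ∀ x, f x < row c' N ↔ f x < row c 0 := fun x => by
          rw [lt_row_zero, lt_row, and_iff_left (hN x), ← le_iff_lt_or_eq, ← not_lt, hcc', not_le]
        have hiff' : ∀ x, f x ≤ row c' N ↔ f x < row c 0 := fun x => by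
          rw [lt_row_zero, le_row, and_iff_left (hN x).le, ← le_iff_lt_or_eq, ← not_lt, hcc',
            not_le]
        have e1 : cnt f (row c' N) = P 0 := by simp only [hP, cnt, hiff]
        have e2 : cntLE f (row c' N) = P 0 := by simp only [hP, cnt, cntLE, hiff']
        have hp : row c' N < f k := by rw [hk]; exact row_lt_row.2 (Or.inl hcc)
        obtain ⟨x, hx⟩ := exists_sum_cycT_mul_xSum (r := r) hm hfirst hp
        rw [e1, e2, Finset.Icc_self, Finset.sum_singleton] at hx
        set g := Function.update f k (row c' N) ∘ Tuple.sort (Function.update f k (row c' N)) with hg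
        have hu1 : cnt g (row c 0) = cnt f (row c 0) + 1 := by
          rw [hg, cnt_comp, cnt_update' f (lt_row_zero.2 hcc)]
          rw [lt_row_zero, hk]
          exact lt_irrefl _
        have hu2 : ∀ d, d ≠ c → cnt g (row d 0) = cnt f (row d 0) := fun d hd => by
          rw [hg, cnt_comp, cnt_update]
          rw [lt_row_zero, lt_row_zero, hk]
          change c' < d ↔ c < d
          rw [hcc']
          exact ⟨fun h => lt_of_le_of_ne h hd.symm, fun h => h.le⟩
        have hu3 := uPoly_update (n := n) (N := fun d => cnt f (row d 0))
          (N' := fun d => cnt g (row d 0)) (c := c) hu1 hu2 hP0n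
        rw [hx]
        have hu4 : (X ⟨P 0, hP0n⟩ - C (Qpar c)) * uPoly (fun d => cnt f (row d 0)) =
            uPoly (fun d => cnt g (row d 0)) := hu3.symm
        rw [hu4, ← mul_assoc]
        exact mCol_mem_dominatingIdeal hf (sort_monotone _) (update_lt hm hp) x
    rw [map_sub, evalJM_X, evalJM_C, sub_mul] at hgoal
    rw [LN, dif_pos hP0n, hPi, hmk]
    refine (Submodule.Quotient.eq _).2 ?_
    change L r ⟨P 0, hP0n⟩ * _ - Qpar c • (cycT n r (P 0) (k.1 - P 0) * mElt lam) ∈ _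
    rwa [Algebra.smul_def]

section Module

variable {M : Type*} [AddCommGroup M] [Module (LaurentRing r) M] [Module (Hecke n r) M]

theorem L_smul_of_first {k : Fin n} {v : M} {c : Fin r} {i : ℕ}
    (h : qpar r ^ i • L r k • v = Qpar c • v) :
    L r k • v = (content (c, i, 0) : LaurentRing r) • v := by
  have h3 := congrArg (fun x => ((laurentVar r none ^ i)⁻¹ : (LaurentRing r)ˣ) • x) h
  have h4 : qpar r ^ i • L r k • v = (laurentVar r none ^ i : (LaurentRing r)ˣ) • L r k • v := by
    rw [Units.smul_def, Units.val_pow_eq_pow_val]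
  simp only [h4, inv_smul_smul] at h3
  rw [h3, Units.smul_def, smul_smul, Qpar, ← Units.val_mul]
  congr 2
  simp [content, mul_comm]

variable [IsScalarTower (LaurentRing r) (Hecke n r) M]

/-- Evaluating q L_(t+1) = T_t L_t T_t on `v` gives a q^2, so one step to the right multiplies the
eigenvalue by q. -/
theorem L_smul_hi {t : Fin (n - 1)} {v : M} {a : LaurentRing r} (hT : T r t • v = qpar r • v)
    (hL : L r (lo t) • v = a • v) : L r (hi t) • v = (a * qpar r) • v := by
  refine q_smul_inj (r := r) ?_
  rw [← smul_assoc, q_smul_L_hi, mul_smul, mul_smul, hT, hecke_smul_comm, hL, hecke_smul_comm,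
    hecke_smul_comm, hT, mul_smul]

theorem evalJM_smul {v : M} {a : Fin n → LaurentRing r} (h : ∀ k, L r k • v = a k • v)
    (p : MvPolynomial (Fin n) (LaurentRing r)) :
    evalJM n r p • v = MvPolynomial.eval a p • v := by
  induction p using MvPolynomial.induction_on with
  | C a => rw [evalJM_C, algebraMap_smul, eval_C]
  | add p p' h h' => rw [map_add, add_smul, h, h', map_add, add_smul]
  | mul_X p k h' =>
    rw [map_mul, mul_smul, evalJM_X, h, hecke_smul_comm, h', map_mul, eval_X, smul_smul, mul_comm]

end Module

theorem content_succ (c : Fin r) (i j : ℕ) :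
    (content (c, i, j + 1) : LaurentRing r) = content (c, i, j) * qpar r := by
  rw [qpar, ← Units.val_mul]
  congr 1
  simp only [content, pow_succ]
  simp only [mul_assoc, mul_comm, mul_left_comm]

theorem L_smul_mElt {lam : Multipartition r n} {f : Fin n → Row r} (hf : IsColoring lam f)
    (k : Fin n) :
    L r k • (Submodule.Quotient.mk (mElt lam) : Hecke n r ⧸ dominatingIdeal lam) =
      (content (tabCell f k) : LaurentRing r) •
        (Submodule.Quotient.mk (mElt lam) : Hecke n r ⧸ dominatingIdeal lam) := by
  have hm := hf.mono
  obtain ⟨c, i, hci⟩ : ∃ c i, f k = row c i := ⟨comp (f k), idx (f k), rfl⟩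
  have key : ∀ j (k : Fin n), f k = row c i → k.1 = cnt f (row c i) + j →
      L r k • (Submodule.Quotient.mk (mElt lam) : Hecke n r ⧸ dominatingIdeal lam) =
      (content (c, i, j) : LaurentRing r) •
        (Submodule.Quotient.mk (mElt lam) : Hecke n r ⧸ dominatingIdeal lam) := by
    intro j
    induction j with
    | zero =>
      intro k hk hk'
      have h := L_smul_first hf hk (by omega)
      rw [LN, dif_pos k.2] at h
      exact L_smul_of_first (n := n) (r := r) (M := Hecke n r ⧸ dominatingIdeal lam)
        (v := Submodule.Quotient.mk (mElt lam)) h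
    | succ j ih =>
      intro k hk hk'
      have hj := k.2
      set k₀ : Fin n := ⟨cnt f (row c i) + j, by omega⟩ with hk₀
      have hlt : k.1 < cnt f (row c (i + 1)) := ((eq_row_iff hm).1 hk).2
      have hfk₀ : f k₀ = row c i := (eq_row_iff hm).2
        ⟨by simp only [hk₀]; omega, by simp only [hk₀]; omega⟩
      have ih := ih k₀ hfk₀ rfl
      set t : Fin (n - 1) := ⟨cnt f (row c i) + j, by omega⟩ with ht
      have hlo : lo t = k₀ := rfl
      have hhi : hi t = k := Fin.ext (by simp only [ht, hi]; omega)
      have hT : T r t • (Submodule.Quotient.mk (mElt lam) : Hecke n r ⧸ dominatingIdeal lam) =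
          qpar r • (Submodule.Quotient.mk (mElt lam) : Hecke n r ⧸ dominatingIdeal lam) := by
        change Submodule.Quotient.mk (T r t * mElt lam) = _
        rw [hf.mElt_eq, T_mul_mCol hm (by rw [hlo, hhi, hk, hfk₀])]
        rfl
      rw [content_succ, ← hhi]
      exact L_smul_hi (n := n) (r := r) (M := Hecke n r ⧸ dominatingIdeal lam)
        (v := Submodule.Quotient.mk (mElt lam)) hT (by rw [hlo]; exact ih)
  rw [key (k.1 - cnt f (f k)) k hci]
  · rw [tabCell, hci]; rfl
  · have := ((eq_row_iff hm).1 hci).1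
    rw [hci]
    omega

/-- Polynomials in the Jucys–Murphy elements act on the generator of the Specht module through
the contents of the initial tableau. -/
theorem evalJM_smul_mElt {lam : Multipartition r n} {f : Fin n → Row r} (hf : IsColoring lam f)
    (p : MvPolynomial (Fin n) (LaurentRing r)) :
    evalJM n r p • (Submodule.Quotient.mk (mElt lam) : Hecke n r ⧸ dominatingIdeal lam) =
      MvPolynomial.eval (fun k => (content (tabCell f k) : LaurentRing r)) p •
        (Submodule.Quotient.mk (mElt lam) : Hecke n r ⧸ dominatingIdeal lam) :=
  evalJM_smul (n := n) (r := r) (M := Hecke n r ⧸ dominatingIdeal lam)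
    (v := Submodule.Quotient.mk (mElt lam)) (L_smul_mElt hf) p


/-! ### A spanning set of `H_{n,r}` -/

/-- The monomial `∏ L_i ^ a_i`. -/
def LMon (r : ℕ) (a : Fin n → ℕ) : Hecke n r := evalJM n r (∏ i, X i ^ a i)

theorem LMon_add (a b : Fin n → ℕ) : LMon r (a + b) = LMon r a * LMon r b := by
  simp only [LMon, ← map_mul, ← Finset.prod_mul_distrib, Pi.add_apply, pow_add]

theorem LMon_zero : LMon r (0 : Fin n → ℕ) = 1 := by simp [LMon]

theorem LMon_single (k : Fin n) (m : ℕ) : LMon r (Pi.single k m) = L r k ^ m := by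
  rw [LMon, Finset.prod_eq_single k, map_pow, evalJM_X, Pi.single_eq_same]
  · intro i _ hi
    rw [Pi.single_eq_of_ne hi, pow_zero]
  · simp

theorem T_commute_LMon {i : Fin (n - 1)} {a : Fin n → ℕ} (h : a (lo i) = 0) (h' : a (hi i) = 0) :
    Commute (T r i) (LMon r a) := by
  rw [LMon]
  refine Finset.prod_induction _ (fun p => Commute (T r i) (evalJM n r p)) ?_ ?_ ?_
  · intro p p' hp hp'
    rw [map_mul]
    exact hp.mul_right hp'
  · rw [map_one]; exact Commute.one_right _
  · intro j _
    by_cases hj : j = lo i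
    · subst hj; rw [h, pow_zero, map_one]; exact Commute.one_right _
    by_cases hj' : j = hi i
    · subst hj'; rw [h', pow_zero, map_one]; exact Commute.one_right _
    rw [map_pow, evalJM_X]
    exact Commute.pow_right (T_mul_L_comm hj hj') _

/-- The span of the products `L^a T_w` with exponents in `S`. -/
def monSpan (r : ℕ) (S : Set (Fin n → ℕ)) : Submodule (LaurentRing r) (Hecke n r) :=
  Submodule.span _ {x | ∃ a ∈ S, ∃ w, x = LMon r a * TPerm r w}

theorem mul_mem_monSpan {S : Set (Fin n → ℕ)} {a : Fin n → ℕ} (h : a ∈ S)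
    (w : Equiv.Perm (Fin n)) : LMon r a * TPerm r w ∈ monSpan r S :=
  Submodule.subset_span ⟨a, h, w, rfl⟩

theorem LMon_mem {S : Set (Fin n → ℕ)} {a : Fin n → ℕ} (h : a ∈ S) : LMon r a ∈ monSpan r S := by
  simpa [TPerm_one] using mul_mem_monSpan (r := r) h 1

theorem monSpan_induction {S : Set (Fin n → ℕ)} {N : Submodule (LaurentRing r) (Hecke n r)}
    (φ : Hecke n r →ₗ[LaurentRing r] Hecke n r)
    (h : ∀ a ∈ S, ∀ w, φ (LMon r a * TPerm r w) ∈ N) {x : Hecke n r} (hx : x ∈ monSpan r S) :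
    φ x ∈ N := by
  have : monSpan r S ≤ N.comap φ := by
    refine Submodule.span_le.2 ?_
    rintro _ ⟨a, ha, w, rfl⟩
    exact h a ha w
  exact this hx

theorem LMon_mul_mem {S S' : Set (Fin n → ℕ)} {b : Fin n → ℕ} (h : ∀ a ∈ S, b + a ∈ S')
    {x : Hecke n r} (hx : x ∈ monSpan r S) : LMon r b * x ∈ monSpan r S' := by
  refine monSpan_induction (LinearMap.mulLeft _ (LMon r b)) ?_ hx
  intro a ha w
  rw [LinearMap.mulLeft_apply, ← mul_assoc, ← LMon_add]
  exact mul_mem_monSpan (h a ha) w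

theorem T_mul_mem_monSpan_zero (i : Fin (n - 1)) {x : Hecke n r} (hx : x ∈ monSpan r {0}) :
    T r i * x ∈ monSpan r {0} := by
  refine monSpan_induction (LinearMap.mulLeft _ (T r i)) ?_ hx
  rintro a rfl w
  have hm : ∀ v, TPerm r v ∈ monSpan (n := n) r {0} := fun v => by
    simpa [LMon_zero] using mul_mem_monSpan (r := r) (Set.mem_singleton (0 : Fin n → ℕ)) v
  rw [LinearMap.mulLeft_apply, LMon_zero, one_mul]
  rcases lt_or_gt_of_ne (w⁻¹.injective.ne (lo_ne_hi i)) with h | h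
  · rw [T_mul_TPerm_of_lt h]
    exact hm _
  · rw [T_mul_TPerm_of_gt h]
    exact add_mem (Submodule.smul_mem _ _ (hm _)) (Submodule.smul_mem _ _ (hm _))

theorem TPerm_mul_TPerm_mem (v w : Equiv.Perm (Fin n)) :
    TPerm r v * TPerm r w ∈ monSpan r {0} := by
  rw [TPerm]
  induction reducedWord v with
  | nil => simpa [LMon_zero] using mul_mem_monSpan (r := r) (Set.mem_singleton (0 : Fin n → ℕ)) w
  | cons i l ih =>
    rw [List.map_cons, List.prod_cons, mul_assoc]
    exact T_mul_mem_monSpan_zero i ih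

theorem mul_TPerm_mem {S : Set (Fin n → ℕ)} (w : Equiv.Perm (Fin n)) {x : Hecke n r}
    (hx : x ∈ monSpan r S) : x * TPerm r w ∈ monSpan r S := by
  refine monSpan_induction (LinearMap.mulRight _ (TPerm r w)) ?_ hx
  intro a ha v
  rw [LinearMap.mulRight_apply, mul_assoc]
  refine LMon_mul_mem ?_ (TPerm_mul_TPerm_mem v w)
  rintro _ rfl
  simpa using ha

theorem mul_T_mem {S : Set (Fin n → ℕ)} (i : Fin (n - 1)) {x : Hecke n r}
    (hx : x ∈ monSpan r S) : x * T r i ∈ monSpan r S := by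
  rw [← TPerm_simpleSwap]
  exact mul_TPerm_mem _ hx

/-- An explicit Bernstein relation for powers: both exponents in the correction terms are visible,
which is what the degree bounds of the spanning argument need. -/
theorem T_mul_L_lo_pow (i : Fin (n - 1)) (b : ℕ) :
    T r i * L r (lo i) ^ b +
      qm r • ∑ j ∈ Finset.range b, L r (hi i) ^ (j + 1) * L r (lo i) ^ (b - 1 - j) =
      L r (hi i) ^ b * T r i := by
  have hc : Commute (L r (hi i)) (L r (lo i)) := L_mul_comm _ _
  induction b with
  | zero => simp
  | succ b ih =>
    have h1 : ∑ j ∈ Finset.range b, L r (hi i) ^ (j + 1) * L r (lo i) ^ (b - j) =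
        (∑ j ∈ Finset.range b, L r (hi i) ^ (j + 1) * L r (lo i) ^ (b - 1 - j)) * L r (lo i) := by
      rw [Finset.sum_mul]
      refine Finset.sum_congr rfl fun j hj => ?_
      rw [mul_assoc, ← pow_succ]
      congr 2
      have := Finset.mem_range.1 hj
      omega
    rw [Finset.sum_range_succ, Nat.add_sub_cancel, Nat.sub_self, pow_zero, mul_one, h1, pow_succ,
      ← mul_assoc, smul_add, ← add_assoc, ← smul_mul_assoc, ← add_mul, ih, mul_assoc,
      pow_succ, mul_assoc, ← T_mul_L_lo, mul_add, mul_smul_comm]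

/-- The exponents supported below `k`, with the `k`-th one less than `r`. -/
def lowExp (r : ℕ) (k : Fin n) : Set (Fin n → ℕ) := {b | b k < r ∧ ∀ i, k < i → b i = 0}

/-- The part of the monomial away from `lo i` and `hi i` commutes with T_i. The remaining power of L
at `lo i` yields only exponents at `hi i` not exceeding the original one. -/
theorem T_mul_mem_lowExp (i : Fin (n - 1)) {x : Hecke n r} (hx : x ∈ monSpan r (lowExp r (lo i))) :
    T r i * x ∈ monSpan r (lowExp r (hi i)) := by
  refine monSpan_induction (LinearMap.mulLeft _ (T r i)) ?_ hx
  rintro a ⟨ha, ha'⟩ w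
  have hlh := lo_lt_hi i
  have hdec : a = Function.update a (lo i) 0 + Pi.single (lo i) (a (lo i)) := by
    ext j
    by_cases hj : j = lo i
    · subst hj; simp
    · simp [hj]
  set a' := Function.update a (lo i) 0 with ha'_def
  have h0 : a' (lo i) = 0 := by simp [a']
  have h1 : a' (hi i) = 0 := by simp [a', hlh.ne', ha' _ hlh]
  have h2 : ∀ j, hi i < j → a' j = 0 := fun j hj => by
    simp [a', (hlh.trans hj).ne', ha' _ (hlh.trans hj)]
  rw [LinearMap.mulLeft_apply, ← mul_assoc]
  refine mul_TPerm_mem w ?_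
  rw [hdec, LMon_add, LMon_single, ← mul_assoc, (T_commute_LMon h0 h1).eq, mul_assoc,
    eq_sub_of_add_eq (T_mul_L_lo_pow i (a (lo i))), mul_sub]
  refine sub_mem ?_ ?_
  · rw [← mul_assoc, ← LMon_single, ← LMon_add]
    refine mul_T_mem i (LMon_mem ⟨by simpa [h1] using ha, fun j hj => ?_⟩)
    simp [h2 j hj, hj.ne']
  · rw [mul_smul_comm, Finset.mul_sum]
    refine Submodule.smul_mem _ _ (Submodule.sum_mem _ fun j hj => ?_)
    have := Finset.mem_range.1 hj
    rw [← LMon_single, ← LMon_single, ← LMon_add, ← LMon_add]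
    refine LMon_mem ⟨?_, fun l hl => ?_⟩
    · simp [h1, hlh.ne']; omega
    · simp [h2 l hl, hl.ne', (hlh.trans hl).ne']

/-- Induction on `k`, from the cyclotomic relation at the first index. In the step, T_i L_i^r
contains L_(i+1)^r twice: as L_(i+1)^r T_i and, with coefficient q-1, as the top correction term.
This bounds L_(i+1)^r (T_i - (q-1)), and the second factor is invertible. -/
theorem L_pow_mem (k : Fin n) : L r k ^ r ∈ monSpan r (lowExp r k) := by
  obtain ⟨m, hm⟩ : ∃ m, k.1 = m := ⟨_, rfl⟩
  induction m generalizing k with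
  | zero =>
    have h := cyclotomic_relation (r := r) k hm
    set p : Polynomial (LaurentRing r) := ∏ c : Fin r, (Polynomial.X - Polynomial.C (Qpar c))
      with hp
    have hmon : p.Monic := Polynomial.monic_prod_of_monic _ _ fun c _ => Polynomial.monic_X_sub_C _
    have hdeg : p.natDegree = r := by
      rw [hp, Polynomial.natDegree_prod_of_monic _ _ fun c _ => Polynomial.monic_X_sub_C _]
      simp
    rw [hmon.as_sum, hdeg, map_add, map_pow, Polynomial.aeval_X, map_sum] at h
    rw [eq_neg_of_add_eq_zero_left h]
    refine neg_mem (Submodule.sum_mem _ fun j hj => ?_)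
    rw [map_mul, Polynomial.aeval_C, map_pow, Polynomial.aeval_X, ← Algebra.smul_def,
      ← LMon_single]
    refine Submodule.smul_mem _ _ (LMon_mem ⟨by simpa using hj, fun i hi => ?_⟩)
    simp [hi.ne']
  | succ m ih =>
    have hk := k.2
    obtain ⟨i, rfl⟩ : ∃ i : Fin (n - 1), k = hi i := ⟨⟨m, by omega⟩, Fin.ext hm⟩
    have hlh := lo_lt_hi i
    have h1 := T_mul_mem_lowExp i (ih (lo i) (by simpa [hi, lo] using hm))
    have h2 := T_mul_L_lo_pow (r := r) i r
    have hr : 0 < r ∨ r = 0 := by omega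
    rcases hr with hr | hr
    · obtain ⟨r', hr'⟩ : ∃ r', r = r' + 1 := ⟨r - 1, by omega⟩
      have h3 : L r (hi i) ^ r * T r i - qm r • L r (hi i) ^ r ∈ monSpan r (lowExp r (hi i)) := by
        have : L r (hi i) ^ r * T r i - qm r • L r (hi i) ^ r = T r i * L r (lo i) ^ r +
            qm r • ∑ j ∈ Finset.range r', L r (hi i) ^ (j + 1) * L r (lo i) ^ (r - 1 - j) := by
          have hsum : ∑ j ∈ Finset.range r, L r (hi i) ^ (j + 1) * L r (lo i) ^ (r - 1 - j) =
              ∑ j ∈ Finset.range r', L r (hi i) ^ (j + 1) * L r (lo i) ^ (r - 1 - j) +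
                L r (hi i) ^ r := by
            rw [show Finset.range r = Finset.range (r' + 1) by rw [hr'], Finset.sum_range_succ,
              show r - 1 - r' = 0 by omega, pow_zero, mul_one,
              show L r (hi i) ^ (r' + 1) = L r (hi i) ^ r from congrArg _ hr'.symm]
          rw [← h2, hsum, smul_add]
          abel
        rw [this]
        refine add_mem h1 (Submodule.smul_mem _ _ (Submodule.sum_mem _ fun j hj => ?_))
        have := Finset.mem_range.1 hj
        rw [← LMon_single, ← LMon_single, ← LMon_add]
        refine LMon_mem ⟨?_, fun l hl => ?_⟩
        · simp [hlh.ne']; omega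
        · simp [hl.ne', (hlh.trans hl).ne']
      -- The quadratic relation reads (T_i - (q-1)) T_i = q, so right multiplication by T_i leaves q
      -- L_(i+1)^r.
      have h4 := mul_T_mem i h3
      rw [sub_mul, mul_assoc, T_mul_self, smul_mul_assoc, mul_add, mul_smul_comm, add_sub_cancel_left,
        mul_smul_comm, mul_one] at h4
      have h5 := Submodule.smul_mem _ (((laurentVar r none)⁻¹ : (LaurentRing r)ˣ) : LaurentRing r) h4
      rwa [smul_smul, qpar, Units.inv_mul, one_smul] at h5
    -- For r = 0 the cyclotomic relation is an empty product equal to zero, and the algebra is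
    -- trivial.
    · have h6 : (1 : Hecke n r) = 0 := by
        have := cyclotomic_relation (r := r) (n := n) ⟨0, by omega⟩ rfl
        subst hr
        simpa using this
      rw [← mul_one (L r (hi i) ^ r), h6, mul_zero]
      exact zero_mem _

theorem monSpan_univ : monSpan r (Set.univ : Set (Fin n → ℕ)) = ⊤ := by
  have hJ : ∀ p w, evalJM n r p * TPerm r w ∈ monSpan r (Set.univ : Set (Fin n → ℕ)) := by
    intro p w
    refine mul_TPerm_mem w ?_
    induction p using MvPolynomial.induction_on with
    | C a =>
      rw [evalJM_C, Algebra.algebraMap_eq_smul_one, ← LMon_zero]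
      exact Submodule.smul_mem _ _ (LMon_mem trivial)
    | add p p' h h' => rw [map_add]; exact add_mem h h'
    | mul_X p k h =>
      rw [mul_comm, map_mul, evalJM_X, ← pow_one (L r k), ← LMon_single]
      exact LMon_mul_mem (fun _ _ => Set.mem_univ _) h
  have hT : ∀ (i : Fin (n - 1)) (x : Hecke n r), x ∈ monSpan r (Set.univ : Set (Fin n → ℕ)) →
      T r i * x ∈ monSpan r (Set.univ : Set (Fin n → ℕ)) := by
    intro i x hx
    refine monSpan_induction (LinearMap.mulLeft _ (T r i)) ?_ hx
    intro a _ w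
    obtain ⟨d, -, hd⟩ := T_mul_evalJM (r := r) i (∏ j, X j ^ a j)
    rw [LinearMap.mulLeft_apply, ← mul_assoc, LMon, hd]
    refine mul_TPerm_mem w (add_mem (mul_T_mem i ?_) (Submodule.smul_mem _ _ ?_))
    · simpa [TPerm_one] using hJ (rename (simpleSwap i) (∏ j, X j ^ a j)) 1
    · simpa only [TPerm_one, mul_one] using hJ (X (hi i) * d) 1
  rw [eq_top_iff]
  rintro x -
  have hx : x ∈ Algebra.adjoin (LaurentRing r)
      (Set.range (L r : Fin n → Hecke n r) ∪ Set.range (T r)) := by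
    rw [adjoin_generators]; trivial
  have key : ∀ y ∈ monSpan r (Set.univ : Set (Fin n → ℕ)),
      x * y ∈ monSpan r (Set.univ : Set (Fin n → ℕ)) := by
    induction hx using Algebra.adjoin_induction with
    | mem x hx =>
      intro y hy
      rcases hx with ⟨k, rfl⟩ | ⟨i, rfl⟩
      · rw [← pow_one (L r k), ← LMon_single]
        exact LMon_mul_mem (fun _ _ => Set.mem_univ _) hy
      · exact hT i y hy
    | algebraMap a =>
      intro y hy
      rw [← Algebra.smul_def]
      exact Submodule.smul_mem _ _ hy
    | add x x' _ _ h h' => intro y hy; rw [add_mul]; exact add_mem (h y hy) (h' y hy)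
    | mul x x' _ _ h h' => intro y hy; rw [mul_assoc]; exact h _ (h' y hy)
  simpa using key 1 (by rw [← LMon_zero]; exact LMon_mem trivial)

/-- Rewriting a factor L_k^r lowers the exponent at `k` and leaves the higher ones alone; exponents
below `k` may grow. Hence the reduction in `monSpan_reduced` proceeds from the last index down. -/
theorem monSpan_le_monSpan (k : Fin n) :
    monSpan r {a : Fin n → ℕ | ∀ i, k < i → a i < r} ≤
      monSpan r {a : Fin n → ℕ | ∀ i, k ≤ i → a i < r} := by
  have key : ∀ N, ∀ a : Fin n → ℕ, a k = N → (∀ i, k < i → a i < r) →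
      LMon r a ∈ monSpan r {a : Fin n → ℕ | ∀ i, k ≤ i → a i < r} := by
    intro N
    induction N using Nat.strong_induction_on with
    | _ N ihN =>
      intro a haN ha
      by_cases hlt : a k < r
      · refine LMon_mem (Set.mem_ofPred.2 fun i hi => ?_)
        rcases hi.lt_or_eq with h | rfl
        · exact ha i h
        · exact hlt
      · obtain ⟨c, hc, hck, hci⟩ : ∃ c : Fin n → ℕ, a = c + Pi.single k r ∧ c k + r = N ∧
            ∀ i, k < i → c i < r := by
          refine ⟨a - Pi.single k r, ?_, ?_, fun i hi => ?_⟩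
          · ext j
            by_cases hj : j = k
            · subst hj; simp; omega
            · simp [hj]
          · simp; omega
          · simpa [hi.ne'] using ha i hi
        rw [hc, LMon_add, LMon_single]
        refine monSpan_induction (LinearMap.mulLeft _ (LMon r c)) ?_ (L_pow_mem k)
        rintro b ⟨hb, hb'⟩ w
        rw [LinearMap.mulLeft_apply, ← mul_assoc, ← LMon_add]
        refine mul_TPerm_mem w (ihN ((c + b) k) ?_ _ rfl fun i hi => ?_)
        · rw [Pi.add_apply]; omega
        · rw [Pi.add_apply, hb' i hi]; exact hci i hi
  refine Submodule.span_le.2 ?_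
  rintro _ ⟨a, ha, w, rfl⟩
  exact mul_TPerm_mem w (key _ a rfl ha)

theorem monSpan_reduced : monSpan r {a : Fin n → ℕ | ∀ i, a i < r} = ⊤ := by
  have hS : ∀ m ≤ n, monSpan r {a : Fin n → ℕ | ∀ i : Fin n, n - m ≤ i.1 → a i < r} = ⊤ := by
    intro m
    induction m with
    | zero =>
      intro _
      rw [← monSpan_univ]
      congr 1
      refine Set.eq_univ_of_forall fun a i hi => ?_
      have := i.2
      omega
    | succ m ih =>
      intro hm
      rw [eq_top_iff, ← ih (by omega)]
      have h := monSpan_le_monSpan (r := r) (⟨n - (m + 1), by omega⟩ : Fin n)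
      simp only [Fin.lt_def, Fin.le_def] at h
      rwa [show n - m = n - (m + 1) + 1 by omega]
  simpa using hS n le_rfl

/-- The elements `L^a T_w` with `a_i < r`, which span `H_{n,r}`. -/
def stdElt (x : (Fin n → Fin r) × Equiv.Perm (Fin n)) : Hecke n r :=
  LMon r (fun i => (x.1 i : ℕ)) * TPerm r x.2

theorem span_stdElt : Submodule.span (LaurentRing r) (Set.range (stdElt (n := n) (r := r))) = ⊤ := by
  rw [← monSpan_reduced]
  refine le_antisymm (Submodule.span_le.2 ?_) (Submodule.span_le.2 ?_)
  · rintro _ ⟨x, rfl⟩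
    exact mul_mem_monSpan (Set.mem_ofPred.2 fun i => (x.1 i).2) _
  · rintro _ ⟨a, ha, w, rfl⟩
    exact Submodule.subset_span ⟨(fun i => ⟨a i, ha i⟩, w), rfl⟩


/-! ### Standard tableaux -/

/-- The cell `y` lies weakly north-west of `x`, in the same component. -/
def Below (y x : Cell r) : Prop := y.1 = x.1 ∧ y.2.1 ≤ x.2.1 ∧ y.2.2 ≤ x.2.2

/-- Standard tableaux: `t k` is the cell with entry `k`, and the entries up to `k` fill a
multidiagram. -/
structure IsStd (t : Fin n → Cell r) : Prop where
  inj : Function.Injective t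
  lower : ∀ k x, Below x (t k) → ∃ j ≤ k, t j = x

theorem IsStd.le_of_below {t : Fin n → Cell r} (ht : IsStd t) {k l : Fin n}
    (h : Below (t k) (t l)) : k ≤ l := by
  obtain ⟨j, hj, hjk⟩ := ht.lower l _ h
  rwa [← ht.inj hjk]

/-- Cells of the same component on the same diagonal. -/
def SameDiag (x y : Cell r) : Prop := x.1 = y.1 ∧ x.2.2 + y.2.1 = y.2.2 + x.2.1

theorem SameDiag.below_or {x y : Cell r} (h : SameDiag x y) : Below x y ∨ Below y x := by
  obtain ⟨h1, h2⟩ := h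
  rcases le_total x.2.1 y.2.1 with h3 | h3
  · exact Or.inl ⟨h1, h3, by omega⟩
  · exact Or.inr ⟨h1.symm, h3, by omega⟩

/-- Between two cells of one diagonal the tableau must fill the right neighbor and the lower
neighbor of the first. So entries at distance at most two have distinct contents, and the
denominators in the quadratic and braid relations are nonzero. -/
theorem IsStd.add_three_le {t : Fin n → Cell r} (ht : IsStd t) {k l : Fin n} (hkl : k < l)
    (h : SameDiag (t k) (t l)) : k.1 + 3 ≤ l.1 := by
  have hb : Below (t k) (t l) := h.below_or.resolve_right fun h' =>
    absurd (ht.le_of_below h') (not_le.2 hkl)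
  have hne : t k ≠ t l := ht.inj.ne hkl.ne
  obtain ⟨h1, h2⟩ := h
  have h3 : (t k).2.1 < (t l).2.1 := by
    refine lt_of_le_of_ne hb.2.1 fun h3 => hne (Prod.ext h1 (Prod.ext h3 (by omega)))
  have hx1 : Below ((t k).1, (t k).2.1, (t k).2.2 + 1) (t l) := ⟨h1, hb.2.1, by simp; omega⟩
  have hx2 : Below ((t k).1, (t k).2.1 + 1, (t k).2.2) (t l) := ⟨h1, h3, hb.2.2⟩
  obtain ⟨p, hp, hpx⟩ := ht.lower l _ hx1
  obtain ⟨p', hp', hpx'⟩ := ht.lower l _ hx2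
  have hkp : k ≤ p := ht.le_of_below (by rw [hpx]; exact ⟨rfl, le_rfl, by simp⟩)
  have hkp' : k ≤ p' := ht.le_of_below (by rw [hpx']; exact ⟨rfl, by simp, le_rfl⟩)
  have e1 : k ≠ p := fun e => by
    rw [← e] at hpx; have := congrArg (fun x => x.2.2) hpx; simp at this
  have e2 : k ≠ p' := fun e => by
    rw [← e] at hpx'; have := congrArg (fun x => x.2.1) hpx'; simp at this
  have e3 : p ≠ l := fun e => by
    rw [e] at hpx; have := congrArg (fun x => x.2.1) hpx; simp at this; omega
  have e4 : p' ≠ l := fun e => by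
    rw [e] at hpx'; have := congrArg (fun x => x.2.2) hpx'; simp at this; omega
  have e5 : p ≠ p' := fun e => by
    rw [e, hpx'] at hpx; have := congrArg (fun x => x.2.1) hpx; simp at this
  simp only [Fin.le_def, ne_eq, Fin.ext_iff] at *
  omega

/-- A standard tableau is determined by the diagonals of its entries. -/
theorem IsStd.eq_of_sameDiag {t t' : Fin n → Cell r} (ht : IsStd t) (ht' : IsStd t')
    (h : ∀ k, SameDiag (t k) (t' k)) : t = t' := by
  -- At the first disagreement the two cells are comparable. The north-western one is already
  -- occupied in the other tableau, hence by an earlier entry, on which both agree.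
  have key : ∀ {s s' : Fin n → Cell r}, IsStd s → IsStd s' → ∀ k, (∀ j < k, s j = s' j) →
      Below (s k) (s' k) → s k = s' k := by
    intro s s' hs hs' k hk hb
    obtain ⟨j, hj, hjk⟩ := hs'.lower k _ hb
    rcases hj.lt_or_eq with hlt | rfl
    · exact absurd (hs.inj ((hk j hlt).trans hjk)) hlt.ne
    · exact hjk.symm
  funext k
  induction k using WellFoundedLT.induction with
  | _ k ih =>
    rcases (h k).below_or with hb | hb
    · exact key ht ht' k ih hb
    · exact (key ht' ht k (fun j hj => (ih j hj).symm) hb).symm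

/-- Swapping consecutive entries of a standard tableau gives a standard tableau, unless the two
entries lie in adjacent cells. -/
theorem IsStd.swap {t : Fin n → Cell r} (ht : IsStd t) {i : Fin (n - 1)}
    (h : ¬ Below (t (lo i)) (t (hi i))) : IsStd (t ∘ simpleSwap i) := by
  refine ⟨ht.inj.comp (simpleSwap i).injective, fun k x hx => ?_⟩
  have hlh : (lo i).1 + 1 = (hi i).1 := rfl
  by_cases hk : k = lo i
  · subst hk
    rw [Function.comp_apply, simpleSwap_lo] at hx
    obtain ⟨j, hj, rfl⟩ := ht.lower _ _ hx
    have hj1 : j ≠ lo i := fun e => h (e ▸ hx)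
    by_cases hj2 : j = hi i
    · exact ⟨lo i, le_rfl, by rw [Function.comp_apply, simpleSwap_lo, hj2]⟩
    · refine ⟨j, ?_, by rw [Function.comp_apply, simpleSwap_of_ne hj1 hj2]⟩
      simp only [Fin.le_def, ne_eq, Fin.ext_iff] at *
      omega
  by_cases hk' : k = hi i
  · subst hk'
    rw [Function.comp_apply, simpleSwap_hi] at hx
    obtain ⟨j, hj, rfl⟩ := ht.lower _ _ hx
    by_cases hj1 : j = lo i
    · exact ⟨hi i, le_rfl, by rw [Function.comp_apply, simpleSwap_hi, hj1]⟩
    · have hj2 : j ≠ hi i := fun e => by rw [e] at hj; exact absurd hj (not_le.2 (lo_lt_hi i))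
      exact ⟨j, hj.trans (lo_lt_hi i).le, by rw [Function.comp_apply, simpleSwap_of_ne hj1 hj2]⟩
  · rw [Function.comp_apply, simpleSwap_of_ne hk hk'] at hx
    obtain ⟨j, hj, rfl⟩ := ht.lower _ _ hx
    refine ⟨simpleSwap i j, ?_, by
      rw [Function.comp_apply, ← Equiv.Perm.mul_apply, simpleSwap_mul_self, Equiv.Perm.one_apply]⟩
    by_cases hj1 : j = lo i
    · subst hj1
      rw [simpleSwap_lo]
      simp only [Fin.le_def, Fin.ext_iff] at *
      omega
    by_cases hj2 : j = hi i
    · subst hj2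
      rw [simpleSwap_hi]
      exact (lo_lt_hi i).le.trans hj
    rwa [simpleSwap_of_ne hj1 hj2]

/-- A cell weakly between the two carries an entry between `lo i` and `hi i`, hence is one of the
two. -/
theorem IsStd.adjacent {t : Fin n → Cell r} (ht : IsStd t) {i : Fin (n - 1)}
    (h : Below (t (lo i)) (t (hi i))) :
    t (hi i) = ((t (lo i)).1, (t (lo i)).2.1 + 1, (t (lo i)).2.2) ∨
      t (hi i) = ((t (lo i)).1, (t (lo i)).2.1, (t (lo i)).2.2 + 1) := by
  have hlh : (lo i).1 + 1 = (hi i).1 := rfl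
  have hne : t (lo i) ≠ t (hi i) := ht.inj.ne (lo_ne_hi i)
  have key : ∀ z, Below (t (lo i)) z → Below z (t (hi i)) → z = t (lo i) ∨ z = t (hi i) := by
    intro z h1 h2
    obtain ⟨p, hp, rfl⟩ := ht.lower _ _ h2
    have hp' := ht.le_of_below h1
    have : p = lo i ∨ p = hi i := by
      simp only [Fin.le_def, Fin.ext_iff] at *
      omega
    rcases this with rfl | rfl
    · exact Or.inl rfl
    · exact Or.inr rfl
  set x := t (lo i)
  set y := t (hi i)
  obtain ⟨h1, h2, h3⟩ := h
  rcases h2.lt_or_eq with h2 | h2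
  · left
    rcases key (x.1, x.2.1 + 1, x.2.2) ⟨rfl, by simp, le_rfl⟩ ⟨h1, h2, h3⟩ with e | e
    · have := congrArg (fun x => x.2.1) e; simp at this
    · exact e.symm
  · right
    have h4 : x.2.2 < y.2.2 := lt_of_le_of_ne h3 fun e => hne (Prod.ext h1 (Prod.ext h2 e))
    rcases key (x.1, x.2.1, x.2.2 + 1) ⟨rfl, le_rfl, by simp⟩ ⟨h1, h2.le, h4⟩ with e | e
    · have := congrArg (fun x => x.2.2) e; simp at this
    · exact e.symm

/-- The initial tableau of a multipartition is standard. -/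
theorem IsColoring.isStd {lam : Multipartition r n} {f : Fin n → Row r} (hf : IsColoring lam f) :
    IsStd (tabCell f) := by
  have hm := hf.mono
  have heq : ∀ k, f k = row (comp (f k)) (idx (f k)) := fun k => rfl
  have hbd : ∀ k, cnt f (f k) ≤ k.1 ∧ k.1 < cnt f (row (comp (f k)) (idx (f k) + 1)) := fun k =>
    (eq_row_iff hm).1 (heq k)
  refine ⟨fun k l hkl => ?_, fun k x hx => ?_⟩
  · have h1 : f k = f l := by
      have e1 := congrArg (fun x => x.1) hkl
      have e2 := congrArg (fun x => x.2.1) hkl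
      simp only [tabCell] at e1 e2
      rw [heq k, heq l, e1, e2]
    have e3 := congrArg (fun x => x.2.2) hkl
    simp only [tabCell] at e3
    have h2 := (hbd k).1
    have h3 := (hbd l).1
    rw [h1] at e3 h2
    exact Fin.ext (by omega)
  · obtain ⟨c, i, j⟩ := x
    obtain ⟨h1, h2, h3⟩ := hx
    simp only [tabCell] at h1 h2 h3
    have hlen := cnt_row_succ' f c i
    have hlen' := cnt_row_succ' f c (idx (f k))
    have hant : len f (row c (idx (f k))) ≤ len f (row c i) := by
      rw [hf.len_eq, hf.len_eq]
      exact (lam.1 c).rowLen_anti _ _ h2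
    have hk := hbd k
    rw [← h1] at hk
    have hck : cnt f (f k) = cnt f (row c (idx (f k))) := by rw [h1]; rfl
    have hmono : ∀ p p', p ≤ p' → cnt f p ≤ cnt f p' := fun p p' hp =>
      Finset.card_le_card fun l hl => by
        simp only [Finset.mem_filter, Finset.mem_univ, true_and] at hl ⊢
        exact hl.trans_le hp
    have hle : cnt f (row c i) + j ≤ k.1 ∧ j < len f (row c i) := by
      refine ⟨?_, by omega⟩
      rcases h2.lt_or_eq with h | h
      · have := hmono (row c (i + 1)) (row c (idx (f k)))
          (le_row.2 (Or.inr ⟨rfl, h⟩))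
        omega
      · rw [h]; omega
    refine ⟨⟨cnt f (row c i) + j, hle.1.trans_lt k.2⟩, hle.1, ?_⟩
    have hrow : f ⟨cnt f (row c i) + j, hle.1.trans_lt k.2⟩ = row c i :=
      (eq_row_iff hm).2 ⟨by simp, by simp only []; omega⟩
    rw [tabCell, hrow]
    exact Prod.ext rfl (Prod.ext rfl (by simp))

theorem IsColoring.image_tabCell {lam : Multipartition r n} {f : Fin n → Row r}
    (hf : IsColoring lam f) : Finset.univ.image (tabCell f) = cellSet lam := by
  have hm := hf.mono
  refine Finset.eq_of_subset_of_card_le ?_ ?_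
  · intro x hx
    obtain ⟨k, -, rfl⟩ := Finset.mem_image.1 hx
    rw [mem_cellSet, YoungDiagram.mem_cells]
    change (idx (f k), k.1 - cnt f (f k)) ∈ lam.1 (comp (f k))
    rw [YoungDiagram.mem_iff_lt_rowLen, ← hf.len_eq]
    have h1 := (eq_row_iff hm).1 (show f k = row (comp (f k)) (idx (f k)) from rfl)
    rw [cnt_row_succ'] at h1
    change k.1 - cnt f (row (comp (f k)) (idx (f k))) < _
    omega
  · rw [Finset.card_image_of_injective _ hf.isStd.inj, card_cellSet]
    simp

theorem cellSet_injective : Function.Injective (cellSet : Multipartition r n → Finset (Cell r)) := by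
  intro lam mu h
  refine Subtype.ext (funext fun c => YoungDiagram.ext (Finset.ext fun x => ?_))
  have := Finset.ext_iff.1 h (c, x)
  rwa [mem_cellSet, mem_cellSet] at this


/-! ### Counting standard tableaux -/

/-- Multidiagrams: finite sets of cells closed under passing to cells below. -/
def IsLower (D : Finset (Cell r)) : Prop := ∀ x ∈ D, ∀ y, Below y x → y ∈ D

open Classical in
/-- The removable cells. -/
def remv (D : Finset (Cell r)) : Finset (Cell r) := D.filter fun x => IsLower (D.erase x)

theorem mem_remv' {D : Finset (Cell r)} {x : Cell r} :
    x ∈ remv D ↔ x ∈ D ∧ IsLower (D.erase x) := by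
  classical
  rw [remv, Finset.mem_filter]

theorem exists_notMem_row (D : Finset (Cell r)) (c : Fin r) (i : ℕ) : ∃ j, (c, i, j) ∉ D := by
  obtain ⟨j, hj⟩ := Infinite.exists_notMem_finset (D.image fun x => x.2.2)
  exact ⟨j, fun h => hj (Finset.mem_image.2 ⟨_, h, rfl⟩)⟩

open Classical in
/-- The length of a row of a multidiagram. -/
def rowl (D : Finset (Cell r)) (c : Fin r) (i : ℕ) : ℕ := Nat.find (exists_notMem_row D c i)

theorem IsLower.mem_iff {D : Finset (Cell r)} (hD : IsLower D) {c : Fin r} {i j : ℕ} :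
    (c, i, j) ∈ D ↔ j < rowl D c i := by
  classical
  rw [rowl, Nat.lt_find_iff]
  exact ⟨fun h m hm => not_not.2 (hD _ h _ ⟨rfl, le_rfl, hm⟩), fun h => not_not.1 (h j le_rfl)⟩

theorem IsLower.rowl_anti {D : Finset (Cell r)} (hD : IsLower D) (c : Fin r) {i i' : ℕ}
    (h : i ≤ i') : rowl D c i' ≤ rowl D c i := by
  by_contra! hlt
  exact lt_irrefl _ (hD.mem_iff.1 (hD _ (hD.mem_iff.2 hlt) (c, i, rowl D c i) ⟨rfl, h, le_rfl⟩))

theorem IsLower.isLower_insert {D : Finset (Cell r)} (hD : IsLower D) {y : Cell r} :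
    IsLower (insert y D) ↔ ∀ z, Below z y → z = y ∨ z ∈ D := by
  refine ⟨fun h z hz => Finset.mem_insert.1 (h y (Finset.mem_insert_self _ _) z hz), ?_⟩
  intro h x hx z hz
  rw [Finset.mem_insert] at hx ⊢
  rcases hx with rfl | hx
  · exact h z hz
  · exact Or.inr (hD x hx z hz)

theorem IsLower.mem_remv {D : Finset (Cell r)} (hD : IsLower D) {c : Fin r} {i j : ℕ} :
    (c, i, j) ∈ remv D ↔ j + 1 = rowl D c i ∧ rowl D c (i + 1) ≤ j := by
  rw [mem_remv', hD.mem_iff]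
  constructor
  · rintro ⟨h1, h2⟩
    have key : ∀ z, z ∈ D → z ≠ (c, i, j) → ¬ Below (c, i, j) z := fun z hz hne hb =>
      absurd (h2 z (Finset.mem_erase.2 ⟨hne, hz⟩) _ hb) (Finset.notMem_erase _ _)
    constructor
    · by_contra hne
      exact key (c, i, j + 1) (hD.mem_iff.2 (by omega)) (by simp) ⟨rfl, le_rfl, by simp⟩
    · by_contra! hlt
      exact key (c, i + 1, j) (hD.mem_iff.2 hlt) (by simp) ⟨rfl, by simp, le_rfl⟩
  · rintro ⟨h1, h2⟩
    refine ⟨by omega, fun x hx y hy => ?_⟩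
    obtain ⟨hne, hx⟩ := Finset.mem_erase.1 hx
    refine Finset.mem_erase.2 ⟨?_, hD x hx y hy⟩
    rintro rfl
    obtain ⟨c', i', j'⟩ := x
    obtain ⟨h5, h3, h4⟩ := hy
    simp only at h3 h4 h5
    subst h5
    rw [hD.mem_iff] at hx
    rcases h3.lt_or_eq with h3 | rfl
    · have : rowl D c i' ≤ rowl D c (i + 1) := hD.rowl_anti c h3
      omega
    · exact hne (by simp only [Prod.mk.injEq, true_and]; omega)

/-- The addable cells. -/
def addb (D : Finset (Cell r)) : Finset (Cell r) :=
  (Finset.univ.image fun c => (c, 0, rowl D c 0)) ∪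
    (remv D).image fun x => (x.1, x.2.1 + 1, rowl D x.1 (x.2.1 + 1))

theorem IsLower.mem_addb {D : Finset (Cell r)} (hD : IsLower D) {y : Cell r} :
    y ∈ addb D ↔ y ∉ D ∧ IsLower (insert y D) := by
  obtain ⟨c, i, j⟩ := y
  rw [hD.isLower_insert, hD.mem_iff, not_lt, addb, Finset.mem_union]
  constructor
  · rintro (h | h)
    · obtain ⟨c', -, h⟩ := Finset.mem_image.1 h
      obtain ⟨rfl, rfl, rfl⟩ : c' = c ∧ 0 = i ∧ rowl D c' 0 = j := by simpa using h
      refine ⟨le_rfl, ?_⟩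
      rintro ⟨c, i, j⟩ ⟨h1, h2, h3⟩
      simp only at h1 h2 h3
      obtain rfl : i = 0 := by omega
      subst h1
      rw [hD.mem_iff]
      rcases h3.lt_or_eq with h3 | rfl
      · exact Or.inr h3
      · exact Or.inl rfl
    · obtain ⟨⟨c', i', j'⟩, hx, h⟩ := Finset.mem_image.1 h
      obtain ⟨rfl, rfl, rfl⟩ : c' = c ∧ i' + 1 = i ∧ rowl D c' (i' + 1) = j := by simpa using h
      rw [hD.mem_remv] at hx
      refine ⟨le_rfl, ?_⟩
      rintro ⟨c, i, j⟩ ⟨h1, h2, h3⟩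
      simp only at h1 h2 h3
      subst h1
      rw [hD.mem_iff]
      rcases h2.lt_or_eq with h2 | rfl
      · have := hD.rowl_anti c (Nat.lt_succ_iff.1 h2)
        right; omega
      · rcases h3.lt_or_eq with h3 | rfl
        · exact Or.inr h3
        · exact Or.inl rfl
  · rintro ⟨h1, h2⟩
    have hj : j = rowl D c i := by
      by_contra hne
      have h3 := h2 (c, i, rowl D c i) ⟨rfl, le_rfl, h1⟩
      rw [hD.mem_iff] at h3
      rcases h3 with h3 | h3
      · exact hne (by simpa using h3.symm)
      · exact lt_irrefl _ h3
    cases i with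
    | zero => exact Or.inl (Finset.mem_image.2 ⟨c, Finset.mem_univ _, by rw [hj]⟩)
    | succ i =>
      right
      have h3 : j < rowl D c i := by
        have := h2 (c, i, j) ⟨rfl, by simp, le_rfl⟩
        rw [hD.mem_iff] at this
        simpa using this
      refine Finset.mem_image.2 ⟨(c, i, rowl D c i - 1), hD.mem_remv.2 ⟨by omega, by omega⟩, ?_⟩
      rw [hj]

/-- Each removable cell yields one addable cell, at the end of the next row; the first row of each
of the `r` components gives one more. -/
theorem IsLower.card_addb {D : Finset (Cell r)} (hD : IsLower D) :
    (addb D).card = (remv D).card + r := by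
  rw [addb, Finset.card_union_of_disjoint, Finset.card_image_of_injective,
    Finset.card_image_of_injOn, Finset.card_univ, Fintype.card_fin, add_comm]
  · rintro ⟨c, i, j⟩ hx ⟨c', i', j'⟩ hx' h
    simp only [Prod.mk.injEq, add_left_inj] at h
    obtain ⟨rfl, rfl, -⟩ := h
    have h1 := (hD.mem_remv.1 hx).1
    have h2 := (hD.mem_remv.1 hx').1
    simp; omega
  · intro c c' h
    exact congrArg Prod.fst h
  · rw [Finset.disjoint_left]
    intro x hx hx'
    obtain ⟨c, -, rfl⟩ := Finset.mem_image.1 hx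
    obtain ⟨y, -, h⟩ := Finset.mem_image.1 hx'
    simp at h

open Classical in
/-- The standard tableaux of shape `D`. -/
def tab (n : ℕ) (D : Finset (Cell r)) : Finset (Fin n → Cell r) :=
  (Fintype.piFinset fun _ => D).filter fun t => IsStd t ∧ Finset.univ.image t = D

theorem mem_tab {D : Finset (Cell r)} {t : Fin n → Cell r} :
    t ∈ tab n D ↔ IsStd t ∧ Finset.univ.image t = D := by
  classical
  rw [tab, Finset.mem_filter, Fintype.mem_piFinset, and_iff_right_iff_imp]
  rintro ⟨-, rfl⟩ k
  exact Finset.mem_image_of_mem _ (Finset.mem_univ _)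

theorem IsStd.isLower {t : Fin n → Cell r} (ht : IsStd t) : IsLower (Finset.univ.image t) := by
  intro x hx y hy
  obtain ⟨k, -, rfl⟩ := Finset.mem_image.1 hx
  obtain ⟨j, -, rfl⟩ := ht.lower k y hy
  exact Finset.mem_image_of_mem _ (Finset.mem_univ _)

theorem image_snoc (t : Fin n → Cell r) (x : Cell r) :
    Finset.univ.image (Fin.snoc t x : Fin (n + 1) → Cell r) = insert x (Finset.univ.image t) := by
  ext y
  simp only [Finset.mem_image, Finset.mem_univ, true_and, Finset.mem_insert]
  constructor
  · rintro ⟨k, rfl⟩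
    refine Fin.lastCases ?_ (fun k => ?_) k
    · simp
    · simp
  · rintro (rfl | ⟨k, rfl⟩)
    · exact ⟨Fin.last n, by simp⟩
    · exact ⟨k.castSucc, by simp⟩

theorem isStd_snoc {t : Fin n → Cell r} {x : Cell r} :
    IsStd (Fin.snoc t x : Fin (n + 1) → Cell r) ↔
      IsStd t ∧ x ∉ Finset.univ.image t ∧ IsLower (insert x (Finset.univ.image t)) := by
  constructor
  · intro h
    have h1 : IsStd t := by
      refine ⟨fun k l hkl => ?_, fun k y hy => ?_⟩
      · have := @h.inj k.castSucc l.castSucc (by simpa using hkl)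
        simpa using this
      · obtain ⟨j, hj, hjy⟩ := h.lower k.castSucc y (by simpa using hy)
        have hjn : j.1 < n := lt_of_le_of_lt hj k.2
        obtain ⟨j, rfl⟩ : ∃ j', j = Fin.castSucc j' := ⟨⟨j.1, hjn⟩, rfl⟩
        exact ⟨j, hj, by simpa using hjy⟩
    refine ⟨h1, fun hx => ?_, ?_⟩
    · obtain ⟨k, -, hk⟩ := Finset.mem_image.1 hx
      have := @h.inj k.castSucc (Fin.last n) (by simpa using hk)
      exact absurd this (Fin.castSucc_lt_last k).ne
    · rw [← image_snoc]
      exact h.isLower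
  · rintro ⟨h1, h2, h3⟩
    have h2' : ∀ k, t k ≠ x := fun k hk => h2 (Finset.mem_image.2 ⟨k, Finset.mem_univ _, hk⟩)
    refine ⟨fun k l => ?_, fun k y => ?_⟩
    · refine Fin.lastCases ?_ (fun k => ?_) k <;> refine Fin.lastCases ?_ (fun l => ?_) l
      · simp
      · simpa using fun h => (h2' l h.symm).elim
      · simpa using fun h => (h2' k h).elim
      · simpa using fun h => h1.inj h
    · refine Fin.lastCases ?_ (fun k => ?_) k
      · rw [Fin.snoc_last]
        intro hy
        rcases (h1.isLower.isLower_insert.1 h3) y hy with rfl | h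
        · exact ⟨Fin.last n, le_rfl, by simp⟩
        · obtain ⟨j, -, rfl⟩ := Finset.mem_image.1 h
          exact ⟨j.castSucc, Fin.le_last _, by simp⟩
      · rw [Fin.snoc_castSucc]
        intro hy
        obtain ⟨j, hj, rfl⟩ := h1.lower k y hy
        exact ⟨j.castSucc, hj, by simp⟩

/-- Branching rule: the largest entry occupies a removable cell, and deleting it leaves a standard
tableau. -/
theorem card_tab_succ {D : Finset (Cell r)} (hD : IsLower D) :
    (tab (n + 1) D).card = ∑ x ∈ remv D, (tab n (D.erase x)).card := by
  have hmem : ∀ (t : Fin n → Cell r) x, (Fin.snoc t x : Fin (n + 1) → Cell r) ∈ tab (n + 1) D ↔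
      x ∈ remv D ∧ t ∈ tab n (D.erase x) := by
    intro t x
    rw [mem_tab, mem_tab, isStd_snoc, image_snoc, mem_remv']
    constructor
    · rintro ⟨⟨h1, h2, h3⟩, rfl⟩
      rw [Finset.erase_insert h2]
      exact ⟨⟨Finset.mem_insert_self _ _, h1.isLower⟩, h1, rfl⟩
    · rintro ⟨⟨h1, h2⟩, h3, h4⟩
      rw [h4, Finset.insert_erase h1]
      exact ⟨⟨h3, Finset.notMem_erase _ _, hD⟩, rfl⟩
  have hdec : ∀ t : Fin (n + 1) → Cell r, t = Fin.snoc (Fin.init t) (t (Fin.last n)) := fun t =>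
    (Fin.snoc_init_self t).symm
  rw [Finset.card_eq_sum_card_fiberwise (f := fun t => t (Fin.last n)) (t := remv D)]
  · refine Finset.sum_congr rfl fun x hx => ?_
    refine Finset.card_nbij' (fun t => Fin.init t) (fun t => Fin.snoc t x) ?_ ?_ ?_ ?_
    · intro t ht
      obtain ⟨ht', rfl⟩ := Finset.mem_filter.1 ht
      rw [hdec t, hmem] at ht'
      exact ht'.2
    · intro t ht
      exact Finset.mem_filter.2 ⟨(hmem t x).2 ⟨hx, ht⟩, by simp⟩
    · intro t ht
      obtain ⟨ht, rfl⟩ := Finset.mem_filter.1 ht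
      exact (hdec t).symm
    · intro t ht
      simp
  · intro t ht
    rw [Finset.mem_coe, hdec t, hmem] at ht
    exact ht.1

/-- The lattice of multidiagrams is r-differential: adding then removing a cell differs from
removing then adding only when the cell is the same, and there are `r` more addable than removable
cells. -/
theorem sum_card_tab_insert (n : ℕ) {D : Finset (Cell r)} (hD : IsLower D) (hc : D.card = n) :
    ∑ y ∈ addb D, (tab (n + 1) (insert y D)).card = r * (n + 1) * (tab n D).card := by
  induction n generalizing D with
  | zero =>
    obtain rfl := Finset.card_eq_zero.1 hc
    have h1 : remv (∅ : Finset (Cell r)) = ∅ := by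
      ext x; rw [mem_remv']; simp
    have h2 := hD.card_addb
    rw [h1, Finset.card_empty, zero_add] at h2
    rw [Finset.sum_congr rfl (g := fun _ => (tab 0 (∅ : Finset (Cell r))).card),
      Finset.sum_const, h2, smul_eq_mul, zero_add, mul_one]
    intro y hy
    rw [card_tab_succ (hD.mem_addb.1 hy).2, Finset.sum_eq_single y,
      Finset.erase_insert (Finset.notMem_empty y)]
    · intro x hx hxy
      have := (mem_remv'.1 hx).1
      simp only [Finset.mem_insert, Finset.notMem_empty, or_false] at this
      exact absurd this hxy
    · intro h
      exact absurd (mem_remv'.2 ⟨Finset.mem_insert_self _ _, by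
        rwa [Finset.erase_insert (Finset.notMem_empty y)]⟩) h
  | succ m ih =>
    have h1 : ∀ y ∈ addb D, (tab (m + 1 + 1) (insert y D)).card = (tab (m + 1) D).card +
        ∑ x ∈ (remv (insert y D)).erase y, (tab (m + 1) ((insert y D).erase x)).card := by
      intro y hy
      obtain ⟨h, h'⟩ := hD.mem_addb.1 hy
      rw [card_tab_succ h', ← Finset.add_sum_erase (remv (insert y D)) _
        (mem_remv'.2 ⟨Finset.mem_insert_self _ _, by rwa [Finset.erase_insert h]⟩),
        Finset.erase_insert h]
    have hlow : ∀ x ∈ remv D, IsLower (D.erase x) := fun x hx => (mem_remv'.1 hx).2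
    -- For distinct cells, adding `y` and removing `x` are operations in either order.
    have h2 : ∀ y x, (y ∈ addb D ∧ x ∈ (remv (insert y D)).erase y) ↔
        (y ∈ (addb (D.erase x)).erase x ∧ x ∈ remv D) := by
      intro y x
      rw [hD.mem_addb, Finset.mem_erase, mem_remv', Finset.mem_erase, Finset.mem_insert]
      constructor
      · rintro ⟨⟨hy, hyD⟩, hxy, hx, hxD⟩
        have hx := hx.resolve_left hxy
        have hlx : IsLower (D.erase x) := fun z hz u hu => by
          obtain ⟨hzx, hz⟩ := Finset.mem_erase.1 hz
          have h3 := hxD z (Finset.mem_erase.2 ⟨hzx, Finset.mem_insert_of_mem hz⟩) u hu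
          exact Finset.mem_erase.2 ⟨(Finset.mem_erase.1 h3).1, hD z hz u hu⟩
        refine ⟨⟨Ne.symm hxy, (hlx.mem_addb).2 ⟨fun h => hy (Finset.mem_of_mem_erase h), ?_⟩⟩,
          mem_remv'.2 ⟨hx, hlx⟩⟩
        rwa [← Finset.erase_insert_of_ne (Ne.symm hxy)]
      · rintro ⟨⟨hxy, hy⟩, hx⟩
        obtain ⟨hx, hxD⟩ := mem_remv'.1 hx
        obtain ⟨hy, hyD⟩ := hxD.mem_addb.1 hy
        rw [← Finset.erase_insert_of_ne hxy] at hyD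
        refine ⟨⟨fun h => hy (Finset.mem_erase.2 ⟨hxy, h⟩), hD.isLower_insert.2 fun z hz => ?_⟩,
          Ne.symm hxy, Or.inr hx, hyD⟩
        have h3 := hyD y (Finset.mem_erase.2 ⟨hxy, Finset.mem_insert_self _ _⟩) z hz
        exact Finset.mem_insert.1 (Finset.mem_of_mem_erase h3)
    have h4 : ∀ x ∈ remv D, ∑ y ∈ (addb (D.erase x)).erase x,
        (tab (m + 1) ((insert y D).erase x)).card + (tab (m + 1) D).card =
          r * (m + 1) * (tab m (D.erase x)).card := by
      intro x hx
      obtain ⟨hxD, hlx⟩ := mem_remv'.1 hx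
      rw [← ih hlx (by rw [Finset.card_erase_of_mem hxD, hc, Nat.add_sub_cancel]),
        ← Finset.sum_erase_add (addb (D.erase x)) _ (hlx.mem_addb.2 ⟨Finset.notMem_erase _ _, by
          rwa [Finset.insert_erase hxD]⟩), Finset.insert_erase hxD]
      congr 1
      refine Finset.sum_congr rfl fun y hy => ?_
      rw [Finset.erase_insert_of_ne (Finset.ne_of_mem_erase hy)]
    have h5 := Finset.sum_congr rfl h4
    rw [Finset.sum_add_distrib, Finset.sum_const, ← Finset.mul_sum, ← card_tab_succ hD,
      smul_eq_mul] at h5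
    rw [Finset.sum_congr rfl h1, Finset.sum_add_distrib, Finset.sum_const, Finset.sum_comm' h2,
      hD.card_addb, smul_eq_mul]
    linarith

open Classical in
/-- The multidiagrams with `n` cells. -/
def shapes (r n : ℕ) : Finset (Finset (Cell r)) :=
  match n with
  | 0 => {∅}
  | n + 1 => (shapes r n).biUnion fun D => (addb D).image (insert · D)

theorem mem_shapes {D : Finset (Cell r)} : D ∈ shapes r n ↔ IsLower D ∧ D.card = n := by
  classical
  induction n generalizing D with
  | zero =>
    rw [shapes, Finset.mem_singleton, Finset.card_eq_zero, iff_and_self]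
    rintro rfl x hx
    simp at hx
  | succ n ih =>
    rw [shapes, Finset.mem_biUnion]
    constructor
    · rintro ⟨D', hD', h⟩
      obtain ⟨y, hy, rfl⟩ := Finset.mem_image.1 h
      obtain ⟨h1, h2⟩ := ih.1 hD'
      obtain ⟨h3, h4⟩ := h1.mem_addb.1 hy
      exact ⟨h4, by rw [Finset.card_insert_of_notMem h3, h2]⟩
    · rintro ⟨h1, h2⟩
      -- A cell with maximal i + j is removable, since any other cell to its south-east has a larger
      -- sum.
      obtain ⟨x, hx, hmax⟩ := Finset.exists_max_image D (fun x => x.2.1 + x.2.2)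
        (Finset.card_pos.1 (by omega))
      have hlx : IsLower (D.erase x) := by
        intro y hy z hz
        obtain ⟨hyx, hyD⟩ := Finset.mem_erase.1 hy
        refine Finset.mem_erase.2 ⟨?_, h1 y hyD z hz⟩
        rintro rfl
        have := hmax y hyD
        obtain ⟨e1, e2, e3⟩ := hz
        exact hyx (Prod.ext e1.symm (Prod.ext (by omega) (by omega)))
      refine ⟨D.erase x, ih.2 ⟨hlx, by rw [Finset.card_erase_of_mem hx, h2, Nat.add_sub_cancel]⟩,
        Finset.mem_image.2 ⟨x, hlx.mem_addb.2 ⟨Finset.notMem_erase _ _, ?_⟩, ?_⟩⟩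
      · rwa [Finset.insert_erase hx]
      · exact Finset.insert_erase hx

/-- Expand one factor f_D by the branching rule, reindex by pairs of a smaller diagram and an
addable cell, and apply `sum_card_tab_insert`. -/
theorem sum_card_tab_sq (r n : ℕ) :
    ∑ D ∈ shapes r n, (tab n D).card * (tab n D).card = r ^ n * n.factorial := by
  induction n with
  | zero =>
    rw [shapes, Finset.sum_singleton]
    have : tab 0 (∅ : Finset (Cell r)) = {Fin.elim0} := by
      ext t
      rw [mem_tab, Finset.mem_singleton]
      exact ⟨fun _ => Subsingleton.elim _ _, fun _ => ⟨⟨fun k => k.elim0, fun k => k.elim0⟩, by simp⟩⟩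
    simp [this]
  | succ n ih =>
    have h1 : ∀ D ∈ shapes r (n + 1), (tab (n + 1) D).card * (tab (n + 1) D).card =
        ∑ x ∈ remv D, (tab n (D.erase x)).card * (tab (n + 1) D).card := fun D hD => by
      rw [← Finset.sum_mul, ← card_tab_succ (mem_shapes.1 hD).1]
    have h2 : ∀ D ∈ shapes r n, ∑ y ∈ addb D, (tab n D).card * (tab (n + 1) (insert y D)).card =
        r * (n + 1) * ((tab n D).card * (tab n D).card) := fun D hD => by
      obtain ⟨h, h'⟩ := mem_shapes.1 hD
      rw [← Finset.mul_sum, sum_card_tab_insert n h h']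
      ring
    rw [Finset.sum_congr rfl h1, Finset.sum_sigma']
    trans ∑ D ∈ shapes r n, ∑ y ∈ addb D, (tab n D).card * (tab (n + 1) (insert y D)).card
    · rw [Finset.sum_sigma' (shapes r n)]
      refine Finset.sum_bij' (fun p _ => ⟨p.1.erase p.2, p.2⟩) (fun p _ => ⟨insert p.2 p.1, p.2⟩)
        ?_ ?_ ?_ ?_ ?_
      · rintro ⟨D, x⟩ hp
        obtain ⟨hD, hx⟩ := Finset.mem_sigma.1 hp
        obtain ⟨h, h'⟩ := mem_shapes.1 hD
        obtain ⟨hx, hlx⟩ := mem_remv'.1 hx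
        refine Finset.mem_sigma.2 ⟨mem_shapes.2 ⟨hlx, ?_⟩, hlx.mem_addb.2 ⟨Finset.notMem_erase _ _, ?_⟩⟩
        · rw [Finset.card_erase_of_mem hx, h', Nat.add_sub_cancel]
        · rwa [Finset.insert_erase hx]
      · rintro ⟨D, x⟩ hp
        obtain ⟨hD, hx⟩ := Finset.mem_sigma.1 hp
        obtain ⟨h, h'⟩ := mem_shapes.1 hD
        obtain ⟨hx, hlx⟩ := h.mem_addb.1 hx
        refine Finset.mem_sigma.2 ⟨mem_shapes.2 ⟨hlx, ?_⟩,
          mem_remv'.2 ⟨Finset.mem_insert_self _ _, ?_⟩⟩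
        · rw [Finset.card_insert_of_notMem hx, h']
        · rwa [Finset.erase_insert hx]
      · rintro ⟨D, x⟩ hp
        have hx := (mem_remv'.1 (Finset.mem_sigma.1 hp).2).1
        simp only [Finset.insert_erase hx]
      · rintro ⟨D, x⟩ hp
        obtain ⟨hD, hx⟩ := Finset.mem_sigma.1 hp
        have hx := ((mem_shapes.1 hD).1.mem_addb.1 hx).1
        simp only [Finset.erase_insert hx]
      · rintro ⟨D, x⟩ hp
        have hx := (mem_remv'.1 (Finset.mem_sigma.1 hp).2).1
        simp only [Finset.insert_erase hx]
    · rw [Finset.sum_congr rfl h2, ← Finset.mul_sum, ih, Nat.factorial_succ]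
      ring

/-- There are `r ^ n * n!` pairs of standard tableaux of the same shape. -/
theorem exists_finset_pairs (r n : ℕ) : ∃ P : Finset ((Fin n → Cell r) × (Fin n → Cell r)),
    (∀ p ∈ P, IsStd p.1 ∧ IsStd p.2 ∧ Finset.univ.image p.1 = Finset.univ.image p.2) ∧
      P.card = r ^ n * n.factorial := by
  classical
  refine ⟨(shapes r n).biUnion fun D => tab n D ×ˢ tab n D, fun p hp => ?_, ?_⟩
  · obtain ⟨D, -, hp⟩ := Finset.mem_biUnion.1 hp
    obtain ⟨h1, h2⟩ := Finset.mem_product.1 hp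
    rw [mem_tab] at h1 h2
    exact ⟨h1.1, h2.1, h1.2.trans h2.2.symm⟩
  · rw [Finset.card_biUnion, ← sum_card_tab_sq]
    · simp only [Finset.card_product]
    · intro D _ D' _ hne
      rw [Function.onFun, Finset.disjoint_left]
      intro p hp hp'
      have h1 := mem_tab.1 (Finset.mem_product.1 hp).1
      have h2 := mem_tab.1 (Finset.mem_product.1 hp').1
      exact hne (h1.2.symm.trans h2.2)


/-! ### The seminormal representation -/

section Seminormal

variable {K : Type} [Field K]

/-- The content of a cell. -/
def cont (q : K) (Q : Fin r → K) (x : Cell r) : K := Q x.1 * q ^ x.2.2 * (q ^ x.2.1)⁻¹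

/-- The monomials `Q_c q^a` are pairwise distinct. -/
structure IsGeneric (q : K) (Q : Fin r → K) : Prop where
  q_ne : q ≠ 0
  sep : ∀ c c' a b, Q c * q ^ a = Q c' * q ^ b → c = c' ∧ a = b

theorem IsGeneric.sameDiag {q : K} {Q : Fin r → K} (h : IsGeneric q Q) {x y : Cell r}
    (hxy : cont q Q x = cont q Q y) : SameDiag x y := by
  refine h.sep _ _ _ _ ?_
  have h1 := pow_ne_zero x.2.1 h.q_ne
  have h2 := pow_ne_zero y.2.1 h.q_ne
  rw [cont, cont] at hxy
  field_simp at hxy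
  rw [pow_add, pow_add, ← mul_assoc, ← mul_assoc, hxy]
  ring

/-- The diagonal coefficient of the seminormal form. -/
def snA (q x y : K) : K := (q - 1) * y / (y - x)

open Classical in
/-- The off-diagonal coefficient of the seminormal form. -/
def snB (q x y : K) : K := if q + snA q x y * snA q y x = 0 then 0 else 1 + snA q x y

theorem snA_add (q : K) {x y : K} (h : x ≠ y) : snA q x y + snA q y x = q - 1 := by
  have h1 : y - x ≠ 0 := sub_ne_zero.2 h.symm
  have h2 : x - y ≠ 0 := sub_ne_zero.2 h
  rw [snA, snA, ← neg_sub y x]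
  field_simp
  ring

theorem snA_mul (q : K) {x y : K} (h : x ≠ y) : snA q x y * x + (q - 1) * y = y * snA q x y := by
  have h1 : y - x ≠ 0 := sub_ne_zero.2 h.symm
  rw [snA]
  field_simp
  ring

/-- The relations constrain only this product of off-diagonal coefficients. Since the two diagonal
ones add up to q-1, it equals (1 + A)(1 + A'). Setting both factors to zero when the product
vanishes keeps nonvanishing symmetric and avoids square roots. -/
theorem snB_mul (q : K) {x y : K} (h : x ≠ y) :
    snB q x y * snB q y x = q + snA q x y * snA q y x := by
  rw [snB, snB, mul_comm (snA q y x)]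
  split_ifs with h1
  · rw [h1, mul_zero]
  · linear_combination snA_add q h

theorem snB_eq_zero_of {q x y : K} (h : x ≠ y) (hxy : y = q * x ∨ x = q * y) : snB q x y = 0 := by
  rw [snB, if_pos]
  have key : ∀ z : K, z ≠ q * z → snA q z (q * z) = q ∧ snA q (q * z) z = -1 := fun z hz => by
    rw [snA, snA, div_eq_iff (sub_ne_zero.2 hz.symm), div_eq_iff (sub_ne_zero.2 hz)]
    exact ⟨by ring, by ring⟩
  rcases hxy with rfl | rfl
  · rw [(key x h).1, (key x h).2]; ring
  · rw [(key y h.symm).1, (key y h.symm).2]; ring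

theorem snB_ne_zero_symm {q x y : K} (h : x ≠ y) (hb : snB q x y ≠ 0) : snB q y x ≠ 0 := by
  have h1 : q + snA q x y * snA q y x ≠ 0 := fun h1 => hb (by rw [snB, if_pos h1])
  rw [← snB_mul q h] at h1
  exact right_ne_zero_of_mul h1

/-- This and the next two identities are the coefficients of t, t ∘ s_i and t ∘ s_j in the braid
relation; the other coefficients agree without computation. -/
theorem snA_braid_diag (q : K) {x y z : K} (h1 : x ≠ y) (h2 : y ≠ z) (h3 : x ≠ z) :
    snA q x y * snA q y z * snA q x y + (q + snA q x y * snA q y x) * snA q x z =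
      snA q y z * snA q x y * snA q y z + (q + snA q y z * snA q z y) * snA q x z := by
  have e1 : y - x ≠ 0 := sub_ne_zero.2 h1.symm
  have e2 : z - y ≠ 0 := sub_ne_zero.2 h2.symm
  have e3 : z - x ≠ 0 := sub_ne_zero.2 h3.symm
  simp only [snA]
  rw [← neg_sub y x, ← neg_sub z y]
  field_simp
  ring

theorem snA_braid_left (q : K) {x y z : K} (h1 : x ≠ y) (h2 : y ≠ z) (h3 : x ≠ z) :
    snA q x y * snA q y z + snA q x z * snA q y x = snA q y z * snA q x z := by
  have e1 : y - x ≠ 0 := sub_ne_zero.2 h1.symm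
  have e2 : z - y ≠ 0 := sub_ne_zero.2 h2.symm
  have e3 : z - x ≠ 0 := sub_ne_zero.2 h3.symm
  simp only [snA]
  rw [← neg_sub y x]
  field_simp
  ring

theorem snA_braid_right (q : K) {x y z : K} (h1 : x ≠ y) (h2 : y ≠ z) (h3 : x ≠ z) :
    snA q x y * snA q x z = snA q y z * snA q x y + snA q x z * snA q z y := by
  have e1 : y - x ≠ 0 := sub_ne_zero.2 h1.symm
  have e2 : z - y ≠ 0 := sub_ne_zero.2 h2.symm
  have e3 : z - x ≠ 0 := sub_ne_zero.2 h3.symm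
  simp only [snA]
  rw [← neg_sub z y]
  field_simp
  ring

/-- The operator `T_i` on functions of sequences of cells. -/
def freeTOp (q : K) (Q : Fin r → K) (i : Fin (n - 1)) (f : (Fin n → Cell r) → K) :
    (Fin n → Cell r) → K := fun t =>
  snA q (cont q Q (t (lo i))) (cont q Q (t (hi i))) * f t +
    snB q (cont q Q (t (lo i))) (cont q Q (t (hi i))) * f (t ∘ simpleSwap i)

variable (n r) in
/-- The set of standard tableaux. -/
abbrev Std : Type := {t : Fin n → Cell r // IsStd t}

open Classical in
/-- Extension by zero from standard tableaux. -/
def extZ (v : Std n r → K) (t : Fin n → Cell r) : K := if h : IsStd t then v ⟨t, h⟩ else 0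

theorem extZ_coe (v : Std n r → K) (t : Std n r) : extZ v t = v t := by
  rw [extZ, dif_pos t.2]

theorem extZ_of_not (v : Std n r → K) {t : Fin n → Cell r} (h : ¬ IsStd t) : extZ v t = 0 := by
  rw [extZ, dif_neg h]

theorem extZ_add (v w : Std n r → K) : extZ (v + w) = extZ v + extZ w := by
  funext t
  simp only [extZ, Pi.add_apply]
  split_ifs <;> simp

theorem extZ_smul (a : K) (v : Std n r → K) : extZ (a • v) = a • extZ v := by
  funext t
  simp only [extZ, Pi.smul_apply]
  split_ifs <;> simp

/-- The action of `T_i` on functions of standard tableaux. -/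
def TOp (q : K) (Q : Fin r → K) (i : Fin (n - 1)) : Module.End K (Std n r → K) where
  toFun v := fun t => freeTOp q Q i (extZ v) t
  map_add' v w := by
    funext t
    simp only [freeTOp, extZ_add, Pi.add_apply]
    ring
  map_smul' a v := by
    funext t
    simp only [freeTOp, extZ_smul, Pi.smul_apply, smul_eq_mul, RingHom.id_apply]
    ring

/-- The action of `L_k` on functions of standard tableaux. -/
def LOp (q : K) (Q : Fin r → K) (k : Fin n) : Module.End K (Std n r → K) where
  toFun v := fun t => cont q Q (t.1 k) * v t
  map_add' v w := by funext t; simp only [Pi.add_apply]; ring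
  map_smul' a v := by
    funext t
    simp only [Pi.smul_apply, smul_eq_mul, RingHom.id_apply]
    ring

theorem TOp_apply (q : K) (Q : Fin r → K) (i : Fin (n - 1)) (v : Std n r → K) (t : Std n r) :
    TOp q Q i v t = freeTOp q Q i (extZ v) t := rfl

theorem LOp_apply (q : K) (Q : Fin r → K) (k : Fin n) (v : Std n r → K) (t : Std n r) :
    LOp q Q k v t = cont q Q (t.1 k) * v t := rfl

theorem IsGeneric.cont_ne {q : K} {Q : Fin r → K} (h : IsGeneric q Q) {t : Fin n → Cell r}
    (ht : IsStd t) {k l : Fin n} (hkl : k < l) (h' : l.1 < k.1 + 3) :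
    cont q Q (t k) ≠ cont q Q (t l) := fun e => by
  have := ht.add_three_le hkl (h.sameDiag e)
  omega

theorem comp_swap_swap (t : Fin n → Cell r) (i : Fin (n - 1)) :
    (t ∘ simpleSwap i) ∘ simpleSwap i = t := by
  rw [Function.comp_assoc, ← Equiv.Perm.coe_mul, simpleSwap_mul_self, Equiv.Perm.coe_one,
    Function.comp_id]

theorem IsGeneric.snB_eq_zero {q : K} {Q : Fin r → K} (h : IsGeneric q Q) {t : Fin n → Cell r}
    (ht : IsStd t) {i : Fin (n - 1)} (h' : ¬ IsStd (t ∘ simpleSwap i)) :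
    snB q (cont q Q (t (lo i))) (cont q Q (t (hi i))) = 0 := by
  have hlh : (lo i).1 + 1 = (hi i).1 := rfl
  refine snB_eq_zero_of (h.cont_ne ht (lo_lt_hi i) (by omega)) ?_
  have hq := h.q_ne
  rcases ht.adjacent (not_not.1 fun hb => h' (ht.swap hb)) with e | e
  · right
    rw [e, cont, cont, pow_succ]
    field_simp
  · left
    rw [e, cont, cont, pow_succ]
    ring

/-- The coefficients joining standard to nonstandard fillings vanish, in both directions. Hence the
relations can be verified with the free formula, with no case distinction on which swaps are
standard. -/
theorem IsGeneric.extZ_TOp {q : K} {Q : Fin r → K} (h : IsGeneric q Q) (i : Fin (n - 1))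
    (v : Std n r → K) : extZ (TOp q Q i v) = freeTOp q Q i (extZ v) := by
  funext t
  by_cases ht : IsStd t
  · exact extZ_coe _ ⟨t, ht⟩
  · rw [extZ_of_not _ ht, freeTOp, extZ_of_not v ht, mul_zero, zero_add]
    by_cases ht' : IsStd (t ∘ simpleSwap i)
    · have h1 := h.snB_eq_zero ht' (i := i) (by rwa [comp_swap_swap])
      rw [Function.comp_apply, Function.comp_apply, simpleSwap_lo, simpleSwap_hi] at h1
      have h2 : snB q (cont q Q (t (lo i))) (cont q Q (t (hi i))) = 0 := by
        by_contra hne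
        have hlh : (lo i).1 + 1 = (hi i).1 := rfl
        have h3 := h.cont_ne ht' (lo_lt_hi i) (by omega)
        rw [Function.comp_apply, Function.comp_apply, simpleSwap_lo, simpleSwap_hi] at h3
        exact snB_ne_zero_symm h3.symm hne h1
      rw [h2, zero_mul]
    · rw [extZ_of_not v ht', mul_zero]

theorem extZ_LOp (q : K) (Q : Fin r → K) (k : Fin n) (v : Std n r → K) (t : Fin n → Cell r) :
    extZ (LOp q Q k v) t = cont q Q (t k) * extZ v t := by
  by_cases ht : IsStd t
  · rw [extZ_coe _ ⟨t, ht⟩, extZ_coe v ⟨t, ht⟩]; rfl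
  · rw [extZ_of_not _ ht, extZ_of_not _ ht, mul_zero]

variable {q : K} {Q : Fin r → K}

theorem IsGeneric.TOp_comm (h : IsGeneric q Q) {i j : Fin (n - 1)}
    (hij : i.1 + 1 < j.1 ∨ j.1 + 1 < i.1) : TOp (n := n) q Q i * TOp q Q j = TOp q Q j * TOp q Q i := by
  refine LinearMap.ext fun v => funext fun t => ?_
  have e : lo i ≠ lo j ∧ lo i ≠ hi j ∧ hi i ≠ lo j ∧ hi i ≠ hi j := by
    simp only [lo, hi, ne_eq, Fin.mk.injEq]; omega
  obtain ⟨e1, e2, e3, e4⟩ := e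
  have hc : (t.1 ∘ simpleSwap i) ∘ simpleSwap j = (t.1 ∘ simpleSwap j) ∘ simpleSwap i := by
    simp only [Function.comp_assoc, ← Equiv.Perm.coe_mul, simpleSwap_comm hij]
  simp only [Module.End.mul_apply, TOp_apply, h.extZ_TOp, freeTOp, Function.comp_apply,
    simpleSwap_of_ne e1 e2, simpleSwap_of_ne e3 e4, simpleSwap_of_ne e1.symm e3.symm,
    simpleSwap_of_ne e2.symm e4.symm, hc]
  ring

theorem IsGeneric.TOp_braid (h : IsGeneric q Q) {i j : Fin (n - 1)} (hij : j.1 = i.1 + 1) :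
    TOp (n := n) q Q i * TOp q Q j * TOp q Q i = TOp q Q j * TOp q Q i * TOp q Q j := by
  refine LinearMap.ext fun v => funext fun t => ?_
  have hm : lo j = hi i := Fin.ext hij
  have e1 : lo i ≠ lo j := by rw [hm]; exact lo_ne_hi i
  have e2 : lo i ≠ hi j := by simp only [lo, hi, ne_eq, Fin.mk.injEq]; omega
  have e3 : hi j ≠ hi i := by rw [← hm]; exact (lo_ne_hi j).symm
  have f1 : simpleSwap j (hi i) = hi j := by rw [← hm, simpleSwap_lo]
  have f2 : simpleSwap j (hi j) = hi i := by rw [simpleSwap_hi, hm]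
  have f3 := simpleSwap_of_ne e1 e2
  have f4 := simpleSwap_of_ne e2.symm e3
  have hc : ((t.1 ∘ simpleSwap i) ∘ simpleSwap j) ∘ simpleSwap i =
      ((t.1 ∘ simpleSwap j) ∘ simpleSwap i) ∘ simpleSwap j := by
    simp only [Function.comp_assoc, ← Equiv.Perm.coe_mul, simpleSwap_braid hij]
  have g1 := h.cont_ne t.2 (lo_lt_hi i) (by simp only [lo, hi]; omega)
  have g2 := h.cont_ne t.2 (show hi i < hi j by rw [← hm]; exact lo_lt_hi j)
    (by simp only [hi]; omega)
  have g3 := h.cont_ne t.2 (show lo i < hi j from (lo_lt_hi i).trans (by rw [← hm]; exact lo_lt_hi j))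
    (by simp only [lo, hi]; omega)
  simp only [Module.End.mul_apply, TOp_apply, h.extZ_TOp, freeTOp, Function.comp_apply,
    simpleSwap_lo, simpleSwap_hi, hm, f1, f2, f3, f4, hc, comp_swap_swap]
  have k1 := snA_braid_diag q g1 g2 g3
  have k2 := snA_braid_left q g1 g2 g3
  have k3 := snA_braid_right q g1 g2 g3
  rw [← snB_mul q g1, ← snB_mul q g2] at k1
  set x := cont q Q (t.1 (lo i))
  set y := cont q Q (t.1 (hi i))
  set z := cont q Q (t.1 (hi j))
  linear_combination extZ v t.1 * k1 + snB q x y * extZ v (t.1 ∘ simpleSwap i) * k2 +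
    snB q y z * extZ v (t.1 ∘ simpleSwap j) * k3

theorem IsGeneric.TOp_mul_self (h : IsGeneric q Q) (i : Fin (n - 1)) (v : Std n r → K) :
    TOp q Q i (TOp q Q i v) = (q - 1) • TOp q Q i v + q • v := by
  funext t
  have hlh : (lo i).1 + 1 = (hi i).1 := rfl
  have hne := h.cont_ne t.2 (lo_lt_hi i) (by omega)
  rw [TOp_apply, h.extZ_TOp]
  simp only [Pi.add_apply, Pi.smul_apply, TOp_apply, freeTOp, comp_swap_swap, Function.comp_apply,
    simpleSwap_lo, simpleSwap_hi, extZ_coe, smul_eq_mul]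
  have h1 := snA_add q hne
  have h2 := snB_mul q hne
  linear_combination (snA q (cont q Q (t.1 (lo i))) (cont q Q (t.1 (hi i))) * v t +
    snB q (cont q Q (t.1 (lo i))) (cont q Q (t.1 (hi i))) * extZ v (t.1 ∘ simpleSwap i)) * h1 +
    v t * h2

theorem IsGeneric.TOp_LOp (h : IsGeneric q Q) (i : Fin (n - 1)) (v : Std n r → K) :
    TOp q Q i (LOp q Q (lo i) v) + (q - 1) • LOp q Q (hi i) v = LOp q Q (hi i) (TOp q Q i v) := by
  funext t
  have hlh : (lo i).1 + 1 = (hi i).1 := rfl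
  have hne := h.cont_ne t.2 (lo_lt_hi i) (by omega)
  simp only [Pi.add_apply, Pi.smul_apply, TOp_apply, LOp_apply, freeTOp, extZ_LOp,
    Function.comp_apply, simpleSwap_lo, extZ_coe, smul_eq_mul]
  linear_combination v t * snA_mul q hne

theorem TOp_LOp_comm (q : K) (Q : Fin r → K) {i : Fin (n - 1)} {j : Fin n} (h : j ≠ lo i)
    (h' : j ≠ hi i) : TOp (n := n) q Q i * LOp q Q j = LOp q Q j * TOp q Q i := by
  refine LinearMap.ext fun v => funext fun t => ?_
  simp only [Module.End.mul_apply, TOp_apply, LOp_apply, freeTOp, extZ_LOp,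
    Function.comp_apply, simpleSwap_of_ne h h', extZ_coe]
  ring

theorem IsGeneric.LOp_hi (h : IsGeneric q Q) (i : Fin (n - 1)) :
    q • LOp (n := n) q Q (hi i) = TOp q Q i * LOp q Q (lo i) * TOp q Q i := by
  refine LinearMap.ext fun v => ?_
  simp only [Module.End.mul_apply, LinearMap.smul_apply]
  rw [eq_sub_of_add_eq (h.TOp_LOp i (TOp q Q i v)), h.TOp_mul_self, map_add, map_smul, map_smul,
    add_sub_cancel_left]

theorem IsStd.zero_eq {t : Fin n → Cell r} (ht : IsStd t) {k : Fin n} (hk : k.1 = 0) :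
    (t k).2 = (0, 0) := by
  obtain ⟨j, hj, hjk⟩ := ht.lower k ((t k).1, 0, 0) ⟨rfl, by simp, by simp⟩
  obtain rfl : j = k := Fin.ext (by rw [Fin.le_def] at hj; omega)
  rw [hjk]

/-- The first entry sits in a corner cell (c, 0, 0), whose content is Q_c. -/
theorem LOp_cyclotomic (q : K) (Q : Fin r → K) {k : Fin n} (hk : k.1 = 0) :
    Polynomial.aeval (LOp q Q k) (∏ c : Fin r, (Polynomial.X - Polynomial.C (Q c))) = 0 := by
  have key : ∀ (p : Polynomial K) (v : Std n r → K) t,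
      Polynomial.aeval (LOp q Q k) p v t = p.eval (cont q Q (t.1 k)) * v t := by
    intro p v t
    induction p using Polynomial.induction_on' with
    | add p p' h h' =>
      rw [map_add, LinearMap.add_apply, Pi.add_apply, h, h', Polynomial.eval_add, add_mul]
    | monomial m a =>
      rw [Polynomial.aeval_monomial, Polynomial.eval_monomial, Module.End.mul_apply,
        Module.algebraMap_end_apply, Pi.smul_apply, smul_eq_mul, mul_assoc]
      congr 1
      induction m with
      | zero => simp
      | succ m ih => rw [pow_succ', Module.End.mul_apply, LOp_apply, ih, pow_succ']; ring
  refine LinearMap.ext fun v => funext fun t => ?_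
  have h1 := t.2.zero_eq hk
  rw [key, Polynomial.eval_prod, Finset.prod_eq_zero (Finset.mem_univ (t.1 k).1), zero_mul]
  · rfl
  · simp [cont, h1]

end Seminormal


section

variable {K : Type} [Field K] {A : Type} [CommRing A] [Algebra A K]

/-- The seminormal representation of the cyclotomic Hecke algebra. -/
theorem IsGeneric.exists_rep {q : Aˣ} {Q : Fin r → A}
    (h : IsGeneric (algebraMap A K q) (fun c => algebraMap A K (Q c))) (n : ℕ) :
    ∃ φ : HeckeOver n r q Q →ₐ[A] Module.End K (Std n r → K),
      (∀ k, φ (RingQuot.mkAlgHom A _ (freeL A k)) =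
        LOp (algebraMap A K q) (fun c => algebraMap A K (Q c)) k) ∧
      ∀ i, φ (RingQuot.mkAlgHom A _ (freeT A i)) =
        TOp (algebraMap A K q) (fun c => algebraMap A K (Q c)) i := by
  set q' : K := algebraMap A K q
  set Q' : Fin r → K := fun c => algebraMap A K (Q c) with hQ'
  let ψ : FreeAlgebra A (Gen n) →ₐ[A] Module.End K (Std n r → K) := FreeAlgebra.lift A fun g =>
    match g with
    | Gen.L k => LOp q' Q' k
    | Gen.T i => TOp q' Q' i
  have hL : ∀ k, ψ (freeL A k) = LOp q' Q' k := fun k => FreeAlgebra.lift_ι_apply _ _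
  have hT : ∀ i, ψ (freeT A i) = TOp q' Q' i := fun i => FreeAlgebra.lift_ι_apply _ _
  have hsm : ∀ (a : A) (x : Module.End K (Std n r → K)), a • x = algebraMap A K a • x := fun a x =>
    (algebraMap_smul K a x).symm
  have hrel : ∀ ⦃x y⦄, Rel n r q Q x y → ψ x = ψ y := by
    rintro _ _ h'
    induction h' with
    | T_comm i j hij => rw [map_mul, map_mul, hT, hT, h.TOp_comm hij]
    | L_comm i j =>
      rw [map_mul, map_mul, hL, hL]
      refine LinearMap.ext fun v => funext fun t => ?_
      simp only [Module.End.mul_apply, LOp_apply]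
      ring
    | TL_comm i j h1 h2 => rw [map_mul, map_mul, hL, hT, TOp_LOp_comm q' Q' h1 h2]
    | braid i j hij => rw [map_mul, map_mul, map_mul, map_mul, hT, hT, h.TOp_braid hij]
    | quadratic i =>
      rw [map_mul, map_add, map_sub, map_one, hT, AlgHom.commutes, map_zero,
        Algebra.algebraMap_eq_smul_one, hsm]
      refine LinearMap.ext fun v => ?_
      simp only [Module.End.mul_apply, LinearMap.add_apply, LinearMap.sub_apply, Module.End.one_apply,
        LinearMap.smul_apply, map_sub, map_smul, h.TOp_mul_self, LinearMap.zero_apply]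
      module
    | L_succ i => rw [map_smul, map_mul, map_mul, hL, hL, hT, hsm, h.LOp_hi]
    | cyclotomic j hj =>
      rw [← Polynomial.aeval_algHom_apply, hL, map_zero, ← LOp_cyclotomic q' Q' hj,
        ← Polynomial.aeval_map_algebraMap K, Polynomial.map_prod]
      simp [hQ']
  exact ⟨RingQuot.liftAlgHom A ⟨ψ, hrel⟩, fun k => by rw [RingQuot.liftAlgHom_mkAlgHom_apply, hL],
    fun i => by rw [RingQuot.liftAlgHom_mkAlgHom_apply, hT]⟩

end

/-- The Q_c q^a are distinct monomials of the polynomial ring, which embeds in the fraction field.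
-/
theorem isGeneric_fractionRing (r : ℕ) : IsGeneric
    (algebraMap (LaurentRing r) (FractionRing (LaurentRing r)) (laurentVar r none))
    (fun c => algebraMap (LaurentRing r) (FractionRing (LaurentRing r)) (laurentVar r (some c))) := by
  have hinj : Function.Injective
      (algebraMap (LaurentRing r) (FractionRing (LaurentRing r))) := IsFractionRing.injective _ _
  refine ⟨?_, ?_⟩
  · exact ((laurentVar r none).isUnit.map _).ne_zero
  · intro c c' a b h
    rw [← map_pow, ← map_pow, ← map_mul, ← map_mul] at h
    have h1 := hinj h
    simp only [coe_laurentVar] at h1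
    rw [← map_pow, ← map_pow, ← map_mul, ← map_mul] at h1
    have h2 : Function.Injective (algebraMap (MvPolynomial (Option (Fin r)) ℂ) (LaurentRing r)) := by
      refine IsLocalization.injective (M := Submonoid.closure (Set.range X)) _ ?_
      rw [Submonoid.closure_le]
      rintro _ ⟨v, rfl⟩
      exact mem_nonZeroDivisors_of_ne_zero (X_ne_zero v)
    have h3 := h2 h1
    rw [X, X, X, monomial_pow, monomial_pow, monomial_mul, monomial_mul,
      one_pow, one_pow, mul_one] at h3
    have h4 := (monomial_left_injective (one_ne_zero : (1 : ℂ) ≠ 0)) h3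
    have h5 := DFunLike.congr_fun h4 none
    have h6 := DFunLike.congr_fun h4 (some c)
    simp at h5 h6
    refine ⟨?_, h5⟩
    by_contra hne
    simp [Ne.symm hne] at h6


/-! ### Faithfulness of the seminormal representation -/

/-- The fraction field of the base ring. -/
abbrev Frac (r : ℕ) : Type := FractionRing (LaurentRing r)

/-- The image of `q` in the fraction field. -/
def fq (r : ℕ) : Frac r := algebraMap (LaurentRing r) (Frac r) (laurentVar r none)

/-- The images of the `Q_c` in the fraction field. -/
def fQ (r : ℕ) (c : Fin r) : Frac r := algebraMap (LaurentRing r) (Frac r) (laurentVar r (some c))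

theorem isGeneric (r : ℕ) : IsGeneric (fq r) (fQ r) := isGeneric_fractionRing r

theorem algebraMap_content (x : Cell r) :
    algebraMap (LaurentRing r) (Frac r) (content x : LaurentRing r) = cont (fq r) (fQ r) x := by
  have hq := (isGeneric r).q_ne
  rw [cont, eq_mul_inv_iff_mul_eq₀ (pow_ne_zero _ hq), fq, fQ, ← map_pow, ← map_pow, ← map_mul,
    ← map_mul, ← Units.val_pow_eq_pow_val, ← Units.val_pow_eq_pow_val, ← Units.val_mul,
    ← Units.val_mul, content, inv_mul_cancel_right]

/-- The seminormal representation. -/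
def snRep (n r : ℕ) : Hecke n r →ₐ[LaurentRing r] Module.End (Frac r) (Std n r → Frac r) :=
  ((isGeneric r).exists_rep n).choose

theorem snRep_L (k : Fin n) : snRep n r (L r k) = LOp (fq r) (fQ r) k :=
  ((isGeneric r).exists_rep n).choose_spec.1 k

theorem snRep_T (i : Fin (n - 1)) : snRep n r (T r i) = TOp (fq r) (fQ r) i :=
  ((isGeneric r).exists_rep n).choose_spec.2 i

theorem snRep_evalJM (p : MvPolynomial (Fin n) (LaurentRing r)) (v : Std n r → Frac r)
    (t : Std n r) : snRep n r (evalJM n r p) v t =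
      algebraMap (LaurentRing r) (Frac r)
        (MvPolynomial.eval (fun k => (content (t.1 k) : LaurentRing r)) p) * v t := by
  induction p using MvPolynomial.induction_on generalizing v with
  | C a =>
    rw [evalJM_C, AlgHom.commutes, Module.algebraMap_end_apply, eval_C, Pi.smul_apply,
      Algebra.smul_def]
  | add p p' h h' =>
    rw [map_add, map_add, LinearMap.add_apply, Pi.add_apply, h, h', map_add, map_add, add_mul]
  | mul_X p k h =>
    rw [map_mul, map_mul, Module.End.mul_apply, h, evalJM_X, snRep_L, LOp_apply, map_mul, eval_X,
      map_mul, algebraMap_content, mul_assoc]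

/-- Two standard tableaux that differ by a swap, with nonzero seminormal coefficient. -/
def Link (t t' : Std n r) : Prop := ∃ i : Fin (n - 1), t'.1 = t.1 ∘ simpleSwap i ∧
  snB (fq r) (cont (fq r) (fQ r) (t.1 (lo i))) (cont (fq r) (fQ r) (t.1 (hi i))) ≠ 0

theorem Link.symm {t t' : Std n r} (h : Link t t') : Link t' t := by
  obtain ⟨i, h1, h2⟩ := h
  refine ⟨i, by rw [h1, comp_swap_swap], ?_⟩
  rw [h1, Function.comp_apply, Function.comp_apply, simpleSwap_lo, simpleSwap_hi]
  have hlh : (lo i).1 + 1 = (hi i).1 := rfl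
  exact snB_ne_zero_symm ((isGeneric r).cont_ne t.2 (lo_lt_hi i) (by omega)) h2

/-- The functions supported on a set of standard tableaux. -/
def supp (C : Set (Std n r)) : Submodule (Frac r) (Std n r → Frac r) where
  carrier := {v | ∀ t, t ∉ C → v t = 0}
  add_mem' hv hw t ht := by rw [Pi.add_apply, hv t ht, hw t ht, add_zero]
  zero_mem' _ _ := rfl
  smul_mem' a v hv t ht := by rw [Pi.smul_apply, hv t ht, smul_zero]

theorem snRep_mem_supp {C : Set (Std n r)} (hC : ∀ t t', Link t t' → t ∈ C → t' ∈ C)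
    (x : Hecke n r) {v : Std n r → Frac r} (hv : v ∈ supp C) : snRep n r x v ∈ supp C := by
  have hx : x ∈ Algebra.adjoin (LaurentRing r)
      (Set.range (L r : Fin n → Hecke n r) ∪ Set.range (T r)) := by
    rw [adjoin_generators]; trivial
  induction hx using Algebra.adjoin_induction generalizing v with
  | mem x hx =>
    intro t ht
    rcases hx with ⟨k, rfl⟩ | ⟨i, rfl⟩
    · rw [snRep_L, LOp_apply, hv t ht, mul_zero]
    · rw [snRep_T, TOp_apply, freeTOp, extZ_coe, hv t ht, mul_zero, zero_add]
      by_cases h1 : IsStd (t.1 ∘ simpleSwap i)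
      · by_cases h2 : snB (fq r) (cont (fq r) (fQ r) (t.1 (lo i)))
            (cont (fq r) (fQ r) (t.1 (hi i))) = 0
        · rw [h2, zero_mul]
        · have hl : Link t ⟨_, h1⟩ := ⟨i, rfl, h2⟩
          rw [extZ_coe v ⟨_, h1⟩, hv _ fun h3 => ht (hC _ _ hl.symm h3), mul_zero]
      · rw [extZ_of_not _ h1, mul_zero]
  | algebraMap a =>
    rw [AlgHom.commutes, Algebra.algebraMap_eq_smul_one, ← algebraMap_smul (Frac r) a]
    exact Submodule.smul_mem _ _ hv
  | add x y _ _ h h' => rw [map_add]; exact add_mem (h hv) (h' hv)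
  | mul x y _ _ h h' => rw [map_mul]; exact h (h' hv)

theorem evalJM_sub_mem {lam : Multipartition r n} {f : Fin n → Row r} (hf : IsColoring lam f)
    (p : MvPolynomial (Fin n) (LaurentRing r)) :
    evalJM n r p * mElt lam -
      MvPolynomial.eval (fun k => (content (tabCell f k) : LaurentRing r)) p • mElt lam ∈
        dominatingIdeal lam :=
  (Submodule.Quotient.eq _).1 (evalJM_smul_mElt hf p)

/-- There is a multipartition with `m_lam = 1`. -/
theorem exists_mElt_eq_one (h : Nonempty (Std n r)) :
    ∃ (lam : Multipartition r n) (f : Fin n → Row r), IsColoring lam f ∧ mElt lam = 1 := by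
  obtain ⟨f, hm, hi, h0, hs⟩ : ∃ f : Fin n → Row r, Monotone f ∧ Function.Injective f ∧
      (∀ k c, ¬ f k < row c 0) ∧ ∀ c i k, f k = row c (i + 1) → ∃ k', f k' = row c i := by
    obtain ⟨t⟩ := h
    rcases Nat.eq_zero_or_pos n with rfl | hn
    · exact ⟨fun k => k.elim0, fun k => k.elim0, fun k => k.elim0, fun k => k.elim0,
        fun _ _ k => k.elim0⟩
    · have hr : 0 < r := (Nat.zero_le _).trans_lt (t.1 ⟨0, hn⟩).1.2
      -- All entries go into one column of the last component: no component has entries before it,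
      -- so u is an empty product, and the row stabilizer is trivial.
      refine ⟨fun k => row ⟨r - 1, by omega⟩ k, fun k l hkl => le_row.2 (Or.inr ⟨rfl, hkl⟩),
        fun k l hkl => Fin.ext (congrArg idx hkl), fun k c hlt => ?_, fun c i k hk => ?_⟩
      · have := Fin.lt_def.1 (lt_row_zero.1 hlt)
        have h2 := c.2
        change r - 1 < c.1 at this
        omega
      · have h1 : (⟨r - 1, by omega⟩ : Fin r) = c := congrArg comp hk
        have h2 : k.1 = i + 1 := congrArg idx hk
        exact ⟨⟨i, by omega⟩, by rw [← h1]⟩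
  have hp : IsPart f := by
    refine ⟨hm, fun c i => ?_⟩
    rcases Nat.eq_zero_or_pos (len f (row c (i + 1))) with h1 | h1
    · omega
    · obtain ⟨k, hk⟩ := len_pos_iff.1 h1
      have h2 : 0 < len f (row c i) := len_pos_iff.2 (hs c i k hk)
      have h3 : len f (row c (i + 1)) ≤ 1 := Finset.card_le_one.2 fun a ha b hb => hi (by
        rw [(Finset.mem_filter.1 ha).2, (Finset.mem_filter.1 hb).2])
      omega
  obtain ⟨lam, hlam⟩ := hp.exists_isColoring
  refine ⟨lam, f, hlam, ?_⟩
  have hc : ∀ c, cnt f (row c 0) = 0 := fun c =>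
    Finset.card_eq_zero.2 (Finset.filter_eq_empty_iff.2 fun k _ => h0 k c)
  have hstab : stab f = {1} := by
    ext w
    rw [mem_stab, Finset.mem_singleton]
    exact ⟨fun h => Equiv.ext fun k => hi (h k), by rintro rfl k; rfl⟩
  rw [hlam.mElt_eq, mCol, xSum, hstab, Finset.sum_singleton, TPerm_one, mul_one, uPoly]
  simp [hc]

/-- Functions supported on a link-closed set form a subrepresentation, so their annihilator is a
two-sided ideal, and it is enough to kill the generators. -/
theorem snRep_eq_zero_of_mem {C : Set (Std n r)} (hC : ∀ t t', Link t t' → t ∈ C → t' ∈ C)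
    {lam : Multipartition r n}
    (h : ∀ mu, StrictlyDominates mu lam → ∀ v ∈ supp C, snRep n r (mElt mu) v = 0)
    {x : Hecke n r} (hx : x ∈ dominatingIdeal lam) {v : Std n r → Frac r} (hv : v ∈ supp C) :
    snRep n r x v = 0 := by
  have hx' : x ∈ TwoSidedIdeal.span {a : Hecke n r | ∃ mu, StrictlyDominates mu lam ∧ a = mElt mu} :=
    TwoSidedIdeal.mem_asIdeal.1 hx
  let J : TwoSidedIdeal (Hecke n r) := TwoSidedIdeal.mk'
    {x | ∀ v ∈ supp C, snRep n r x v = 0}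
    (fun v _ => by rw [map_zero, LinearMap.zero_apply])
    (fun {x y} hx hy v hv => by rw [map_add, LinearMap.add_apply, hx v hv, hy v hv, add_zero])
    (fun {x} hx v hv => by rw [map_neg, LinearMap.neg_apply, hx v hv, neg_zero])
    (fun {x y} hy v hv => by rw [map_mul, Module.End.mul_apply, hy v hv, map_zero])
    (fun {x y} hx v hv => by
      rw [map_mul, Module.End.mul_apply]; exact hx _ (snRep_mem_supp hC y hv))
  have hJ : ∀ x, x ∈ J ↔ ∀ v ∈ supp C, snRep n r x v = 0 := fun x => TwoSidedIdeal.mem_mk' _ _ _ _ _ _ _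
  refine (hJ x).1 (TwoSidedIdeal.span_le.2 ?_ hx') v hv
  rintro _ ⟨mu, hmu, rfl⟩
  exact (hJ _).2 (h mu hmu)

/-- Some m_lam acts nontrivially, because the one-column shape has m_lam = 1. For the most dominant
such lam the ideal of shapes above it acts by zero, so the congruences modulo that ideal become
genuine eigenvalue equations for m_lam v. -/
theorem exists_minimal_shape {C : Set (Std n r)} (hC : ∀ t t', Link t t' → t ∈ C → t' ∈ C)
    (hne : C.Nonempty) : ∃ (lam : Multipartition r n) (f : Fin n → Row r) (hf : IsColoring lam f),
      (⟨tabCell f, hf.isStd⟩ : Std n r) ∈ C ∧ (∃ v ∈ supp C, snRep n r (mElt lam) v ≠ 0) ∧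
      ∀ x ∈ dominatingIdeal lam, ∀ v ∈ supp C, snRep n r x v = 0 := by
  classical
  let S : Set (Fin n → Row r) :=
    {f | ∃ lam : Multipartition r n, IsColoring lam f ∧ ∃ v ∈ supp C, snRep n r (mElt lam) v ≠ 0}
  have hS : S.Nonempty := by
    obtain ⟨t, ht⟩ := hne
    obtain ⟨lam, f, hf, h1⟩ := exists_mElt_eq_one ⟨t⟩
    refine ⟨f, lam, hf, Pi.single t 1, fun t' ht' =>
      Pi.single_eq_of_ne (fun e : t' = t => ht' (e.symm ▸ ht)) _, ?_⟩
    rw [h1, map_one, Module.End.one_apply]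
    exact Pi.single_ne_zero_iff.2 one_ne_zero
  obtain ⟨f, ⟨lam, hf, v, hv, hne⟩, hmin⟩ := (wellFounded_lt (α := Fin n → Row r)).has_min S hS
  have hkill : ∀ x ∈ dominatingIdeal lam, ∀ v ∈ supp C, snRep n r x v = 0 := by
    intro x hx v hv
    refine snRep_eq_zero_of_mem hC (fun mu hmu v hv => ?_) hx hv
    by_contra hne
    obtain ⟨g, hg⟩ := exists_isColoring mu
    exact hmin g ⟨mu, hg, v, hv, hne⟩ (hf.lt_of_strictlyDominates hg hmu)
  refine ⟨lam, f, hf, ?_, ⟨v, hv, hne⟩, hkill⟩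
  obtain ⟨t, ht⟩ := Function.ne_iff.1 hne
  have htC : t ∈ C := by
    by_contra h
    exact ht (snRep_mem_supp hC _ hv t h)
  -- Where m_lam v does not vanish, the contents of `t` equal those of the initial tableau, and a
  -- standard tableau is determined by its diagonals.
  have key : ∀ k, SameDiag (t.1 k) (tabCell f k) := by
    intro k
    refine (isGeneric r).sameDiag ?_
    have h1 := congrFun (hkill _ (evalJM_sub_mem hf (X k)) v hv) t
    rw [map_sub, map_mul, LinearMap.sub_apply, Module.End.mul_apply, Pi.sub_apply, snRep_evalJM,
      eval_X, eval_X, map_smul, LinearMap.smul_apply, Pi.smul_apply, Algebra.smul_def, ← sub_mul,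
      algebraMap_content, algebraMap_content] at h1
    exact sub_eq_zero.1 ((mul_eq_zero.1 h1).resolve_right ht)
  rwa [show (⟨tabCell f, hf.isStd⟩ : Std n r) = t from
    Subtype.ext (t.2.eq_of_sameDiag hf.isStd key).symm]


/-- Apply `exists_minimal_shape` to all tableaux of the shape of `lam`: the shape found must be
`lam`. So its ideal acts by zero there while m_lam does not, over a field. -/
theorem eq_zero_of_smul_mElt_mem {lam : Multipartition r n} {c : LaurentRing r}
    (h : c • mElt lam ∈ dominatingIdeal lam) : c = 0 := by
  obtain ⟨f, hf⟩ := exists_isColoring lam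
  set t₀ : Std n r := ⟨tabCell f, hf.isStd⟩
  obtain ⟨mu, g, hg, hmem, ⟨v, hv, hne⟩, hkill⟩ := exists_minimal_shape
    (C := {t | Finset.univ.image t.1 = Finset.univ.image t₀.1}) (fun t t' hl ht => by
      obtain ⟨i, h1, -⟩ := hl
      rw [Set.mem_ofPred, ← Set.mem_ofPred.1 ht, h1, ← Finset.image_image,
        Finset.image_univ_equiv]) ⟨t₀, rfl⟩
  have hmu : mu = lam := cellSet_injective (by
    rw [← hf.image_tabCell, ← hg.image_tabCell]; exact hmem)
  subst hmu
  have h1 := hkill _ h v hv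
  rw [map_smul, LinearMap.smul_apply, ← algebraMap_smul (Frac r) c, smul_eq_zero] at h1
  exact (FaithfulSMul.algebraMap_injective (LaurentRing r) (Frac r)) (by
    rw [h1.resolve_right hne, map_zero])

theorem IsColoring.unique {lam : Multipartition r n} {f g : Fin n → Row r} (hf : IsColoring lam f)
    (hg : IsColoring lam g) : f = g :=
  le_antisymm
    ((le_iff_cnt_le hg.mono hf.mono).2 fun p => by
      have h1 := hf.cnt_eq (comp p) (idx p)
      rw [← hg.cnt_eq] at h1
      exact h1.ge)
    ((le_iff_cnt_le hf.mono hg.mono).2 fun p => by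
      have h1 := hf.cnt_eq (comp p) (idx p)
      rw [← hg.cnt_eq] at h1
      exact h1.le)

theorem Link.image_eq {t t' : Std n r} (h : Link t t') :
    Finset.univ.image t'.1 = Finset.univ.image t.1 := by
  obtain ⟨i, h1, -⟩ := h
  rw [h1, ← Finset.image_image, Finset.image_univ_equiv]

/-- Apply `exists_minimal_shape` to the connected component of `t`; links preserve the shape. -/
theorem exists_reflTransGen_initial (t : Std n r) :
    ∃ (lam : Multipartition r n) (f : Fin n → Row r) (hf : IsColoring lam f),
      Finset.univ.image t.1 = cellSet lam ∧ Relation.ReflTransGen Link t ⟨tabCell f, hf.isStd⟩ := by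
  obtain ⟨mu, g, hg, hmem, -⟩ := exists_minimal_shape
    (C := {t' | Relation.ReflTransGen Link t t'}) (fun _ _ hl ht => Relation.ReflTransGen.tail ht hl)
      ⟨t, Relation.ReflTransGen.refl⟩
  refine ⟨mu, g, hg, ?_, hmem⟩
  have key : ∀ t', Relation.ReflTransGen Link t t' →
      Finset.univ.image t'.1 = Finset.univ.image t.1 := by
    intro t' ht'
    induction ht' with
    | refl => rfl
    | tail _ h ih => rw [h.image_eq, ih]
  rw [← key _ hmem, hg.image_tabCell]

theorem reflTransGen_of_image_eq {t t' : Std n r}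
    (h : Finset.univ.image t.1 = Finset.univ.image t'.1) : Relation.ReflTransGen Link t t' := by
  obtain ⟨lam, f, hf, h1, h2⟩ := exists_reflTransGen_initial t
  obtain ⟨mu, g, hg, h3, h4⟩ := exists_reflTransGen_initial t'
  obtain rfl : lam = mu := cellSet_injective (by rw [← h1, ← h3, h])
  obtain rfl := hf.unique hg
  have : Std.Symm (Link (n := n) (r := r)) := ⟨fun _ _ h => h.symm⟩
  exact h2.trans (symm_of _ h4)

/-! ### Matrix units in the image, and the dimension count -/

theorem finite_std (n r : ℕ) : Finite (Std n r) := by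
  classical
  refine Set.Finite.to_subtype (s := {t : Fin n → Cell r | IsStd t}) ?_
  refine Set.Finite.subset ((shapes r n).biUnion fun D => tab n D).finite_toSet fun t ht => ?_
  have ht : IsStd t := ht
  rw [Finset.mem_coe, Finset.mem_biUnion]
  refine ⟨_, mem_shapes.2 ⟨ht.isLower, ?_⟩, mem_tab.2 ⟨ht, rfl⟩⟩
  rw [Finset.card_image_of_injective _ ht.inj, Finset.card_univ, Fintype.card_fin]

open Classical in
/-- The matrix unit with entry `1` in position `(t, t')`. -/
def matUnit (t t' : Std n r) : Module.End (Frac r) (Std n r → Frac r) where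
  toFun v := Pi.single t (v t')
  map_add' v w := by rw [Pi.add_apply, Pi.single_add]
  map_smul' a v := by rw [Pi.smul_apply, Pi.single_smul, RingHom.id_apply]

theorem matUnit_mul (t t' t'' : Std n r) : matUnit t t' * matUnit t' t'' = matUnit t t'' := by
  classical
  refine LinearMap.ext fun v => ?_
  simp [matUnit]

/-- The linear span of the image of the Hecke algebra in the seminormal representation. -/
def repSpan (n r : ℕ) : Subalgebra (Frac r) (Module.End (Frac r) (Std n r → Frac r)) :=
  Submodule.toSubalgebra (Submodule.span (Frac r) (Set.range (snRep n r)))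
    (Submodule.subset_span ⟨1, map_one _⟩) (fun x y hx hy => by
      have h := Submodule.mul_mem_mul hx hy
      rw [Submodule.span_mul_span] at h
      refine Submodule.span_mono ?_ h
      rintro _ ⟨_, ⟨a, rfl⟩, _, ⟨b, rfl⟩, rfl⟩
      exact ⟨a * b, map_mul _ _ _⟩)

theorem snRep_mem (x : Hecke n r) : snRep n r x ∈ repSpan n r :=
  Submodule.subset_span (s := Set.range (snRep n r)) ⟨x, rfl⟩

/-- The diagonal operators in the span contain the content functions of the L_k, which separate
standard tableaux; Lagrange interpolation then produces the indicator of `t`. -/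
theorem matUnit_self_mem (t : Std n r) : matUnit t t ∈ repSpan n r := by
  classical
  have := finite_std n r
  have := Fintype.ofFinite (Std n r)
  let D : Subalgebra (Frac r) (Std n r → Frac r) := (repSpan n r).comap (Algebra.lmul _ _)
  have hsep : ∀ t', t' ≠ t → ∃ y ∈ D, y t' ≠ y t := by
    intro t' hne
    by_contra! h
    refine hne (Subtype.ext (t'.2.eq_of_sameDiag t.2 fun k => (isGeneric r).sameDiag ?_))
    refine h (fun s => cont (fq r) (fQ r) (s.1 k)) ?_
    have h1 := snRep_mem (L r k : Hecke n r)
    rw [snRep_L] at h1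
    exact h1
  choose! y hyD hy using hsep
  let d : Std n r → Frac r := ∏ t' ∈ Finset.univ.erase t,
    (y t' t - y t' t')⁻¹ • (y t' - algebraMap (Frac r) (Std n r → Frac r) (y t' t'))
  have hd : d ∈ D := D.prod_mem fun t' ht' =>
    D.smul_mem (D.sub_mem (hyD _ (Finset.ne_of_mem_erase ht')) (D.algebraMap_mem _)) _
  have hd' : d = Pi.single t 1 := by
    funext s
    simp only [d, Finset.prod_apply, Pi.smul_apply, Pi.sub_apply, Pi.algebraMap_apply,
      Algebra.algebraMap_self, RingHom.id_apply, smul_eq_mul]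
    by_cases hs : s = t
    · subst hs
      rw [Pi.single_eq_same]
      refine Finset.prod_eq_one fun t' ht' => inv_mul_cancel₀ (sub_ne_zero.2 ?_)
      exact (hy t' (Finset.ne_of_mem_erase ht')).symm
    · rw [Pi.single_eq_of_ne hs]
      refine Finset.prod_eq_zero (Finset.mem_erase.2 ⟨hs, Finset.mem_univ s⟩) ?_
      rw [sub_self, mul_zero]
  rw [hd'] at hd
  have h1 : Algebra.lmul (Frac r) (Std n r → Frac r) (Pi.single t 1) ∈ repSpan n r := hd
  convert h1 using 1
  refine LinearMap.ext fun v => funext fun s => ?_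
  change (Pi.single t (v t) : Std n r → Frac r) s = ((Pi.single t 1 : Std n r → Frac r) * v) s
  rw [Pi.mul_apply]
  by_cases hs : s = t
  · subst hs; simp
  · simp [Pi.single_eq_of_ne hs]

/-- Compressing T_i by the diagonal matrix units at `t` and `t'` isolates its off-diagonal
coefficient, nonzero by the definition of a link. -/
theorem Link.matUnit_mem {t t' : Std n r} (h : Link t t') : matUnit t t' ∈ repSpan n r := by
  classical
  obtain ⟨i, h1, h2⟩ := h
  have hne : t ≠ t' := by
    rintro rfl
    have := t.2.inj (congrFun h1 (lo i))
    rw [simpleSwap_lo] at this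
    exact lo_ne_hi i this
  have h3 : matUnit t t * snRep n r (T r i) * matUnit t' t' ∈ repSpan n r :=
    mul_mem (mul_mem (matUnit_self_mem t) (snRep_mem _)) (matUnit_self_mem t')
  have h4 : matUnit t t * snRep n r (T r i) * matUnit t' t' =
      snB (fq r) (cont (fq r) (fQ r) (t.1 (lo i))) (cont (fq r) (fQ r) (t.1 (hi i))) •
        matUnit t t' := by
    rw [snRep_T]
    refine LinearMap.ext fun v => funext fun s => ?_
    change (Pi.single t (TOp (fq r) (fQ r) i (Pi.single t' (v t')) t) : Std n r → Frac r) s =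
      (_ : Frac r) • (Pi.single t (v t') : Std n r → Frac r) s
    rw [TOp_apply, freeTOp, extZ_coe, ← h1, extZ_coe, Pi.single_eq_same,
      Pi.single_eq_of_ne hne, mul_zero, zero_add]
    by_cases hs : s = t
    · subst hs; simp
    · simp [Pi.single_eq_of_ne hs]
  rw [h4] at h3
  have h5 := Subalgebra.smul_mem _ h3
    (snB (fq r) (cont (fq r) (fQ r) (t.1 (lo i))) (cont (fq r) (fQ r) (t.1 (hi i))))⁻¹
  rwa [smul_smul, inv_mul_cancel₀ h2, one_smul] at h5

theorem matUnit_mem {t t' : Std n r} (h : Finset.univ.image t.1 = Finset.univ.image t'.1) :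
    matUnit t t' ∈ repSpan n r := by
  induction reflTransGen_of_image_eq h with
  | refl => exact matUnit_self_mem t
  | @tail b c h1 h2 ih =>
    rw [← matUnit_mul t b c]
    exact mul_mem (ih (by rw [h, h2.image_eq])) h2.matUnit_mem

theorem linearIndependent_matUnit :
    LinearIndependent (Frac r) fun p : Std n r × Std n r => matUnit p.1 p.2 := by
  classical
  rw [linearIndependent_iff']
  intro s g hg p hp
  have h1 := congrFun (LinearMap.congr_fun hg (Pi.single p.2 1)) p.1
  rw [LinearMap.sum_apply, Finset.sum_apply, Finset.sum_eq_single p] at h1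
  · change g p • (Pi.single p.1 ((Pi.single p.2 1 : Std n r → Frac r) p.2) : Std n r → Frac r) p.1 = 0
      at h1
    simpa using h1
  · intro p' _ hne
    change g p' • (Pi.single p'.1 ((Pi.single p.2 1 : Std n r → Frac r) p'.2) : Std n r → Frac r) p.1 = 0
    by_cases e : p.1 = p'.1
    · have : p'.2 ≠ p.2 := fun e' => hne (Prod.ext e.symm e')
      rw [Pi.single_eq_of_ne this, Pi.single_zero, Pi.zero_apply, smul_zero]
    · rw [Pi.single_eq_of_ne e, smul_zero]
  · exact fun h => absurd hp h

theorem repSpan_le : Subalgebra.toSubmodule (repSpan n r) ≤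
    Submodule.span (Frac r) (Set.range fun x => snRep n r (stdElt (n := n) (r := r) x)) := by
  refine Submodule.span_le.2 ?_
  rintro _ ⟨x, rfl⟩
  have hx : x ∈ Submodule.span (LaurentRing r) (Set.range (stdElt (n := n) (r := r))) := by
    rw [span_stdElt]; trivial
  induction hx using Submodule.span_induction with
  | mem x hx =>
    obtain ⟨y, rfl⟩ := hx
    exact Submodule.subset_span ⟨y, rfl⟩
  | zero => rw [map_zero]; exact zero_mem _
  | add x y _ _ h h' => rw [map_add]; exact add_mem h h'
  | smul a x _ h =>
    rw [map_smul, ← algebraMap_smul (Frac r) a]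
    exact Submodule.smul_mem _ _ h

/-- There are r^n n! of these operators, and their span contains as many linearly independent matrix
units, one for each pair of tableaux of the same shape. -/
theorem linearIndependent_snRep_stdElt :
    LinearIndependent (Frac r) fun x => snRep n r (stdElt (n := n) (r := r) x) := by
  classical
  have := finite_std n r
  rw [linearIndependent_iff_card_le_finrank_span]
  obtain ⟨P, hP, hcard⟩ := exists_finset_pairs r n
  let e : P → Std n r × Std n r := fun p => (⟨p.1.1, (hP _ p.2).1⟩, ⟨p.1.2, (hP _ p.2).2.1⟩)
  have he : Function.Injective e := fun p p' h => by
    have h1 := congrArg (fun x => x.1.1) h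
    have h2 := congrArg (fun x => x.2.1) h
    exact Subtype.ext (Prod.ext h1 h2)
  have hli := linearIndependent_matUnit (n := n) (r := r) |>.comp e he
  have h1 : Fintype.card ((Fin n → Fin r) × Equiv.Perm (Fin n)) = P.card := by
    rw [hcard, Fintype.card_prod, Fintype.card_fun, Fintype.card_perm]
    simp
  rw [h1, ← Fintype.card_coe, ← finrank_span_eq_card hli]
  refine Submodule.finrank_mono (Submodule.span_le.2 ?_)
  rintro _ ⟨p, rfl⟩
  exact repSpan_le (matUnit_mem (hP _ p.2).2.2)

/-- The seminormal representation is faithful. -/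
theorem snRep_injective : Function.Injective (snRep n r) := by
  refine (injective_iff_map_eq_zero _).2 fun x hx => ?_
  have h1 : x ∈ Submodule.span (LaurentRing r) (Set.range (stdElt (n := n) (r := r))) := by
    rw [span_stdElt]; trivial
  obtain ⟨c, rfl⟩ := (Submodule.mem_span_range_iff_exists_fun _).1 h1
  rw [map_sum] at hx
  have h2 := Fintype.linearIndependent_iff.1 linearIndependent_snRep_stdElt
    (fun y => algebraMap (LaurentRing r) (Frac r) (c y)) (by
      rw [← hx]
      exact Finset.sum_congr rfl fun y _ => by rw [map_smul, algebraMap_smul])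
  refine Finset.sum_eq_zero fun y _ => ?_
  rw [(FaithfulSMul.algebraMap_injective (LaurentRing r) (Frac r)) ((h2 y).trans (map_zero _).symm),
    zero_smul]


/-! ### The central characters -/

theorem exists_initialTableau (lam : Multipartition r n) : ∃ t : Fin n → Cell r,
    ∃ f : Fin n → Row r, IsColoring lam f ∧ t = tabCell f :=
  let ⟨f, hf⟩ := exists_isColoring lam
  ⟨_, f, hf, rfl⟩

/-- The initial tableau of a multipartition. -/
def initialTableau (lam : Multipartition r n) : Fin n → Cell r :=
  (exists_initialTableau lam).choose

/-- The value of a polynomial at the contents of the initial tableau. -/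
def evalContent (lam : Multipartition r n) :
    MvPolynomial (Fin n) (LaurentRing r) →ₐ[LaurentRing r] LaurentRing r :=
  MvPolynomial.aeval fun k => (content (initialTableau lam k) : LaurentRing r)

theorem evalContent_apply (lam : Multipartition r n) (p : MvPolynomial (Fin n) (LaurentRing r)) :
    evalContent lam p =
      MvPolynomial.eval (fun k => (content (initialTableau lam k) : LaurentRing r)) p := by
  rw [evalContent, MvPolynomial.aeval_eq_eval]

/-- Centrality transfers the eigenvalue from the generator to the whole cyclic module. Conversely
two scalars acting alike on the generator differ by a `c` with c m_lam in the ideal, so they agree.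
-/
theorem smul_specht_iff {p : MvPolynomial (Fin n) (LaurentRing r)} (hp : p.IsSymmetric)
    (lam : Multipartition r n) (c : LaurentRing r) :
    (∀ x : Specht lam, evalJM n r p • x = c • x) ↔ evalContent lam p = c := by
  obtain ⟨f, hf, ht⟩ := (exists_initialTableau lam).choose_spec
  have hm : evalJM n r p • (Submodule.Quotient.mk (mElt lam) : Hecke n r ⧸ dominatingIdeal lam) =
      evalContent lam p •
        (Submodule.Quotient.mk (mElt lam) : Hecke n r ⧸ dominatingIdeal lam) := by
    rw [evalContent_apply, initialTableau, ht]
    exact evalJM_smul_mElt hf p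
  constructor
  · intro h
    have h1 := congrArg Subtype.val (h ⟨_, Submodule.mem_span_singleton_self _⟩)
    have h2 : evalContent lam p •
        (Submodule.Quotient.mk (mElt lam) : Hecke n r ⧸ dominatingIdeal lam) =
        c • (Submodule.Quotient.mk (mElt lam) : Hecke n r ⧸ dominatingIdeal lam) :=
      hm.symm.trans h1
    have h3 : evalContent lam p • mElt lam - c • mElt lam ∈ dominatingIdeal lam :=
      (Submodule.Quotient.eq _).1 h2
    have h4 : evalContent lam p = (evalContent lam p - c) + c := by ring
    rw [h4, add_smul, add_sub_cancel_right] at h3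
    exact sub_eq_zero.1 (eq_zero_of_smul_mElt_mem h3)
  · rintro rfl ⟨x, hx⟩
    obtain ⟨a, rfl⟩ := Submodule.mem_span_singleton.1 hx
    refine Subtype.ext ?_
    change evalJM n r p • a • (Submodule.Quotient.mk (mElt lam) : Hecke n r ⧸ dominatingIdeal lam) =
      evalContent lam p •
        (a • (Submodule.Quotient.mk (mElt lam) : Hecke n r ⧸ dominatingIdeal lam))
    rw [← mul_smul, ← (commute_of_isSymmetric hp a).eq, mul_smul, hm]
    exact hecke_smul_comm (n := n) (r := r) (M := Hecke n r ⧸ dominatingIdeal lam) _ _ _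

/-- Links permute contents, so a symmetric polynomial takes one value on all tableaux connected to a
given initial tableau. In the faithful seminormal representation its image is diagonal with these
values. -/
theorem evalJM_eq_zero {p : MvPolynomial (Fin n) (LaurentRing r)} (hp : p.IsSymmetric)
    (h : ∀ lam : Multipartition r n, evalContent lam p = 0) : evalJM n r p = 0 := by
  have hlink : ∀ t t' : Std n r, Link t t' →
      MvPolynomial.eval (fun k => (content (t'.1 k) : LaurentRing r)) p =
        MvPolynomial.eval (fun k => (content (t.1 k) : LaurentRing r)) p := by
    rintro t t' ⟨i, h1, -⟩
    rw [h1]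
    nth_rewrite 2 [← hp (simpleSwap i)]
    rw [eval_rename]
    rfl
  refine snRep_injective ?_
  rw [map_zero]
  refine LinearMap.ext fun v => funext fun t => ?_
  obtain ⟨lam, f, hf, -, h2⟩ := exists_reflTransGen_initial t
  have h3 : MvPolynomial.eval (fun k => (content (t.1 k) : LaurentRing r)) p = 0 := by
    induction h2 using Relation.ReflTransGen.head_induction_on with
    | refl =>
      obtain ⟨g, hg, hg'⟩ := (exists_initialTableau lam).choose_spec
      obtain rfl := hf.unique hg
      have := h lam
      rwa [evalContent_apply, initialTableau, hg'] at this
    | head h4 _ ih => rw [← hlink _ _ h4, ih]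
  rw [snRep_evalJM, h3, map_zero, zero_mul]
  rfl

theorem exists_isSymmetric (z : JMCenter n r) :
    ∃ p : MvPolynomial (Fin n) (LaurentRing r), p.IsSymmetric ∧ evalJM n r p = z := by
  obtain ⟨p, hp, h⟩ := Subalgebra.mem_map.1 z.2
  exact ⟨p, (mem_symmetricSubalgebra p).1 hp, h⟩

/-- Independence of the chosen symmetric polynomial: both values are the scalar by which the same
element acts, and that scalar is unique. This is what makes `centralChar` multiplicative and
additive. -/
theorem evalContent_eq {p p' : MvPolynomial (Fin n) (LaurentRing r)} (hp : p.IsSymmetric)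
    (hp' : p'.IsSymmetric) (h : evalJM n r p = evalJM n r p') (lam : Multipartition r n) :
    evalContent lam p = evalContent lam p' := by
  refine (smul_specht_iff hp lam _).1 ?_
  rw [h]
  exact (smul_specht_iff hp' lam _).2 rfl

/-- The central characters of the Jucys–Murphy center on all Specht modules. -/
def centralChar (n r : ℕ) :
    JMCenter n r →ₐ[LaurentRing r] (Multipartition r n → LaurentRing r) where
  toFun z lam := evalContent lam (exists_isSymmetric z).choose
  map_one' := by
    funext lam
    have h := (exists_isSymmetric (1 : JMCenter n r)).choose_spec
    rw [evalContent_eq h.1 (IsSymmetric.one) (by rw [h.2, map_one]; rfl), map_one]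
    rfl
  map_zero' := by
    funext lam
    have h := (exists_isSymmetric (0 : JMCenter n r)).choose_spec
    rw [evalContent_eq h.1 (IsSymmetric.zero) (by rw [h.2, map_zero]; rfl), map_zero]
    rfl
  map_mul' z w := by
    funext lam
    have hz := (exists_isSymmetric z).choose_spec
    have hw := (exists_isSymmetric w).choose_spec
    have h := (exists_isSymmetric (z * w)).choose_spec
    rw [evalContent_eq h.1 (hz.1.mul hw.1) (by rw [h.2, map_mul, hz.2, hw.2]; rfl), map_mul]
    rfl
  map_add' z w := by
    funext lam
    have hz := (exists_isSymmetric z).choose_spec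
    have hw := (exists_isSymmetric w).choose_spec
    have h := (exists_isSymmetric (z + w)).choose_spec
    rw [evalContent_eq h.1 (hz.1.add hw.1) (by rw [h.2, map_add, hz.2, hw.2]; rfl), map_add]
    rfl
  commutes' a := by
    funext lam
    have h := (exists_isSymmetric (algebraMap (LaurentRing r) (JMCenter n r) a)).choose_spec
    rw [evalContent_eq h.1 (IsSymmetric.C a) (by rw [h.2, evalJM_C]; rfl), evalContent_apply, eval_C]
    rfl

end ArikiKoike
end

theorem mainTheorem3 (n r : ℕ) :
    ∃ σ : ArikiKoike.JMCenter n r →ₐ[ArikiKoike.LaurentRing r]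
        (ArikiKoike.Multipartition r n → ArikiKoike.LaurentRing r),
      (∀ (z : ArikiKoike.JMCenter n r) (lam : ArikiKoike.Multipartition r n)
          (c : ArikiKoike.LaurentRing r),
        (∀ x : ArikiKoike.Specht lam, (z : ArikiKoike.Hecke n r) • x = c • x) ↔ σ z lam = c) ∧
      Function.Injective σ := by
  refine ⟨ArikiKoike.centralChar n r, fun z lam c => ?_, (injective_iff_map_eq_zero _).2 fun z hz => ?_⟩
  · obtain ⟨hp, h⟩ := (ArikiKoike.exists_isSymmetric z).choose_spec
    rw [← h]
    exact ArikiKoike.smul_specht_iff hp lam c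
  · obtain ⟨hp, h⟩ := (ArikiKoike.exists_isSymmetric z).choose_spec
    refine Subtype.ext (h.symm.trans ?_)
    exact ArikiKoike.evalJM_eq_zero hp fun lam => congrFun hz lam
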